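/- **Setting.** Fix $T>0$, $d,\nu\in\mathbb N$ and an open set $U\subset\mathbb R^d$. $D([0,T],U)$ is the set of càdlàg paths with values and left limits in $U$, with the supremum norm; $\mathrm{CBV}([0,T],S)$ is the set of continuous $S$-valued paths whose components have bounded variation; $X^t=X(\cdot\wedge t)$. A functional $F:[0,T]\times D([0,T],U)\times \mathrm{CBV}([0,T],S)\to\mathbb R$ ($S\subset\mathbb R^m$ open) is *non-anticipative* if $F(t,X,A)=F(t,X^t,A^t)$. It is - *boundedness-preserving* if for each $A$ and each compact $K\subset U$, $|F(t,X,A)|\le C$ for all $t$ and all $K$-valued $X$, with some constant $C$; - *continuous at fixed times* if for all $\varepsilon,t,X,A$ there is $\delta>0$ with $|F(t,X,A)-F(t,Y,A)|<\varepsilon$ whenever $\|X^t-Y^t\|_\infty<\delta$; - *left-continuous* if for all $t\in(0,T]$, $\varepsilon$, $X$, $A$ there is $\delta>0$ with $|F(t,X,A)-F(t-h,Y,A)|<\varepsilon$ whenever $0\le h<\delta$, $h\le t$ and $\|X^t-Y^{t-h}\|_\infty<\delta$; - *continuous in $X$ locally uniformly in $t$* if for all $\varepsilon,t,X,A$ there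 is $\delta>0$ with $|F(u,X,A)-F(u,Y,A)|<\varepsilon$ whenever $\|X-Y\|_\infty<\delta$ and $|t-u|<\delta$; - *horizontally differentiable* with horizontal derivative $(\mathscr D_0F,\dots,\mathscr D_mF)$ if the $\mathscr D_iF$ are non-anticipative and boundedness-preserving, $[s,t]\ni r\mapsto \mathscr D_iF(r,X^s,A)$ is Borel measurable, and $F(t,X^s,A)-F(s,X^s,A)=\sum_{i=0}^m\int_s^t\mathscr D_iF(r,X^s,A)\,dA_i(r)$ for all $s<t$, $X$, $A$, where $A_0(r)=r$; - *vertically differentiable* with vertical derivative $\nabla_XF(t,X,A)=(\partial_iF(t,X,A))_{i\le d}$ if for all $(t,X,A)$ the map $v\mapsto F(t,X+v\mathbf 1_{[t,T]},A^t)$, defined for small $v\in\mathbb R^d$, is differentiable at $0$ with gradient $\nabla_XF(t,X,A)$. $\mathbb C^{1,2}_c(U,S)$ is the set of non-anticipative $F$ that are left-continuous, boundedness-preserving, continuous in $X$ locally uniformly in $t$, horizontally differentiable with a horizontal derivative that is continuous at fixed times, and twice vertically differentiable with $\nabla_XF$ and $\nabla_X^2F$ left-continuous and boundedness-preserving. A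 functional $\xi:[0,T]\times D([0,T],U)\to\mathbb R^d$ is an *admissible functional integrand* if $\xi(t,X)=\nabla_XF(t,X,A)$ for all $(t,X)$, for some $m$, some open $S\subset\mathbb R^m$, some $A\in \mathrm{CBV}([0,T],S)$ and some $F\in\mathbb C^{1,2}_c(U,S)$. Fix finite sets $\mathbb T_1\subset\mathbb T_2\subset\cdots\subset[0,T]$ containing $0$ and $T$ with mesh tending to $0$; $s'$ is the successor of $s$ in $\mathbb T_n$ ($T'=T$). A real continuous path $x$ has *continuous quadratic variation* $[x]$ if $\sum_{s\in\mathbb T_n,\,s\le t}(x(s')-x(s))^2\to[x](t)$ for all $t\in(0,T]$ and $[x]$ is continuous with $[x](0)=0$; a path $X$ in $\mathbb R^d$ has continuous quadratic variation $([X_i,X_j])_{i,j}$ if all $X_i$ and $X_i+X_j$ do, and $[X_i,X_j]=\frac12([X_i+X_j]-[X_i]-[X_j])$. For $X\in C([0,T],U)$ put $X^n=\sum_{s\in\mathbb T_n}X(s')\mathbf 1_{[s,s')}+X(T)\mathbf 1_{\{T\}}$, and for $s\in\mathbb T_n$ let $X^{n,s-}$ be the path equal to $X^n$ on $[0,s)$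 and to $X(s)$ on $[s,T]$. The *pathwise Itô integral* is $$\int_0^t\xi(s,X)\,dX(s)=\lim_{n\to\infty}\sum_{s\in\mathbb T_n,\,s\le t}\xi(s,X^{n,s-})\cdot(X(s')-X(s)).$$ **Theorem.** Let $\xi_{(1)},\dots,\xi_{(\nu)}:[0,T]\times D([0,T],U)\to\mathbb R^d$ be admissible functional integrands and let $X\in C([0,T],U)$ have continuous quadratic variation $[X]$. Then the integrals $Y_\ell(t)=\int_0^t\xi_{(\ell)}(s,X)\,dX(s)$ exist for all $t\in[0,T]$ and $\ell=1,\dots,\nu$, $Y=(Y_1,\dots,Y_\nu)$ belongs to $C([0,T],\mathbb R^\nu)$, and the following hold. (a) There are $q\in\mathbb N$, an open set $\widetilde S\subset\mathbb R^q$, $\widetilde A\in \mathrm{CBV}([0,T],\widetilde S)$ and $\widetilde F_1,\dots,\widetilde F_\nu\in\mathbb C^{1,2}_c(U,\widetilde S)$ such that, with $\widetilde F=(\widetilde F_1,\dots,\widetilde F_\nu)$, $$Y(t)=\widetilde F(t,X,\widetilde A)\quad\text{for all }t\in[0,T],$$ and $\nabla_X\widetilde F_\ell(t,\widetilde X,\widetilde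 A)=\xi_{(\ell)}(t,\widetilde X)$ for all $\ell$, $t\in[0,T]$ and $\widetilde X\in D([0,T],U)$. (b) Let $\widetilde F,\widetilde A$ be any pair as in (a) and let $\eta:[0,T]\times D([0,T],\mathbb R^\nu)\to\mathbb R^\nu$ be an admissible functional integrand. Then $\widetilde F(\cdot,\widetilde X,\widetilde A)\in D([0,T],\mathbb R^\nu)$ for every $\widetilde X\in D([0,T],U)$, so that $$\zeta(t,\widetilde X)=\sum_{\ell=1}^\nu\eta_\ell\big(t,\widetilde F(\cdot,\widetilde X,\widetilde A)\big)\,\xi_{(\ell)}(t,\widetilde X),\qquad \widetilde X\in D([0,T],U),$$ is well defined, and $\zeta$ is an admissible functional integrand. Moreover $\zeta(s,X)=\sum_{\ell=1}^\nu\eta_\ell(s,Y)\xi_{(\ell)}(s,X)$ for all $s\in[0,T]$. (c) If, in addition, $Y$ has continuous quadratic variation given by $[Y_k,Y_\ell](t)=\sum_{i,j=1}^d\int_0^t\xi_{(k),i}(s,X)\,\xi_{(\ell),j}(s,X)\,d[X_i,X_j](s)$ for all $t$, $k$, $\ell$, then the two integrals below exist and $$\int_0^T\eta(s,Y)\,dY(s)=\int_0^T\zeta(s,X)\,dX(s),$$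 where the right-hand side is what is meant by $\int_0^T\sum_{\ell=1}^\nu\eta_\ell(s,Y)\,\xi_{(\ell)}(s,X)\,dX(s)$. -/

import Mathlib

open Set Filter Topology MeasureTheory
open scoped ENNReal

namespace PathwiseIto

/-- The time interval `[0,T]`. -/
abbrev Time (T : ℝ) : Type := ↥(Set.Icc (0 : ℝ) T)

/-- `ℝ^d` with the Euclidean norm. -/
abbrev Vec (d : ℕ) : Type := EuclideanSpace ℝ (Fin d)

instance (T : ℝ) : CompactIccSpace (Time T) :=
  ⟨fun {_ _} => isClosed_Icc.isCompact⟩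

/-! ### Path spaces -/

/-- `D([0,T],U)`: right-continuous `U`-valued paths whose left limits exist and lie in `U`.
At time `0` the condition `left_lim` is void, since `𝓝[<] 0 = ⊥` in `[0,T]`. -/
@[ext]
structure Cadlag (T : ℝ) {d : ℕ} (U : Set (Vec d)) where
  toFun : Time T → Vec d
  mem : ∀ t, toFun t ∈ U
  right_cont : ∀ t, ContinuousWithinAt toFun (Ici t) t
  left_lim : ∀ t, ∃ l ∈ U, Tendsto toFun (𝓝[<] t) (𝓝 l)

/-- `C([0,T],U)`. -/
@[ext]
structure CPath (T : ℝ) {d : ℕ} (U : Set (Vec d)) where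
  toFun : Time T → Vec d
  mem : ∀ t, toFun t ∈ U
  cont : Continuous toFun

/-- `CBV([0,T],S)`: continuous `S`-valued paths whose components are of bounded variation. -/
@[ext]
structure CBV (T : ℝ) {m : ℕ} (S : Set (Vec m)) where
  toFun : Time T → Vec m
  mem : ∀ t, toFun t ∈ S
  cont : Continuous toFun
  bv : ∀ i, BoundedVariationOn (fun t => toFun t i) univ

instance {T : ℝ} {d : ℕ} {U : Set (Vec d)} : CoeFun (Cadlag T U) fun _ => Time T → Vec d :=
  ⟨Cadlag.toFun⟩

instance {T : ℝ} {d : ℕ} {U : Set (Vec d)} : CoeFun (CPath T U) fun _ => Time T → Vec d :=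
  ⟨CPath.toFun⟩

instance {T : ℝ} {m : ℕ} {S : Set (Vec m)} : CoeFun (CBV T S) fun _ => Time T → Vec m :=
  ⟨CBV.toFun⟩

/-- A continuous path as a càdlàg path. -/
def CPath.toCadlag {T : ℝ} {d : ℕ} {U : Set (Vec d)} (X : CPath T U) : Cadlag T U where
  toFun := X
  mem := X.mem
  right_cont _ := X.cont.continuousWithinAt
  left_lim t := ⟨X t, X.mem t, X.cont.continuousAt.tendsto.mono_left nhdsWithin_le_nhds⟩

/-- The stopped path `X^t = (X(t ∧ s))_{s ∈ [0,T]}`. -/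
def Cadlag.stopped {T : ℝ} {d : ℕ} {U : Set (Vec d)} (X : Cadlag T U) (t : Time T) :
    Cadlag T U where
  toFun s := X (min t s)
  mem s := X.mem _
  right_cont s := by
    have h : ContinuousWithinAt (fun u : Time T => min t u) (Ici s) s :=
      (continuous_const.min continuous_id).continuousWithinAt
    exact ContinuousWithinAt.comp (t := Ici (min t s)) (X.right_cont (min t s)) h
      fun u hu => min_le_min (le_refl t) (mem_Ici.1 hu)
  left_lim s := by
    rcases le_or_gt s t with hst | hst
    · obtain ⟨l, hl, hlim⟩ := X.left_lim s
      refine ⟨l, hl, hlim.congr' ?_⟩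
      filter_upwards [self_mem_nhdsWithin] with u hu
      rw [min_eq_right ((le_of_lt hu).trans hst)]
    · refine ⟨X t, X.mem t, tendsto_const_nhds.congr' ?_⟩
      filter_upwards [mem_nhdsWithin_of_mem_nhds (Ioi_mem_nhds hst)] with u hu
      rw [min_eq_left (le_of_lt hu)]

/-- The stopped path `A^t`. -/
def CBV.stopped {T : ℝ} {m : ℕ} {S : Set (Vec m)} (A : CBV T S) (t : Time T) : CBV T S where
  toFun s := A (min t s)
  mem s := A.mem _
  cont := A.cont.comp (continuous_const.min continuous_id)
  bv i := by
    have h : MonotoneOn (fun s : Time T => min t s) univ :=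
      fun a _ b _ hab => min_le_min le_rfl hab
    exact ne_top_of_le_ne_top (A.bv i)
      (eVariationOn.comp_le_of_monotoneOn (fun s => A s i) _ h (mapsTo_univ _ _))

/-- `‖X - Y‖_∞`, as an element of `[0,∞]`. -/
noncomputable def supDist {T : ℝ} {d : ℕ} {U : Set (Vec d)} (X Y : Cadlag T U) : ℝ≥0∞ :=
  ⨆ u, edist (X u) (Y u)

open Classical in
/-- The path `X + v 1_{[t,T]}`. As the closure of the range of `X` is a compact subset of the
open set `U`, this path belongs to `D([0,T],U)` for all sufficiently small `v`; for the other `v`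
(which are irrelevant for derivatives at `v = 0`) the value is `X` by convention. -/
noncomputable def Cadlag.bump {T : ℝ} {d : ℕ} {U : Set (Vec d)} (X : Cadlag T U) (t : Time T)
    (v : Vec d) : Cadlag T U :=
  if h : ∃ Z : Cadlag T U, ∀ u, Z u = X u + (if t ≤ u then v else 0) then h.choose else X

/-! ### Functionals and their regularity -/

/-- Real-valued functionals on `[0,T] × D([0,T],U) × CBV([0,T],S)`. -/
abbrev Functional (T : ℝ) {d m : ℕ} (U : Set (Vec d)) (S : Set (Vec m)) : Type :=
  Time T → Cadlag T U → CBV T S → ℝ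

section Functionals

variable {T : ℝ} {d m : ℕ} {U : Set (Vec d)} {S : Set (Vec m)}

/-- `F` is non-anticipative. -/
def NonAnticipative (F : Functional T U S) : Prop :=
  ∀ t X A, F t X A = F t (X.stopped t) (A.stopped t)

/-- `F` is boundedness-preserving. -/
def BoundednessPreserving (F : Functional T U S) : Prop :=
  ∀ A : CBV T S, ∀ K : Set (Vec d), IsCompact K → K ⊆ U →
    ∃ C : ℝ, ∀ (t : Time T) (X : Cadlag T U), (∀ u, X u ∈ K) → |F t X A| ≤ C

/-- `F` is continuous at fixed times. -/
def ContinuousAtFixedTimes (F : Functional T U S) : Prop :=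
  ∀ ε > (0 : ℝ), ∀ t X A, ∃ δ > (0 : ℝ), ∀ Y : Cadlag T U,
    supDist (X.stopped t) (Y.stopped t) < ENNReal.ofReal δ → |F t X A - F t Y A| < ε

/-- `F` is left-continuous; the time `s` plays the role of `t - h` with `h ∈ [0,δ)`. -/
def LeftContinuous (F : Functional T U S) : Prop :=
  ∀ t : Time T, 0 < (t : ℝ) → ∀ ε > (0 : ℝ), ∀ X A, ∃ δ > (0 : ℝ),
    ∀ s : Time T, s ≤ t → (t : ℝ) - s < δ → ∀ Y : Cadlag T U,
      supDist (X.stopped t) (Y.stopped s) < ENNReal.ofReal δ → |F t X A - F s Y A| < ε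

/-- `F` is continuous in `X` locally uniformly in `t`. -/
def ContinuousLocUnif (F : Functional T U S) : Prop :=
  ∀ ε > (0 : ℝ), ∀ (t : Time T) (X : Cadlag T U) (A : CBV T S), ∃ δ > (0 : ℝ),
    ∀ (u : Time T) (Y : Cadlag T U), supDist X Y < ENNReal.ofReal δ → |(t : ℝ) - u| < δ →
      |F u X A - F u Y A| < ε

end Functionals

open Classical in
/-- The Lebesgue–Stieltjes integral `∫_B φ(r) da(r)` over a Borel set `B ⊆ [0,T]` with respect to
the signed measure of a function `a` of bounded variation (the value is `0` by convention if `a`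
is not of bounded variation). -/
noncomputable def lsIntegral {T : ℝ} (φ a : Time T → ℝ) (B : Set (Time T)) : ℝ :=
  if h : BoundedVariationOn a univ then
    (h.vectorMeasure.restrict B).integral φ (ContinuousLinearMap.lsmul ℝ ℝ)
  else 0

/-- The components `A_0, A_1, …, A_m` of `A`, with the convention `A_0(r) = r`. -/
def CBV.component {T : ℝ} {m : ℕ} {S : Set (Vec m)} (A : CBV T S) : Fin (m + 1) → Time T → ℝ :=
  Fin.cons (fun r => (r : ℝ)) (fun i r => A r i)

section Derivatives

variable {T : ℝ} {d m : ℕ} {U : Set (Vec d)} {S : Set (Vec m)}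

/-- `D = (D_0, …, D_m)` is a horizontal derivative of `F`. -/
structure IsHorizontalDerivative (F : Functional T U S) (D : Fin (m + 1) → Functional T U S) :
    Prop where
  nonAnticipative : ∀ i, NonAnticipative (D i)
  boundednessPreserving : ∀ i, BoundednessPreserving (D i)
  measurable : ∀ i (s t : Time T), s < t → ∀ (X : Cadlag T U) (A : CBV T S),
    Measurable fun r : Icc s t => D i r (X.stopped s) A
  integral_eq : ∀ s t : Time T, s < t → ∀ (X : Cadlag T U) (A : CBV T S),
    F t (X.stopped s) A - F s (X.stopped s) A =
      ∑ i, lsIntegral (fun r => D i r (X.stopped s) A) (A.component i) (Ioc s t)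

/-- `F` is vertically differentiable at all `(t,X,A)`. -/
def VerticallyDifferentiable (F : Functional T U S) : Prop :=
  ∀ (t : Time T) (X : Cadlag T U) (A : CBV T S),
    DifferentiableAt ℝ (fun v : Vec d => F t (X.bump t v) (A.stopped t)) 0

/-- The vertical derivative `∇_X F(t,X,A)`. -/
noncomputable def vgrad (F : Functional T U S) (t : Time T) (X : Cadlag T U) (A : CBV T S) :
    Vec d :=
  gradient (fun v : Vec d => F t (X.bump t v) (A.stopped t)) 0

/-- The partial vertical derivative `∂_i F`. -/
noncomputable def vpartial (i : Fin d) (F : Functional T U S) : Functional T U S :=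
  fun t X A => vgrad F t X A i

/-- The class `ℂ^{1,2}_b(U,S)`. -/
structure IsC12b (F : Functional T U S) : Prop where
  nonAnticipative : NonAnticipative F
  leftContinuous : LeftContinuous F
  horizontal : ∃ D : Fin (m + 1) → Functional T U S,
    IsHorizontalDerivative F D ∧ ∀ i, ContinuousAtFixedTimes (D i)
  vdiff : VerticallyDifferentiable F
  vdiff_two : ∀ i, VerticallyDifferentiable (vpartial i F)
  grad_leftContinuous : ∀ i, LeftContinuous (vpartial i F)
  grad_boundednessPreserving : ∀ i, BoundednessPreserving (vpartial i F)
  hess_leftContinuous : ∀ i j, LeftContinuous (vpartial i (vpartial j F))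
  hess_boundednessPreserving : ∀ i j, BoundednessPreserving (vpartial i (vpartial j F))

/-- The class `ℂ^{1,2}_c(U,S)`. -/
structure IsC12c (F : Functional T U S) : Prop extends IsC12b F where
  continuousLocUnif : ContinuousLocUnif F
  boundednessPreserving : BoundednessPreserving F

/-- `ξ : [0,T] × D([0,T],U) → ℝ^d` is an admissible functional integrand. -/
def IsAdmissible (ξ : Time T → Cadlag T U → Vec d) : Prop :=
  ∃ (m : ℕ) (S : Set (Vec m)) (A : CBV T S) (F : Functional T U S),
    IsOpen S ∧ IsC12c F ∧ ∀ t X, ξ t X = vgrad F t X A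

end Derivatives

/-! ### Partitions, quadratic variation and the Itô integral -/

open Classical in
/-- The successor `t' = min {u ∈ P | u > t}`, and `t' = t` if there is no such `u`
(that is, if `t = T`). It is defined for all `t ∈ [0,T]`. -/
noncomputable def nextPt {T : ℝ} (P : Finset (Time T)) (t : Time T) : Time T :=
  if h : (P.filter (t < ·)).Nonempty then (P.filter (t < ·)).min' h else t

/-- A refining sequence of partitions of `[0,T]` with mesh tending to zero. -/
structure IsRefiningPartition {T : ℝ} (P : ℕ → Finset (Time T)) : Prop where
  zero_mem : ∀ n, ∃ s ∈ P n, (s : ℝ) = 0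
  end_mem : ∀ n, ∃ s ∈ P n, (s : ℝ) = T
  mono : Monotone P
  mesh : ∀ ε > (0 : ℝ), ∀ᶠ n in atTop, ∀ s ∈ P n, (nextPt (P n) s : ℝ) - s < ε

/-- `∑_{s ∈ P, s ≤ t} (x(s') - x(s))²`. -/
noncomputable def sqSum {T : ℝ} (P : Finset (Time T)) (x : Time T → ℝ) (t : Time T) : ℝ :=
  ∑ s ∈ P with s ≤ t, (x (nextPt P s) - x s) ^ 2

/-- The real-valued path `x` admits the continuous quadratic variation `q = [x]` along `(P_n)`. -/
structure HasQV {T : ℝ} (P : ℕ → Finset (Time T)) (x q : Time T → ℝ) : Prop where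
  tendsto : ∀ t : Time T, 0 < (t : ℝ) → Tendsto (fun n => sqSum (P n) x t) atTop (𝓝 (q t))
  zero : ∀ t : Time T, (t : ℝ) = 0 → q t = 0
  cont : Continuous q

/-- The continuous path `X` in `ℝ^d` admits the continuous quadratic variation
`Q = ([X_i,X_j])_{i,j}` along `(P_n)`, where
`[X_i,X_j] = ([X_i + X_j] - [X_i] - [X_j]) / 2`. -/
def HasQVMatrix {T : ℝ} {d : ℕ} {U : Set (Vec d)} (P : ℕ → Finset (Time T)) (X : CPath T U)
    (Q : Fin d → Fin d → Time T → ℝ) : Prop :=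
  ∀ i j, ∃ qij qi qj : Time T → ℝ,
    HasQV P (fun t => X t i + X t j) qij ∧ HasQV P (fun t => X t i) qi ∧
    HasQV P (fun t => X t j) qj ∧ ∀ t, Q i j t = (1 / 2) * (qij t - qi t - qj t)

/-- For `u` close to `t` on the right, either `nextPt P u = nextPt P t`, or there is no point of `P`
to the right of `t`. -/
theorem nextPt_right {T : ℝ} (P : Finset (Time T)) (t : Time T) :
    (∀ᶠ u in 𝓝[≥] t, nextPt P u = nextPt P t) ∨ (∀ᶠ u in 𝓝[≥] t, nextPt P u = u) := by
  classical
  have hev : ∀ᶠ u in 𝓝[≥] t, P.filter (u < ·) = P.filter (t < ·) := by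
    have h1 : ∀ᶠ u in 𝓝[≥] t, ∀ p ∈ P, t < p → u < p := by
      rw [Filter.eventually_all_finset]
      intro p _
      by_cases hp : t < p
      · filter_upwards [mem_nhdsWithin_of_mem_nhds (Iio_mem_nhds hp)] with u hu _ using hu
      · exact Eventually.of_forall fun u h => absurd h hp
    filter_upwards [h1, self_mem_nhdsWithin] with u hu htu
    exact Finset.filter_congr fun p hp => ⟨fun h => lt_of_le_of_lt htu h, hu p hp⟩
  by_cases hne : (P.filter (t < ·)).Nonempty
  · left
    filter_upwards [hev] with u hu
    simp only [nextPt, hu, hne, dite_true]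
  · right
    filter_upwards [hev] with u hu
    simp only [nextPt, hu, hne, dite_false]

/-- For `u` close to `t` on the left, either `nextPt P u` is constant, or `nextPt P u = u`. -/
theorem nextPt_left {T : ℝ} (P : Finset (Time T)) (t : Time T) :
    (∃ c, ∀ᶠ u in 𝓝[<] t, nextPt P u = c) ∨ (∀ᶠ u in 𝓝[<] t, nextPt P u = u) := by
  classical
  have hev : ∀ᶠ u in 𝓝[<] t, P.filter (u < ·) = P.filter (t ≤ ·) := by
    have h1 : ∀ᶠ u in 𝓝[<] t, ∀ p ∈ P, p < t → p < u := by
      rw [Filter.eventually_all_finset]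
      intro p _
      by_cases hp : p < t
      · filter_upwards [mem_nhdsWithin_of_mem_nhds (Ioi_mem_nhds hp)] with u hu _ using hu
      · exact Eventually.of_forall fun u h => absurd h hp
    filter_upwards [h1, self_mem_nhdsWithin] with u hu hut
    refine Finset.filter_congr fun p hp => ⟨fun h => ?_, fun h => lt_of_lt_of_le hut h⟩
    by_contra hlt
    exact absurd (hu p hp (not_le.1 hlt)) (not_lt.2 h.le)
  by_cases hne : (P.filter (t ≤ ·)).Nonempty
  · left
    refine ⟨(P.filter (t ≤ ·)).min' hne, ?_⟩
    filter_upwards [hev] with u hu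
    simp only [nextPt, hu, hne, dite_true]
  · right
    filter_upwards [hev] with u hu
    simp only [nextPt, hu, hne, dite_false]

open Classical in
/-- The path `X^{n,s-} = lim_{r ↑ s} X^{n,r}` for `s ∈ P = 𝕋_n`, where
`X^n = ∑_{s ∈ P} X(s') 1_{[s,s')} + X(T) 1_{{T}}`, that is, `X^n(u) = X(u')`. The path agrees
with `X^n` before `s`, and from `s` on it has the constant value `X^n(s-) = X(s)`. For `s = 0` it
is the constant path `X(0)`. -/
noncomputable def CPath.approx {T : ℝ} {d : ℕ} {U : Set (Vec d)} (X : CPath T U)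
    (P : Finset (Time T)) (s : Time T) : Cadlag T U where
  toFun u := if u < s then X (nextPt P u) else X s
  mem u := by split_ifs <;> exact X.mem _
  right_cont t := by
    by_cases hts : t < s
    · have hlt : ∀ᶠ u in 𝓝[≥] t, u < s := mem_nhdsWithin_of_mem_nhds (Iio_mem_nhds hts)
      have key : ∀ᶠ u in 𝓝[≥] t, (if u < s then X (nextPt P u) else X s) = X (nextPt P u) := by
        filter_upwards [hlt] with u hu
        rw [if_pos hu]
      have hX : Tendsto (fun u => X (nextPt P u)) (𝓝[≥] t) (𝓝 (X (nextPt P t))) := by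
        rcases nextPt_right P t with h | h
        · refine tendsto_const_nhds.congr' ?_
          filter_upwards [h] with u hu
          rw [hu]
        · rw [h.self_of_nhdsWithin self_mem_Ici]
          refine (X.cont.continuousAt.tendsto.mono_left nhdsWithin_le_nhds).congr' ?_
          filter_upwards [h] with u hu
          rw [hu]
      unfold ContinuousWithinAt
      beta_reduce
      rw [if_pos hts]
      refine hX.congr' ?_
      filter_upwards [key] with u hu
      exact hu.symm
    · unfold ContinuousWithinAt
      beta_reduce
      rw [if_neg hts]
      refine tendsto_const_nhds.congr' ?_
      filter_upwards [self_mem_nhdsWithin] with u hu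
      rw [if_neg (not_lt.2 ((not_lt.1 hts).trans hu))]
  left_lim t := by
    rcases le_or_gt t s with hts | hts
    · rcases nextPt_left P t with ⟨c, h⟩ | h
      · refine ⟨X c, X.mem c, tendsto_const_nhds.congr' ?_⟩
        filter_upwards [h, self_mem_nhdsWithin] with u hu hut
        rw [if_pos (lt_of_lt_of_le hut hts), hu]
      · refine ⟨X t, X.mem t,
          (X.cont.continuousAt.tendsto.mono_left nhdsWithin_le_nhds).congr' ?_⟩
        filter_upwards [h, self_mem_nhdsWithin] with u hu hut
        rw [if_pos (lt_of_lt_of_le hut hts), hu]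
    · refine ⟨X s, X.mem s, tendsto_const_nhds.congr' ?_⟩
      filter_upwards [mem_nhdsWithin_of_mem_nhds (Ioi_mem_nhds hts)] with u hu
      rw [if_neg (not_lt.2 (le_of_lt hu))]

/-- The approximating sum `∑_{s ∈ P, s ≤ t} ξ(s,X^{n,s-}) · (X(s') - X(s))`, `P = 𝕋_n`. -/
noncomputable def itoSum {T : ℝ} {d : ℕ} {U : Set (Vec d)} (P : Finset (Time T))
    (ξ : Time T → Cadlag T U → Vec d) (X : CPath T U) (t : Time T) : ℝ :=
  ∑ s ∈ P with s ≤ t, inner ℝ (ξ s (X.approx P s)) (X (nextPt P s) - X s)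

/-- The pathwise Itô integral `∫_0^t ξ(s,X) dX(s)` along `(P_n)` exists and equals `I`. -/
def HasItoIntegral {T : ℝ} {d : ℕ} {U : Set (Vec d)} (P : ℕ → Finset (Time T))
    (ξ : Time T → Cadlag T U → Vec d) (X : CPath T U) (t : Time T) (I : ℝ) : Prop :=
  Tendsto (fun n => itoSum (P n) ξ X t) atTop (𝓝 I)

/-- The functional `F` of class `ℂ^{1,2}_c(U,S)` (componentwise) and the path `A ∈ CBV([0,T],S)`
represent `Y` along `X`, `Y(t) = F(t,X,A)`, in such a way that `ξ_(ℓ) = ∇_X F_ℓ(·,·,A)`. -/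
structure Represents {T : ℝ} {d ν q : ℕ} {U : Set (Vec d)} {S : Set (Vec q)}
    (ξ : Fin ν → Time T → Cadlag T U → Vec d) (X : CPath T U)
    (Y : CPath T (univ : Set (Vec ν))) (F : Fin ν → Functional T U S) (A : CBV T S) : Prop where
  isC12c : ∀ l, IsC12c (F l)
  eq : ∀ t l, Y t l = F l t X.toCadlag A
  vgrad_eq : ∀ l t Z, vgrad (F l) t Z A = ξ l t Z

end PathwiseIto

open PathwiseIto

/-! The path of bounded variation and the horizontal derivative can be removed from the problem.
Subtract $\sum_i\int_0^t\mathscr D_iF\,dA_i$ from $F(t,X,A)$. The integrators are continuous, so the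
subtracted functional depends only on the path strictly before $t$. Hence the vertical derivatives
do not change, while the difference $f$ is flat: $f(t,X^s)=f(s,X^s)$ for $s\le t$. Every admissible
integrand is therefore $\nabla f$ for a flat $f$ (`IsAdmissible.exists_isFlat`). Integrators are
handled through densities with respect to one atomless measure $\mu$, which turns identities between
Stieltjes integrals into identities between $\mu$-integrands.

For flat $f$, Itô's formula is a telescoping sum. The paths $X^{n,s-}$ and $X^{n,s'-}$ differ only
in their constant value from $s$ on, and flatness allows both to be evaluated at time $s$. Each
increment is thus an increment of a function on $U$, to which Taylor's formula applies. The
first-order terms form the Itô sum; the second-order terms converge to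
$\frac12\sum\int\partial_i\partial_jf\,d[X_i,X_j]$. As the Hessian is merely left-continuous, that
convergence rests on `tendsto_sum_mul_weights`. The result is `IsFlat.hasItoIntegral`. Solved for
the integral, it exhibits $Y$ as a functional of $X$ and $[X]$, which is (a) with $\widetilde
A=[X]$.

For (b), let $\eta=\nabla h$ with $h$ flat and $\Phi(Z)=\widetilde F(\cdot,Z,\widetilde A)$. After
time $s$ the path $\Phi(Z^s)$ is continuous and of bounded variation, so $h$ obeys a first-order
chain rule along it (`IsFlat.sub_eq_integral`). Subtracting the resulting integral from
$h(t,\Phi(Z))$ gives a flat functional, `driftComp`, and the vertical chain rule identifies its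
gradient as $\zeta$.

For (c), Itô's formula is applied to $h$ along $Y$ and to `driftComp` along $X$. Since $Y$ is both
$\widetilde F(\cdot,X,\widetilde A)$ and the integral of $\nabla_X\widetilde F$, uniqueness of
limits forces the drift of $\widetilde F$ along $X$ to cancel half of its Hessian contracted with
$d[X]$, $\mu$-almost everywhere (`HasDrift.drift_ae_eq_zero`). This removes all terms with $\mathscr
D\widetilde F$ and $\nabla_X^2\widetilde F$. What remains is the second-order term of $h$ along $Y$,
by the assumed formula for $[Y]$. -/

namespace PathwiseIto

/-! ### Càdlàg paths -/

section CadlagPaths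

variable {T : ℝ} {d : ℕ} {U : Set (Vec d)}

theorem Time.nhds_le_eq (t : Time T) : 𝓝 t = 𝓝[<] t ⊔ 𝓝[≥] t := by
  rw [← nhdsWithin_union, Iio_union_Ici, nhdsWithin_univ]

/-- The values of a càdlàg path stay in a compact subset of `U`. -/
theorem Cadlag.exists_compact (hU : IsOpen U) (X : Cadlag T U) :
    ∃ K : Set (Vec d), IsCompact K ∧ K ⊆ U ∧ ∀ u, X u ∈ K := by
  have key : ∃ K : Set (Vec d), IsCompact K ∧ K ⊆ U ∧ ∀ u ∈ (univ : Set (Time T)), X u ∈ K := by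
    refine IsCompact.induction_on (p := fun s : Set (Time T) =>
      ∃ K : Set (Vec d), IsCompact K ∧ K ⊆ U ∧ ∀ u ∈ s, X u ∈ K) isCompact_univ ?_ ?_ ?_ ?_
    · exact ⟨∅, isCompact_empty, empty_subset _, fun _ h => h.elim⟩
    · rintro s t hst ⟨K, h1, h2, h3⟩
      exact ⟨K, h1, h2, fun u hu => h3 u (hst hu)⟩
    · rintro s t ⟨K, h1, h2, h3⟩ ⟨K', h1', h2', h3'⟩
      refine ⟨K ∪ K', h1.union h1', union_subset h2 h2', ?_⟩
      rintro u (hu | hu)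
      · exact Or.inl (h3 u hu)
      · exact Or.inr (h3' u hu)
    · intro t _
      -- Locally, the values lie in a compact neighbourhood of the left limit or of the value at
      -- `t`; this is where left limits inside `U` are needed.
      obtain ⟨l, hl, hlim⟩ := X.left_lim t
      obtain ⟨K, hK, hKl, hKU⟩ := exists_compact_subset hU hl
      obtain ⟨K', hK', hKl', hKU'⟩ := exists_compact_subset hU (X.mem t)
      have h1 : ∀ᶠ u in 𝓝[<] t, X u ∈ K := hlim (mem_interior_iff_mem_nhds.1 hKl)
      have h2 : ∀ᶠ u in 𝓝[≥] t, X u ∈ K' := (X.right_cont t) (mem_interior_iff_mem_nhds.1 hKl')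
      refine ⟨{u | X u ∈ K ∪ K'}, ?_, K ∪ K', hK.union hK', union_subset hKU hKU', fun u hu => hu⟩
      rw [nhdsWithin_univ, Time.nhds_le_eq]
      exact mem_sup.2 ⟨h1.mono fun u hu => Or.inl hu, h2.mono fun u hu => Or.inr hu⟩
  obtain ⟨K, h1, h2, h3⟩ := key
  exact ⟨K, h1, h2, fun u => h3 u (mem_univ u)⟩

/-- A càdlàg path has at most countably many discontinuities. -/
theorem Cadlag.countable_not_continuousAt (X : Cadlag T U) :
    {r : Time T | ¬ ContinuousAt X r}.Countable := by
  choose l _ hl using X.left_lim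
  -- Where there is no left neighbourhood, `l r` is arbitrary, so such points are excluded.
  let D : ℕ → Set (Time T) := fun n => {r | (𝓝[<] r).NeBot ∧ (1 : ℝ) / (n + 1) < dist (X r) (l r)}
  have hD : ∀ n, (D n).Countable := by
    intro n
    -- Every point of `D n` is isolated in it from the left: just before `r` both the values and the
    -- left limits are within half the threshold of `l r`, so no jump there exceeds the threshold.
    -- Such a set is countable.
    have : D n = {r ∈ D n | 𝓝[D n ∩ Iio r] r = ⊥} := by
      refine Subset.antisymm (fun r hr => ⟨hr, ?_⟩) (fun r hr => hr.1)
      have hpos : (0 : ℝ) < 1 / (n + 1) / 2 := by positivity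
      have h1 : ∀ᶠ u in 𝓝[<] r, dist (X u) (l r) < 1 / (n + 1) / 2 :=
        (hl r) (Metric.ball_mem_nhds _ hpos)
      have h2 : ∀ᶠ u in 𝓝[<] r, ∀ᶠ v in 𝓝[<] u, dist (X v) (l r) < 1 / (n + 1) / 2 := by
        obtain ⟨V, hV, hV'⟩ := mem_nhdsWithin_iff_exists_mem_nhds_inter.1 h1
        filter_upwards [mem_nhdsWithin_of_mem_nhds (eventually_mem_nhds_iff.2 hV),
          self_mem_nhdsWithin] with u hu hur
        filter_upwards [mem_nhdsWithin_of_mem_nhds hu, self_mem_nhdsWithin] with v hv hvu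
        exact hV' ⟨hv, mem_Iio.2 ((mem_Iio.1 hvu).trans (mem_Iio.1 hur))⟩
      have h3 : ∀ᶠ u in 𝓝[<] r, u ∉ D n := by
        filter_upwards [h1, h2] with u hu hu2 huD
        have hb := huD.1
        have h5 : dist (l u) (l r) ≤ 1 / (n + 1) / 2 :=
          le_of_tendsto ((hl u).dist tendsto_const_nhds) (hu2.mono fun v hv => hv.le)
        have := dist_triangle_right (X u) (l u) (l r)
        have huD' : (1 : ℝ) / (n + 1) < dist (X u) (l u) := huD.2
        linarith
      rw [inter_comm, nhdsWithin_inter', ← empty_mem_iff_bot]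
      filter_upwards [mem_inf_of_left h3, mem_inf_of_right (mem_principal_self _)] with u hu hu'
      exact hu hu'
    rw [this]
    exact countable_setOfPred_isolated_left_within
  refine (countable_iUnion hD).mono fun r hr => ?_
  have hr : ¬ ContinuousAt X r := hr
  by_contra hcon
  apply hr
  rw [ContinuousAt, Time.nhds_le_eq]
  refine Tendsto.sup ?_ (X.right_cont r)
  by_cases hb : (𝓝[<] r).NeBot
  · have h0 : dist (X r) (l r) = 0 := by
      by_contra hne
      obtain ⟨n, hn⟩ := exists_nat_one_div_lt (lt_of_le_of_ne dist_nonneg (Ne.symm hne))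
      exact hcon (mem_iUnion.2 ⟨n, hb, hn⟩)
    rw [dist_eq_zero.1 h0]
    exact hl r
  · rw [not_neBot.1 hb]
    exact tendsto_bot

open Classical in
/-- The path that agrees with `X` before `t` and has the constant value `x` from `t` on; the value
is `X` by convention if `x ∉ U`. -/
noncomputable def Cadlag.jump (X : Cadlag T U) (t : Time T) (x : Vec d) : Cadlag T U :=
  if h : x ∈ U then
    { toFun := fun u => if u < t then X u else x
      mem := fun u => by split_ifs; exacts [X.mem u, h]
      right_cont := fun s => by
        rcases lt_or_ge s t with hst | hst
        · refine (X.right_cont s).congr_of_eventuallyEq ?_ (by rw [if_pos hst])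
          filter_upwards [mem_nhdsWithin_of_mem_nhds (Iio_mem_nhds hst)] with u hu
          rw [if_pos (mem_Iio.1 hu)]
        · refine (continuousWithinAt_const (b := x)).congr (fun u hu => ?_) ?_
          · rw [if_neg (not_lt.2 (hst.trans (mem_Ici.1 hu)))]
          · rw [if_neg (not_lt.2 hst)]
      left_lim := fun s => by
        rcases le_or_gt s t with hst | hst
        · obtain ⟨l, hl, hlim⟩ := X.left_lim s
          refine ⟨l, hl, hlim.congr' ?_⟩
          filter_upwards [self_mem_nhdsWithin] with u hu
          rw [if_pos (lt_of_lt_of_le (mem_Iio.1 hu) hst)]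
        · refine ⟨x, h, tendsto_const_nhds.congr' ?_⟩
          filter_upwards [mem_nhdsWithin_of_mem_nhds (Ioi_mem_nhds hst)] with u hu
          rw [if_neg (not_lt.2 (mem_Ioi.1 hu).le)] }
  else X

theorem Cadlag.jump_apply (X : Cadlag T U) (t : Time T) {x : Vec d} (hx : x ∈ U) (u : Time T) :
    X.jump t x u = if u < t then X u else x := by
  simp only [Cadlag.jump, hx, dite_true]

theorem Cadlag.jump_of_lt (X : Cadlag T U) {t u : Time T} (x : Vec d) (hu : u < t) :
    X.jump t x u = X u := by
  by_cases hx : x ∈ U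
  · rw [X.jump_apply t hx, if_pos hu]
  · simp only [Cadlag.jump, hx, dite_false]

theorem Cadlag.jump_of_le (X : Cadlag T U) {t u : Time T} {x : Vec d} (hx : x ∈ U) (hu : t ≤ u) :
    X.jump t x u = x := by
  rw [X.jump_apply t hx, if_neg (not_lt.2 hu)]

theorem Cadlag.stopped_apply (X : Cadlag T U) (t u : Time T) : X.stopped t u = X (min t u) := rfl

theorem Cadlag.stopped_of_le (X : Cadlag T U) {t u : Time T} (h : t ≤ u) : X.stopped t u = X t := by
  rw [X.stopped_apply, min_eq_left h]

theorem Cadlag.stopped_of_ge (X : Cadlag T U) {t u : Time T} (h : u ≤ t) : X.stopped t u = X u := by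
  rw [X.stopped_apply, min_eq_right h]

theorem Cadlag.stopped_stopped (X : Cadlag T U) (s t : Time T) :
    (X.stopped s).stopped t = X.stopped (min s t) := by
  ext1; funext u
  simp only [Cadlag.stopped_apply, min_assoc]

theorem Cadlag.stopped_eq_stopped (X Y : Cadlag T U) (t : Time T) (h : ∀ u ≤ t, X u = Y u) :
    X.stopped t = Y.stopped t := by
  ext1; funext u
  exact h _ (min_le_left _ _)

theorem Cadlag.jump_jump (X : Cadlag T U) (t : Time T) {x y : Vec d} (hy : y ∈ U) :
    (X.jump t x).jump t y = X.jump t y := by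
  ext1; funext u
  rcases lt_or_ge u t with h | h
  · rw [Cadlag.jump_of_lt _ _ h, Cadlag.jump_of_lt _ _ h, Cadlag.jump_of_lt _ _ h]
  · rw [Cadlag.jump_of_le _ hy h, Cadlag.jump_of_le _ hy h]

theorem Cadlag.jump_self (X : Cadlag T U) (t : Time T) : X.jump t (X t) = X.stopped t := by
  ext1; funext u
  rcases lt_or_ge u t with h | h
  · rw [Cadlag.jump_of_lt _ _ h, Cadlag.stopped_of_ge _ h.le]
  · rw [Cadlag.jump_of_le _ (X.mem t) h, Cadlag.stopped_of_le _ h]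

theorem Cadlag.jump_stopped (X : Cadlag T U) (t : Time T) {x : Vec d} (hx : x ∈ U) :
    (X.jump t x).stopped t = X.jump t x := by
  conv_rhs => rw [← X.jump_jump t (x := x) hx]
  rw [← Cadlag.jump_self, X.jump_of_le hx le_rfl]

theorem Cadlag.stopped_jump (X : Cadlag T U) (t : Time T) {x : Vec d} (hx : x ∈ U) :
    (X.stopped t).jump t x = X.jump t x := by
  rw [← X.jump_self, X.jump_jump t hx]

theorem Cadlag.bump_eq (X Z : Cadlag T U) (t : Time T) (v : Vec d)
    (h : ∀ u, Z u = X u + (if t ≤ u then v else 0)) : X.bump t v = Z := by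
  have hex : ∃ Z : Cadlag T U, ∀ u, Z u = X u + (if t ≤ u then v else 0) := ⟨Z, h⟩
  rw [Cadlag.bump, dif_pos hex]
  ext1; funext u
  rw [hex.choose_spec u, h u]

theorem Cadlag.bump_of_lt (X : Cadlag T U) {t u : Time T} (v : Vec d) (hu : u < t) :
    X.bump t v u = X u := by
  by_cases hex : ∃ Z : Cadlag T U, ∀ u, Z u = X u + (if t ≤ u then v else 0)
  · rw [Cadlag.bump, dif_pos hex, hex.choose_spec u, if_neg (not_le.2 hu), add_zero]
  · rw [Cadlag.bump, dif_neg hex]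

theorem Cadlag.jump_bump (X : Cadlag T U) (t : Time T) {x v : Vec d} (hx : x ∈ U)
    (hv : x + v ∈ U) : (X.jump t x).bump t v = X.jump t (x + v) := by
  refine Cadlag.bump_eq _ _ _ _ fun u => ?_
  rcases lt_or_ge u t with h | h
  · rw [Cadlag.jump_of_lt _ _ h, Cadlag.jump_of_lt _ _ h, if_neg (not_le.2 h), add_zero]
  · rw [Cadlag.jump_of_le _ hv h, Cadlag.jump_of_le _ hx h, if_pos h]

/-- For small `v` the path `X + v 1_{[t,T]}` is `U`-valued. -/
theorem Cadlag.eventually_bump (hU : IsOpen U) (X : Cadlag T U) (t : Time T) :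
    ∀ᶠ v in 𝓝 (0 : Vec d), ∀ u, X.bump t v u = X u + (if t ≤ u then v else 0) := by
  obtain ⟨K, hK, hKU, hXK⟩ := X.exists_compact hU
  obtain ⟨δ, hδ, hsub⟩ := hK.exists_cthickening_subset_open hU hKU
  have hmem : ∀ x ∈ K, ∀ v : Vec d, ‖v‖ < δ → x + v ∈ U := fun x hx v hv => hsub <| by
    refine Metric.mem_cthickening_of_dist_le (x + v) x δ K hx ?_
    rw [dist_eq_norm, add_sub_cancel_left]
    exact hv.le
  filter_upwards [Metric.ball_mem_nhds (0 : Vec d) hδ] with v hv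
  rw [mem_ball_zero_iff] at hv
  let Z : Cadlag T U :=
    { toFun := fun u => X u + (if t ≤ u then v else 0)
      mem := fun u => by
        refine hmem _ (hXK u) _ ?_
        split_ifs
        · exact hv
        · rwa [norm_zero]
      right_cont := fun s => by
        refine (X.right_cont s).add ?_
        rcases lt_or_ge s t with hst | hst
        · refine (continuousWithinAt_const (b := (0 : Vec d))).congr_of_eventuallyEq ?_
            (by rw [if_neg (not_le.2 hst)])
          filter_upwards [mem_nhdsWithin_of_mem_nhds (Iio_mem_nhds hst)] with u hu
          rw [if_neg (not_le.2 (mem_Iio.1 hu))]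
        · refine (continuousWithinAt_const (b := v)).congr (fun u hu => ?_) ?_
          · rw [if_pos (hst.trans (mem_Ici.1 hu))]
          · rw [if_pos hst]
      left_lim := fun s => by
        -- Only a genuine left limit is known to lie in `K`; otherwise the condition is void.
        by_cases hb : (𝓝[<] s).NeBot
        · obtain ⟨l, hl, hlim⟩ := X.left_lim s
          have hlK : l ∈ K := hK.isClosed.mem_of_tendsto hlim (Eventually.of_forall hXK)
          rcases le_or_gt s t with hst | hst
          · refine ⟨l, hl, hlim.congr' ?_⟩
            filter_upwards [self_mem_nhdsWithin] with u hu
            rw [if_neg (not_le.2 (lt_of_lt_of_le (mem_Iio.1 hu) hst)), add_zero]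
          · refine ⟨l + v, hmem l hlK v hv, (hlim.add tendsto_const_nhds).congr' ?_⟩
            filter_upwards [mem_nhdsWithin_of_mem_nhds (Ioi_mem_nhds hst)] with u hu
            rw [if_pos (mem_Ioi.1 hu).le]
        · refine ⟨X s, X.mem s, ?_⟩
          rw [not_neBot.1 hb]
          exact tendsto_bot }
  intro u
  rw [X.bump_eq Z t v fun _ => rfl]

/-- A non-anticipative functional sees the bumped path only up to `t`, where it is a path with one
free value in the open set `U`. Vertical calculus thereby becomes calculus in the variable `x` of
`X.jump t x`. -/
theorem Cadlag.eventually_bump_stopped (hU : IsOpen U) (X : Cadlag T U) (t : Time T) :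
    ∀ᶠ v in 𝓝 (0 : Vec d), (X.bump t v).stopped t = X.jump t (X t + v) := by
  have h1 : ∀ᶠ v in 𝓝 (0 : Vec d), X t + v ∈ U :=
    (continuous_const.add continuous_id).tendsto' (0 : Vec d) (X t) (by simp)
      (hU.mem_nhds (X.mem t))
  filter_upwards [X.eventually_bump hU t, h1] with v hv hmem
  ext1; funext u
  rcases lt_or_ge u t with h | h
  · rw [Cadlag.stopped_of_ge _ h.le, Cadlag.bump_of_lt _ _ h, Cadlag.jump_of_lt _ _ h]
  · rw [Cadlag.stopped_of_le _ h, hv, if_pos le_rfl, Cadlag.jump_of_le _ hmem h]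

end CadlagPaths

/-! ### Uniform distance and the filters of the continuity notions -/

section Filters

variable {T : ℝ} {d : ℕ} {U : Set (Vec d)}

theorem dist_lt_of_supDist_lt {X Y : Cadlag T U} {δ : ℝ} (h : supDist X Y < ENNReal.ofReal δ)
    (u : Time T) : dist (X u) (Y u) < δ := by
  have := (le_iSup (fun u => edist (X u) (Y u)) u).trans_lt h
  rw [edist_dist] at this
  exact (ENNReal.ofReal_lt_ofReal_iff_of_nonneg dist_nonneg).1 this

theorem supDist_lt_of_dist_le {X Y : Cadlag T U} {c δ : ℝ} (h : ∀ u, dist (X u) (Y u) ≤ c)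
    (hc : c < δ) (hδ : 0 < δ) : supDist X Y < ENNReal.ofReal δ := by
  refine lt_of_le_of_lt (iSup_le fun u => ?_) ((ENNReal.ofReal_lt_ofReal_iff hδ).2 hc)
  rw [edist_dist]
  exact ENNReal.ofReal_le_ofReal (h u)

theorem ENNReal.nhds_zero_hasBasis_ofReal :
    (𝓝 (0 : ℝ≥0∞)).HasBasis (fun δ : ℝ => 0 < δ) fun δ => Iio (ENNReal.ofReal δ) := by
  refine ENNReal.nhds_zero_basis.to_hasBasis (fun a ha => ?_) fun δ hδ =>
    ⟨ENNReal.ofReal δ, ENNReal.ofReal_pos.2 hδ, Subset.rfl⟩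
  obtain ⟨b, hb, hba⟩ := ENNReal.lt_iff_exists_nnreal_btwn.1 ha
  refine ⟨b, by exact_mod_cast hb, Iio_subset_Iio ?_⟩
  rw [ENNReal.ofReal_coe_nnreal]
  exact hba.le

/-- Neighbourhoods of `X` in the supremum norm. -/
noncomputable def nhdsSup (X : Cadlag T U) : Filter (Cadlag T U) := comap (supDist X) (𝓝 0)

/-- The filter of pairs `(s,Y)` with `s ↑ t` and `Y^s → X^t` uniformly. -/
noncomputable def nhdsLeft (t : Time T) (X : Cadlag T U) : Filter (Time T × Cadlag T U) :=
  comap (fun p : Time T × Cadlag T U => supDist (X.stopped t) (p.2.stopped p.1)) (𝓝 0) ⊓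
    comap Prod.fst (𝓝[≤] t)

/-- Dominated convergence is used along these filters and requires countable generation, which they
inherit as pullbacks. -/
instance (X : Cadlag T U) : (nhdsSup X).IsCountablyGenerated := by
  unfold nhdsSup; infer_instance

instance (t : Time T) (X : Cadlag T U) : (nhdsLeft t X).IsCountablyGenerated := by
  unfold nhdsLeft; infer_instance

theorem nhdsSup_hasBasis (X : Cadlag T U) : (nhdsSup X).HasBasis (fun δ : ℝ => 0 < δ)
    fun δ => {Y | supDist X Y < ENNReal.ofReal δ} :=
  ENNReal.nhds_zero_hasBasis_ofReal.comap _

theorem nhdsLE_hasBasis (t : Time T) : (𝓝[≤] t).HasBasis (fun δ : ℝ => 0 < δ)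
    fun δ => {s | s ≤ t ∧ (t : ℝ) - s < δ} := by
  refine (Metric.nhdsWithin_basis_ball (s := Iic t)).to_hasBasis (fun δ hδ => ⟨δ, hδ, ?_⟩)
    fun δ hδ => ⟨δ, hδ, ?_⟩
  · rintro s ⟨hs, hs'⟩
    refine ⟨?_, hs⟩
    rw [Metric.mem_ball, Subtype.dist_eq, Real.dist_eq, abs_sub_comm, abs_of_nonneg]
    · exact hs'
    · exact sub_nonneg.2 hs
  · rintro s ⟨hs, hs'⟩
    refine ⟨hs', ?_⟩
    rw [Metric.mem_ball, Subtype.dist_eq, Real.dist_eq, abs_sub_comm] at hs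
    exact lt_of_abs_lt hs

theorem nhdsLeft_hasBasis (t : Time T) (X : Cadlag T U) :
    (nhdsLeft t X).HasBasis (fun δ : ℝ => 0 < δ) fun δ =>
      {p | p.1 ≤ t ∧ (t : ℝ) - p.1 < δ ∧
        supDist (X.stopped t) (p.2.stopped p.1) < ENNReal.ofReal δ} := by
  refine ((ENNReal.nhds_zero_hasBasis_ofReal.comap _).inf
    ((nhdsLE_hasBasis t).comap Prod.fst)).to_hasBasis ?_ ?_
  · rintro ⟨δ, δ'⟩ ⟨h, h'⟩
    refine ⟨min δ δ', lt_min h h', ?_⟩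
    rintro p ⟨h1, h2, h3⟩
    exact ⟨h3.trans_le (ENNReal.ofReal_le_ofReal (min_le_left _ _)), h1,
      h2.trans_le (min_le_right _ _)⟩
  · intro δ h
    exact ⟨⟨δ, δ⟩, ⟨h, h⟩, fun p hp => ⟨hp.2.1, hp.2.2, hp.1⟩⟩

end Filters


/-! ### Lebesgue–Stieltjes integrals through densities -/

section LebesgueStieltjes

variable {T : ℝ}

/-- `a(t) - a(s) = ∫_{(s,t]} ρ dμ`, that is, `da = ρ dμ`. -/
structure HasLSDensity (a : Time T → ℝ) (μ : Measure (Time T)) (ρ : Time T → ℝ) : Prop where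
  integrable : Integrable ρ μ
  sub_eq : ∀ s t, s ≤ t → a t - a s = ∫ r in Ioc s t, ρ r ∂μ

theorem Time.univ_eq_Icc (t : Time T) :
    (univ : Set (Time T)) = Icc ⟨0, le_rfl, t.2.1.trans t.2.2⟩ ⟨T, t.2.1.trans t.2.2, le_rfl⟩ :=
  (eq_univ_of_forall fun u => mem_Icc.2 ⟨u.2.1, u.2.2⟩).symm

/-- Closed intervals form a π-system generating the Borel sets, and `[0,T]` is one of them. -/
theorem signedMeasure_ext_Icc {v w : SignedMeasure (Time T)}
    (h : ∀ s t, s ≤ t → v (Icc s t) = w (Icc s t)) : v = w := by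
  refine VectorMeasure.ext_of_generateFrom {S | ∃ l u, l ≤ u ∧ Icc l u = S} ?_ ?_ ?_ ?_
  · rintro S ⟨l, u, hlu, rfl⟩
    exact h l u hlu
  · rw [← borel_eq_generateFrom_Icc, BorelSpace.measurable_eq (α := Time T)]
  · exact isPiSystem_Icc (f := id) (g := id)
  · rcases isEmpty_or_nonempty (Time T) with he | ⟨⟨t⟩⟩
    · rw [univ_eq_empty_iff.2 he, v.empty, w.empty]
    · rw [Time.univ_eq_Icc t]
      exact h _ _ (t.2.1.trans t.2.2)

theorem vectorMeasure_Icc_of_continuous {a : Time T → ℝ} (ha : Continuous a)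
    (hbv : BoundedVariationOn a univ) {s t : Time T} (hst : s ≤ t) :
    hbv.vectorMeasure (Icc s t) = a t - a s := by
  rw [hbv.vectorMeasure_Icc hst, ha.continuousWithinAt.rightLim_eq,
    ha.continuousWithinAt.leftLim_eq]

theorem HasLSDensity.vectorMeasure_eq {a : Time T → ℝ} {μ : Measure (Time T)} {ρ : Time T → ℝ}
    [NullSingletonClass μ] (h : HasLSDensity a μ ρ) (ha : Continuous a)
    (hbv : BoundedVariationOn a univ) : hbv.vectorMeasure = μ.withDensityᵥ ρ := by
  refine signedMeasure_ext_Icc fun s t hst => ?_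
  rw [vectorMeasure_Icc_of_continuous ha hbv hst, withDensityᵥ_apply h.integrable measurableSet_Icc,
    integral_Icc_eq_integral_Ioc, h.sub_eq s t hst]

theorem integrable_bdd_mul {μ : Measure (Time T)} {φ ρ : Time T → ℝ} {C : ℝ}
    (hφ : AEStronglyMeasurable φ μ) (hC : ∀ r, |φ r| ≤ C) (hρ : Integrable ρ μ) :
    Integrable (fun r => φ r * ρ r) μ :=
  hρ.bdd_mul hφ (ae_of_all _ hC)

/-- The signed measure splits into the parts with densities `ρ⁺` and `ρ⁻`, and the integral is
additive in the measure. This is the passage from all Stieltjes integrals to integrals against one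
common `μ`. -/
theorem HasLSDensity.lsIntegral_eq {a : Time T → ℝ} {μ : Measure (Time T)} {ρ : Time T → ℝ}
    [NullSingletonClass μ] (h : HasLSDensity a μ ρ) (ha : Continuous a)
    (hbv : BoundedVariationOn a univ) {φ : Time T → ℝ} {C : ℝ} (hφ : AEStronglyMeasurable φ μ)
    (hC : ∀ r, |φ r| ≤ C) {B : Set (Time T)} (hB : MeasurableSet B) :
    lsIntegral φ a B = ∫ r in B, φ r * ρ r ∂μ := by
  have hm := h.integrable.aestronglyMeasurable.aemeasurable
  have := isFiniteMeasure_withDensity_ofReal h.integrable.2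
  have := isFiniteMeasure_withDensity_ofReal h.integrable.neg.2
  have hint : ∀ g : Time T → ℝ≥0∞, IsFiniteMeasure (μ.withDensity g) →
      Integrable φ (μ.withDensity g) := fun g hg =>
    Integrable.of_bound (hφ.mono_ac (withDensity_absolutelyContinuous _ _)) C (ae_of_all _ hC)
  have h1 := hint (fun r => ENNReal.ofReal (ρ r)) inferInstance
  have h2 := hint (fun r => ENNReal.ofReal (-ρ r)) inferInstance
  have e1 := VectorMeasure.setIntegral_toSignedMeasure (f := φ) 
    (μ := μ.withDensity fun r => ENNReal.ofReal (ρ r)) hB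
  have e2 := VectorMeasure.setIntegral_toSignedMeasure (f := φ) 
    (μ := μ.withDensity fun r => ENNReal.ofReal (-ρ r)) hB
  rw [lsIntegral, dif_pos hbv, h.vectorMeasure_eq ha hbv,
    withDensityᵥ_eq_withDensity_pos_part_sub_withDensity_neg_part h.integrable,
    VectorMeasure.restrict_sub, VectorMeasure.integral_sub_vectorMeasure]
  · have hf : ContinuousLinearMap.lsmul ℝ ℝ = (ContinuousLinearMap.lsmul ℝ ℝ (E := ℝ)).flip := by
      ext; simp
    rw [hf, e1, e2, setIntegral_withDensity_eq_setIntegral_toReal_smul₀ _ _ _ hB,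
      setIntegral_withDensity_eq_setIntegral_toReal_smul₀ _ _ _ hB, ← integral_sub]
    · refine integral_congr_ae (ae_of_all _ fun r => ?_)
      simp only [smul_eq_mul, ENNReal.toReal_ofReal']
      rw [← sub_mul, mul_comm, max_zero_sub_max_neg_zero_eq_self]
    · have := (integrable_bdd_mul hφ hC h.integrable.pos_part).integrableOn (s := B)
      refine this.congr (ae_of_all _ fun r => ?_)
      simp [ENNReal.toReal_ofReal', mul_comm]
    · have := (integrable_bdd_mul hφ hC h.integrable.neg_part).integrableOn (s := B)
      refine this.congr (ae_of_all _ fun r => ?_)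
      simp [ENNReal.toReal_ofReal', mul_comm]
    · exact (hm.neg.ennreal_ofReal).restrict
    · exact ae_of_all _ fun _ => ENNReal.ofReal_lt_top
    · exact (hm.ennreal_ofReal).restrict
    · exact ae_of_all _ fun _ => ENNReal.ofReal_lt_top
  · refine VectorMeasure.Integrable.restrict ?_
    simpa [VectorMeasure.Integrable] using h1
  · refine VectorMeasure.Integrable.restrict ?_
    simpa [VectorMeasure.Integrable] using h2

/-- Finitely many continuous functions of bounded variation have densities with respect to a
common atomless finite measure. -/
theorem exists_hasLSDensity {ι : Type*} [Finite ι] (a : ι → Time T → ℝ)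
    (ha : ∀ i, Continuous (a i)) (hbv : ∀ i, BoundedVariationOn (a i) univ) :
    ∃ (μ : Measure (Time T)) (ρ : ι → Time T → ℝ), IsFiniteMeasure μ ∧ NullSingletonClass μ ∧
      ∀ i, HasLSDensity (a i) μ (ρ i) := by
  cases nonempty_fintype ι
  let v : ι → SignedMeasure (Time T) := fun i => (hbv i).vectorMeasure
  -- The sum of the total variations dominates each signed measure, so Radon–Nikodym provides the
  -- densities; continuity of the integrators makes it atomless.
  let μ : Measure (Time T) := ∑ i, (v i).totalVariation
  have hμf : IsFiniteMeasure μ := by infer_instance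
  have hle : ∀ i, (v i).totalVariation ≤ μ := fun i =>
    Finset.single_le_sum (f := fun i => (v i).totalVariation) (fun j _ => Measure.zero_le _) (Finset.mem_univ i)
  have hsing : ∀ i (t : Time T), (v i).totalVariation {t} = 0 := by
    intro i t
    rw [SignedMeasure.totalVariation_eq_variation,
      VectorMeasure.variation_apply_eq_zero (measurableSet_singleton t)]
    intro s hs _
    rcases subset_singleton_iff_eq.1 hs with rfl | rfl
    · exact (v i).empty
    · rw [← Icc_self, vectorMeasure_Icc_of_continuous (ha i) (hbv i) le_rfl, sub_self]
  have hμ : NullSingletonClass μ := ⟨fun t => by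
    simp only [μ, Measure.finsetSum_apply, hsing, Finset.sum_const_zero]⟩
  refine ⟨μ, fun i => (v i).rnDeriv μ, hμf, hμ, fun i =>
    ⟨SignedMeasure.integrable_rnDeriv _ _, fun s t hst => ?_⟩⟩
  have hac : v i ≪ᵥ μ.toENNRealVectorMeasure := by
    rw [SignedMeasure.absolutelyContinuous_ennreal_iff]
    have : μ.toENNRealVectorMeasure.ennrealToMeasure = μ := by simp
    rw [this]
    exact Measure.absolutelyContinuous_of_le (hle i)
  rw [← vectorMeasure_Icc_of_continuous (ha i) (hbv i) hst, ← integral_Icc_eq_integral_Ioc,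
    ← withDensityᵥ_apply (SignedMeasure.integrable_rnDeriv _ _) measurableSet_Icc,
    SignedMeasure.withDensityᵥ_rnDeriv_eq _ _ hac]

theorem hasLSDensity_integral_Iic {μ : Measure (Time T)} {ψ : Time T → ℝ} (hψ : Integrable ψ μ) :
    HasLSDensity (fun t => ∫ r in Iic t, ψ r ∂μ) μ ψ := by
  refine ⟨hψ, fun s t hst => ?_⟩
  rw [← Iic_union_Ioc_eq_Iic hst, setIntegral_union (Iic_disjoint_Ioc le_rfl) measurableSet_Ioc
    hψ.integrableOn hψ.integrableOn, add_sub_cancel_left]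

/-- The Stieltjes measure of a continuous increasing function. -/
theorem exists_measure_of_monotone {q : Time T → ℝ} (hq : Continuous q) (hm : Monotone q) :
    ∃ μ : Measure (Time T), IsFiniteMeasure μ ∧ NullSingletonClass μ ∧
      ∀ s t, s ≤ t → μ.real (Ioc s t) = q t - q s := by
  let f : StieltjesFunction (Time T) := ⟨q, hm, fun _ => hq.continuousWithinAt⟩
  obtain ⟨C, hC⟩ := (isCompact_range hq).isBounded.exists_norm_le
  refine ⟨f.measure, f.isFiniteMeasure_of_forall_abs_le (C := C) fun x => hC _ ⟨x, rfl⟩, ⟨fun t => ?_⟩,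
    fun s t hst => ?_⟩
  · rw [f.measure_singleton]
    change ENNReal.ofReal (q t - Function.leftLim q t) = 0
    rw [hq.continuousWithinAt.leftLim_eq, sub_self, ENNReal.ofReal_zero]
  · rw [measureReal_def, f.measure_Ioc, ENNReal.toReal_ofReal (sub_nonneg.2 (f.mono hst))]

theorem hasLSDensity_one {q : Time T → ℝ} {μ : Measure (Time T)} [IsFiniteMeasure μ]
    (h : ∀ s t, s ≤ t → μ.real (Ioc s t) = q t - q s) : HasLSDensity q μ fun _ => 1 :=
  ⟨integrable_const _, fun s t hst => by simp [h s t hst]⟩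

theorem Monotone.boundedVariationOn_time {q : Time T → ℝ} (hm : Monotone q) :
    BoundedVariationOn q univ := by
  rcases isEmpty_or_nonempty (Time T) with he | ⟨⟨t⟩⟩
  · rw [univ_eq_empty_iff.2 he]
    simp [BoundedVariationOn]
  · have := (hm.monotoneOn univ).eVariationOn_eq (a := ⟨0, le_rfl, t.2.1.trans t.2.2⟩)
      (b := ⟨T, t.2.1.trans t.2.2, le_rfl⟩) (mem_univ _) (mem_univ _)
    rw [← Time.univ_eq_Icc t, inter_self] at this
    rw [BoundedVariationOn, this]
    exact ENNReal.ofReal_ne_top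

/-- Replacing `A` by `A^t` leaves the integrator unchanged on `[0,t]`. This yields the
non-anticipativity of functionals containing Stieltjes integrals. -/
theorem HasLSDensity.stopped {a : Time T → ℝ} {μ : Measure (Time T)} {ρ : Time T → ℝ}
    (h : HasLSDensity a μ ρ) (t : Time T) :
    HasLSDensity (fun r => a (min t r)) μ ((Iic t).indicator ρ) := by
  refine ⟨h.integrable.indicator measurableSet_Iic, fun s u hsu => ?_⟩
  rw [h.sub_eq _ _ (min_le_min_left t hsu), setIntegral_indicator measurableSet_Iic]
  congr 2
  ext r
  simp only [mem_Ioc, mem_inter_iff, mem_Iic, min_lt_iff, le_min_iff]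
  constructor
  · rintro ⟨h1 | h1, h2, h3⟩
    · exact absurd h1 (not_lt.2 h2)
    · exact ⟨⟨h1, h3⟩, h2⟩
  · rintro ⟨⟨h1, h3⟩, h2⟩
    exact ⟨Or.inr h1, h2, h3⟩

end LebesgueStieltjes


/-! ### Functionals of a path alone -/

section PathFunctionals

variable {T : ℝ} {d : ℕ} {U : Set (Vec d)}

/-- Real-valued functionals on `[0,T] × D([0,T],U)`. -/
abbrev PathFun (T : ℝ) {d : ℕ} (U : Set (Vec d)) : Type := Time T → Cadlag T U → ℝ

/-- Neighbourhoods of `X^t` in the supremum norm. -/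
noncomputable def nhdsFixed (t : Time T) (X : Cadlag T U) : Filter (Cadlag T U) :=
  comap (fun Y : Cadlag T U => supDist (X.stopped t) (Y.stopped t)) (𝓝 0)

def Adapted (f : PathFun T U) : Prop := ∀ t X, f t X = f t (X.stopped t)

def LeftCont (f : PathFun T U) : Prop :=
  ∀ t : Time T, 0 < (t : ℝ) → ∀ X,
    Tendsto (fun p : Time T × Cadlag T U => f p.1 p.2) (nhdsLeft t X) (𝓝 (f t X))

/-- Time `0` is exempt: left-continuity, from which this property is often derived, says nothing
there, and an atomless measure does not charge it. -/
def FixedCont (f : PathFun T U) : Prop :=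
  ∀ t : Time T, 0 < (t : ℝ) → ∀ X, Tendsto (fun Y => f t Y) (nhdsFixed t X) (𝓝 (f t X))

/-- By compactness of `[0,T]`, local uniformity in time amounts to this global uniformity. -/
def UnifCont (f : PathFun T U) : Prop :=
  ∀ X, ∀ ε > (0 : ℝ), ∀ᶠ Y in nhdsSup X, ∀ u, |f u X - f u Y| < ε

def BddPres (f : PathFun T U) : Prop :=
  ∀ K : Set (Vec d), IsCompact K → K ⊆ U →
    ∃ C : ℝ, ∀ (t : Time T) (X : Cadlag T U), (∀ u, X u ∈ K) → |f t X| ≤ C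

theorem nhdsFixed_hasBasis (t : Time T) (X : Cadlag T U) : (nhdsFixed t X).HasBasis
    (fun δ : ℝ => 0 < δ) fun δ => {Y | supDist (X.stopped t) (Y.stopped t) < ENNReal.ofReal δ} :=
  ENNReal.nhds_zero_hasBasis_ofReal.comap _

theorem tendsto_nhdsFixed_nhdsLeft (t : Time T) (X : Cadlag T U) :
    Tendsto (fun Y => (t, Y)) (nhdsFixed t X) (nhdsLeft t X) := by
  refine ((nhdsFixed_hasBasis t X).tendsto_iff (nhdsLeft_hasBasis t X)).2 fun δ hδ =>
    ⟨δ, hδ, fun Y hY => ⟨le_rfl, ?_, hY⟩⟩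
  simpa using hδ

theorem LeftCont.fixedCont {f : PathFun T U} (hf : LeftCont f) : FixedCont f :=
  fun t ht X => (hf t ht X).comp (tendsto_nhdsFixed_nhdsLeft t X)

theorem Adapted.eq_stopped {f : PathFun T U} (hf : Adapted f) {r t : Time T} (h : r ≤ t)
    (X : Cadlag T U) : f r (X.stopped t) = f r X := by
  rw [hf r (X.stopped t), hf r X, Cadlag.stopped_stopped, min_eq_right h]

theorem Adapted.congr {f : PathFun T U} (hf : Adapted f) {t : Time T} {X Y : Cadlag T U}
    (h : ∀ u ≤ t, X u = Y u) : f t X = f t Y := by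
  rw [hf t X, hf t Y, Cadlag.stopped_eq_stopped X Y t h]

/-- The two stopped paths agree up to `s`, and afterwards differ by at most the oscillation of `X`
on `[s,r]`, which is small at a continuity point. -/
theorem Cadlag.stopped_close (X : Cadlag T U) {r : Time T} (hX : ContinuousAt X r) {δ : ℝ}
    (hδ : 0 < δ) : ∀ᶠ s in 𝓝[≤] r,
      supDist (X.stopped r) (X.stopped s) < ENNReal.ofReal δ := by
  obtain ⟨η, hη, h⟩ := Metric.continuousAt_iff.1 hX (δ / 3) (by positivity)
  filter_upwards [(nhdsLE_hasBasis r).mem_of_mem hη] with s hs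
  have hs1 : s ≤ r := hs.1
  have hs2 : (r : ℝ) - s < η := hs.2
  have hclose : ∀ u, s ≤ u → u ≤ r → dist (X u) (X r) < δ / 3 := fun u hu hur => h <| by
    have h1 : (s : ℝ) ≤ u := hu
    have h2 : (u : ℝ) ≤ r := hur
    rw [Subtype.dist_eq, Real.dist_eq, abs_sub_comm, abs_of_nonneg (sub_nonneg.2 h2)]
    linarith
  refine supDist_lt_of_dist_le (c := 2 * δ / 3) (fun u => ?_) (by linarith) hδ
  rw [Cadlag.stopped_apply, Cadlag.stopped_apply]
  rcases le_total u s with hus | hus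
  · rw [min_eq_right hus, min_eq_right (hus.trans hs1), dist_self]
    positivity
  · rw [min_eq_left hus]
    have h1 := hclose (min r u) (le_min hs1 hus) (min_le_left _ _)
    have h2 := hclose s le_rfl hs1
    linarith [dist_triangle_right (X (min r u)) (X s) (X r)]

theorem tendsto_nhdsLeft_of_continuousAt (X : Cadlag T U) {r : Time T} (hX : ContinuousAt X r) :
    Tendsto (fun s => (s, X)) (𝓝[≤] r) (nhdsLeft r X) := by
  refine (nhdsLeft_hasBasis r X).tendsto_right_iff.2 fun δ hδ => ?_
  filter_upwards [X.stopped_close hX hδ, (nhdsLE_hasBasis r).mem_of_mem hδ] with s h1 h2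
  exact ⟨h2.1, h2.2, h1⟩

theorem tendsto_nhdsFixed_of_continuousAt (X : Cadlag T U) {r : Time T} (hX : ContinuousAt X r) :
    Tendsto (fun s => X.stopped s) (𝓝[≤] r) (nhdsFixed r X) := by
  refine (nhdsFixed_hasBasis r X).tendsto_right_iff.2 fun δ hδ => ?_
  filter_upwards [X.stopped_close hX hδ, self_mem_nhdsWithin] with s h1 h2
  simp only [Cadlag.stopped_stopped]
  rwa [min_eq_left (mem_Iic.1 h2)]

/-! ### Measurability in time -/

/-- The grid point `(k - 1)/(n + 1)`, clipped to `[0,T]`. -/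
noncomputable def gridPt (hT : 0 ≤ T) (n k : ℕ) : Time T :=
  projIcc 0 T hT (((k - 1 : ℕ) : ℝ) / (n + 1))

/-- The largest grid point strictly before `r`. -/
noncomputable def gridFloor (hT : 0 ≤ T) (n : ℕ) (r : Time T) : Time T :=
  gridPt hT n ⌈(r : ℝ) * (n + 1)⌉₊

theorem gridFloor_spec (hT : 0 ≤ T) (n : ℕ) {r : Time T} (hr : 0 < (r : ℝ)) :
    (gridFloor hT n r : ℝ) < r ∧ (r : ℝ) - 1 / (n + 1) ≤ gridFloor hT n r := by
  have hn : (0 : ℝ) < n + 1 := by positivity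
  have hpos : 0 < (r : ℝ) * (n + 1) := by positivity
  set k := ⌈(r : ℝ) * (n + 1)⌉₊ with hk
  have hk1 : 1 ≤ k := Nat.one_le_iff_ne_zero.2 (Nat.ceil_pos.2 hpos).ne'
  have h1 : (k : ℝ) < r * (n + 1) + 1 := Nat.ceil_lt_add_one hpos.le
  have h2 : (r : ℝ) * (n + 1) ≤ k := Nat.le_ceil _
  have h3 : ((k - 1 : ℕ) : ℝ) = k - 1 := by push_cast [hk1]; ring
  have h4 : ((k : ℝ) - 1) / (n + 1) < r := by rw [div_lt_iff₀ hn]; linarith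
  have h5 : (r : ℝ) - 1 / (n + 1) ≤ ((k : ℝ) - 1) / (n + 1) := by
    rw [sub_div, sub_le_sub_iff_right, le_div_iff₀ hn]; exact h2
  have h6 : (gridFloor hT n r : ℝ) = ((k : ℝ) - 1) / (n + 1) := by
    rw [gridFloor, gridPt, coe_projIcc, ← hk, h3, min_eq_right (h4.le.trans r.2.2), max_eq_right]
    have : (1 : ℝ) ≤ k := by exact_mod_cast hk1
    exact div_nonneg (by linarith) hn.le
  rw [h6]
  exact ⟨h4, h5⟩

theorem tendsto_gridFloor (hT : 0 ≤ T) {r : Time T} (hr : 0 < (r : ℝ)) :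
    Tendsto (fun n => gridFloor hT n r) atTop (𝓝[≤] r) := by
  refine tendsto_nhdsWithin_iff.2 ⟨?_, Eventually.of_forall fun n => (gridFloor_spec hT n hr).1.le⟩
  rw [tendsto_subtype_rng]
  refine tendsto_of_tendsto_of_tendsto_of_le_of_le (g := fun n : ℕ => (r : ℝ) - 1 / (n + 1)) ?_
    tendsto_const_nhds (fun n => (gridFloor_spec hT n hr).2) fun n => (gridFloor_spec hT n hr).1.le
  simpa using tendsto_const_nhds.sub (tendsto_one_div_add_atTop_nhds_zero_nat (𝕜 := ℝ))

/-- The composition factors through a measurable map into `ℕ`, so nothing is required of `g`. -/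
theorem measurable_comp_gridFloor (hT : 0 ≤ T) (n : ℕ) (g : Time T → ℝ) :
    Measurable fun r => g (gridFloor hT n r) := by
  have h1 : Measurable fun r : Time T => ⌈(r : ℝ) * (n + 1)⌉₊ :=
    Nat.measurable_ceil.comp (measurable_subtype_coe.mul_const _)
  exact (measurable_from_nat (f := fun k => g (gridPt hT n k))).comp h1

theorem Cadlag.ae_continuousAt (X : Cadlag T U) (μ : Measure (Time T)) [NullSingletonClass μ] :
    ∀ᵐ r : Time T ∂μ, 0 < (r : ℝ) ∧ ContinuousAt X r := by
  have h1 : ∀ᵐ r ∂μ, ContinuousAt X r := by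
    filter_upwards [X.countable_not_continuousAt.ae_notMem μ] with r hr
    by_contra hcon
    exact hr hcon
  have h2 : ∀ᵐ r : Time T ∂μ, 0 < (r : ℝ) := by
    have hc : {r : Time T | (r : ℝ) = 0}.Countable :=
      Set.Subsingleton.countable fun a ha b hb => Subtype.ext (ha.trans hb.symm)
    filter_upwards [hc.ae_notMem μ] with r hr
    exact lt_of_le_of_ne r.2.1 (fun h => hr h.symm)
  exact h2.and h1

/-- Evaluating at the grid point before `r` gives measurable step functions. They converge at each
positive continuity point of `X`, hence almost everywhere for an atomless measure. -/
theorem LeftCont.aestronglyMeasurable (hT : 0 ≤ T) {f : PathFun T U} (hf : LeftCont f)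
    (X : Cadlag T U) (μ : Measure (Time T)) [NullSingletonClass μ] :
    AEStronglyMeasurable (fun r => f r X) μ := by
  refine aestronglyMeasurable_of_tendsto_ae (u := atTop)
    (f := fun n r => f (gridFloor hT n r) X) (fun n =>
    (measurable_comp_gridFloor hT n fun r => f r X).aestronglyMeasurable) ?_
  filter_upwards [X.ae_continuousAt μ] with r hr
  exact ((hf r hr.1 X).comp (tendsto_nhdsLeft_of_continuousAt X hr.2)).comp
    (tendsto_gridFloor hT hr.1)

theorem Cadlag.continuousAt_stopped (X : Cadlag T U) {s r : Time T} (h : s < r) :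
    ContinuousAt (X.stopped s) r := by
  refine (continuousAt_const (y := X s)).congr ?_
  filter_upwards [Ioi_mem_nhds h] with u hu
  rw [X.stopped_of_le (mem_Ioi.1 hu).le]

open Classical in
-- The path `X^s` is continuous at every `r > s`, so here the grid approximations converge at every
-- point and Borel measurability results, as the definition of a horizontal derivative demands.
theorem LeftCont.measurable_stopped (hT : 0 ≤ T) {f : PathFun T U} (hf : LeftCont f)
    (X : Cadlag T U) (s : Time T) :
    Measurable fun r => if s < r then f r (X.stopped s) else 0 := by
  refine measurable_of_tendsto_metrizable (f := fun n r =>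
    if s < r then f (gridFloor hT n r) (X.stopped s) else 0) (fun n => ?_) ?_
  · exact Measurable.ite measurableSet_Ioi
      (measurable_comp_gridFloor hT n fun r => f r (X.stopped s)) measurable_const
  · refine tendsto_pi_nhds.2 fun r => ?_
    by_cases h : s < r
    · simp only [h, if_true]
      have hr : 0 < (r : ℝ) := lt_of_le_of_lt s.2.1 h
      exact ((hf r hr _).comp (tendsto_nhdsLeft_of_continuousAt _
        (X.continuousAt_stopped h))).comp (tendsto_gridFloor hT hr)
    · simp only [h, if_false]
      exact tendsto_const_nhds

open Classical in
-- A horizontal derivative is known to be measurable in time only along stopped paths, and to be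
-- continuous only at fixed times. Stopping `X` at the grid point before `r` involves countably many
-- stopped paths, and converges at continuity points of `X`.
theorem FixedCont.aestronglyMeasurable (hT : 0 ≤ T) {f : PathFun T U} (hf : FixedCont f)
    (hm : ∀ (s : Time T) (X : Cadlag T U), Measurable fun r => if s < r then f r (X.stopped s) else 0)
    (X : Cadlag T U) (μ : Measure (Time T)) [NullSingletonClass μ] :
    AEStronglyMeasurable (fun r => f r X) μ := by
  refine aestronglyMeasurable_of_tendsto_ae (u := atTop) (f := fun n r =>
    if gridFloor hT n r < r then f r (X.stopped (gridFloor hT n r)) else 0) (fun n => ?_) ?_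
  · have h1 : Measurable fun r : Time T => (⌈(r : ℝ) * (n + 1)⌉₊, r) :=
      (Nat.measurable_ceil.comp (measurable_subtype_coe.mul_const _)).prodMk measurable_id
    have h2 : Measurable fun p : ℕ × Time T =>
        if gridPt hT n p.1 < p.2 then f p.2 (X.stopped (gridPt hT n p.1)) else 0 :=
      measurable_from_prod_countable_right fun k => hm (gridPt hT n k) X
    exact (h2.comp h1).aestronglyMeasurable
  · filter_upwards [X.ae_continuousAt μ] with r hr
    have : ∀ n, gridFloor hT n r < r := fun n => (gridFloor_spec hT n hr.1).1
    simp only [this, if_true]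
    exact ((hf r hr.1 X).comp (tendsto_nhdsFixed_of_continuousAt X hr.2)).comp
      (tendsto_gridFloor hT hr.1)

end PathFunctionals


/-! ### Integral functionals -/

section IntegralFunctionals

variable {T : ℝ} {d : ℕ} {U : Set (Vec d)}

/-- Together with boundedness preservation this supplies the dominating constants near a given path.
-/
theorem Cadlag.exists_compact_nhd (hU : IsOpen U) (X : Cadlag T U) :
    ∃ K : Set (Vec d), IsCompact K ∧ K ⊆ U ∧ ∃ δ > (0 : ℝ), ∀ Y : Cadlag T U,
      (∀ u, dist (X u) (Y u) < δ) → ∀ u, Y u ∈ K := by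
  obtain ⟨K, hK, hKU, hXK⟩ := X.exists_compact hU
  obtain ⟨δ, hδ, hsub⟩ := hK.exists_cthickening_subset_open hU hKU
  refine ⟨Metric.cthickening δ K, hK.cthickening, hsub, δ, hδ, fun Y hY u => ?_⟩
  refine Metric.mem_cthickening_of_dist_le (Y u) (X u) δ K (hXK u) ?_
  rw [dist_comm]
  exact (hY u).le

theorem BddPres.exists_bound {f : PathFun T U} (hU : IsOpen U) (hf : BddPres f) (X : Cadlag T U) :
    ∃ C : ℝ, ∀ t, |f t X| ≤ C := by
  obtain ⟨K, hK, hKU, hXK⟩ := X.exists_compact hU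
  obtain ⟨C, hC⟩ := hf K hK hKU
  exact ⟨C, fun t => hC t X hXK⟩

/-- Integrands `φ` for which `(t,X) ↦ ∫_{[0,t]} φ(r,X) ρ(r) dμ(r)` is a regular functional. -/
structure IsIntegrand (μ : Measure (Time T)) (φ : PathFun T U) : Prop where
  adapted : Adapted φ
  bddPres : BddPres φ
  fixedCont : FixedCont φ
  aesm : ∀ X, AEStronglyMeasurable (fun r => φ r X) μ

/-- Regular functionals that do not depend on the value of the path at the present time. -/
structure IsVertTrivial (J : PathFun T U) : Prop where
  adapted : Adapted J
  leftCont : LeftCont J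
  unifCont : UnifCont J
  bddPres : BddPres J
  congr : ∀ t X Y, (∀ u < t, X u = Y u) → J t X = J t Y

theorem IsIntegrand.integrable (hU : IsOpen U) {μ : Measure (Time T)} {φ : PathFun T U}
    (hφ : IsIntegrand μ φ) {ρ : Time T → ℝ} (hρ : Integrable ρ μ) (X : Cadlag T U) :
    Integrable (fun r => φ r X * ρ r) μ := by
  obtain ⟨C, hC⟩ := hφ.bddPres.exists_bound hU X
  exact integrable_bdd_mul (hφ.aesm X) hC hρ

theorem supDist_mono_stopped (X Y : Cadlag T U) {r s t : Time T} (hrs : r ≤ s) (hrt : r ≤ t) :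
    supDist (X.stopped r) (Y.stopped r) ≤ supDist (X.stopped t) (Y.stopped s) := by
  refine iSup_le fun u => ?_
  have h1 : X.stopped r u = X.stopped t (min r u) := by
    rw [Cadlag.stopped_apply, Cadlag.stopped_of_ge _ ((min_le_left _ _).trans hrt)]
  have h2 : Y.stopped r u = Y.stopped s (min r u) := by
    rw [Cadlag.stopped_apply, Cadlag.stopped_of_ge _ ((min_le_left _ _).trans hrs)]
  rw [h1, h2]
  exact le_iSup (fun v => edist (X.stopped t v) (Y.stopped s v)) (min r u)

theorem tendsto_fst_nhdsLeft (t : Time T) (X : Cadlag T U) :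
    Tendsto Prod.fst (nhdsLeft t X) (𝓝[≤] t) :=
  tendsto_comap.mono_left inf_le_right

theorem tendsto_snd_nhdsFixed {r t : Time T} (hrt : r < t) (X : Cadlag T U) :
    Tendsto Prod.snd (nhdsLeft t X) (nhdsFixed r X) := by
  refine (nhdsFixed_hasBasis r X).tendsto_right_iff.2 fun δ hδ => ?_
  have h1 : ∀ᶠ p in nhdsLeft t X, r < p.1 :=
    (tendsto_fst_nhdsLeft t X) (mem_nhdsWithin_of_mem_nhds (Ioi_mem_nhds hrt))
  filter_upwards [h1, (nhdsLeft_hasBasis t X).mem_of_mem hδ] with p hp hp'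
  exact (supDist_mono_stopped X p.2 hp.le hrt.le).trans_lt hp'.2.2

theorem nhdsSup_le_nhdsFixed (r : Time T) (X : Cadlag T U) : nhdsSup X ≤ nhdsFixed r X := by
  refine (nhdsFixed_hasBasis r X).ge_iff.2 fun δ hδ => ?_
  filter_upwards [(nhdsSup_hasBasis X).mem_of_mem hδ] with Y hY
  refine lt_of_le_of_lt (iSup_le fun u => ?_) hY
  exact le_iSup (fun v => edist (X v) (Y v)) (min r u)

theorem ae_pos (μ : Measure (Time T)) [NullSingletonClass μ] : ∀ᵐ r : Time T ∂μ, 0 < (r : ℝ) := by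
  have hc : {r : Time T | (r : ℝ) = 0}.Countable :=
    Set.Subsingleton.countable fun a ha b hb => Subtype.ext (ha.trans hb.symm)
  filter_upwards [hc.ae_notMem μ] with r hr
  exact lt_of_le_of_ne r.2.1 (fun h => hr h.symm)

/-- Dominated convergence. If `(s,Y)` tends to `(t,X)` from the left, then `Y^r → X^r` for each `r <
t`, so continuity of `φ` at fixed times suffices; times after `t` do not contribute. The time `t`
itself is a null set, whence the independence of the value of the path at `t`. -/
theorem IsIntegrand.isVertTrivial (hU : IsOpen U) {μ : Measure (Time T)} [NullSingletonClass μ]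
    {φ : PathFun T U} (hφ : IsIntegrand μ φ) {ρ : Time T → ℝ} (hρ : Integrable ρ μ) :
    IsVertTrivial (fun t X => ∫ r in Iic t, φ r X * ρ r ∂μ) where
  adapted t X := by
    refine setIntegral_congr_fun measurableSet_Iic fun r hr => ?_
    simp only [hφ.adapted.eq_stopped (mem_Iic.1 hr)]
  bddPres K hK hKU := by
    obtain ⟨C, hC⟩ := hφ.bddPres K hK hKU
    refine ⟨∫ r, |C| * |ρ r| ∂μ, fun t X hX => ?_⟩
    rw [← Real.norm_eq_abs]
    refine (norm_integral_le_integral_norm _).trans ?_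
    refine (setIntegral_le_integral (hφ.integrable hU hρ X).norm
      (ae_of_all _ fun r => norm_nonneg _)).trans ?_
    refine integral_mono (hφ.integrable hU hρ X).norm (hρ.abs.const_mul _) fun r => ?_
    simp only [norm_mul, Real.norm_eq_abs]
    exact mul_le_mul_of_nonneg_right ((hC r X hX).trans (le_abs_self C)) (abs_nonneg _)
  congr t X Y h := by
    have hne : ∀ᵐ r ∂μ, r ≠ t := (countable_singleton t).ae_notMem μ
    refine setIntegral_congr_ae measurableSet_Iic ?_
    filter_upwards [hne] with r hr hrt
    rw [hφ.adapted.congr fun u hu => h u (lt_of_le_of_lt hu (lt_of_le_of_ne (mem_Iic.1 hrt) hr))]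
  leftCont t ht X := by
    obtain ⟨K, hK, hKU, δ, hδ, hX⟩ := (X.stopped t).exists_compact_nhd hU
    obtain ⟨C, hC⟩ := hφ.bddPres K hK hKU
    have hne : ∀ᵐ r ∂μ, r ≠ t := (countable_singleton t).ae_notMem μ
    simp_rw [← integral_indicator (μ := μ) (measurableSet_Iic (α := Time T))]
    refine tendsto_integral_filter_of_dominated_convergence (fun r => |C| * |ρ r|) ?_ ?_
      (hρ.abs.const_mul _) ?_
    · exact Eventually.of_forall fun p =>
        ((hφ.integrable hU hρ p.2).indicator measurableSet_Iic).aestronglyMeasurable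
    · filter_upwards [(nhdsLeft_hasBasis t X).mem_of_mem hδ] with p hp
      refine ae_of_all _ fun r => ?_
      by_cases hr : r ∈ Iic p.1
      · rw [indicator_of_mem hr, norm_mul, Real.norm_eq_abs, Real.norm_eq_abs,
          ← hφ.adapted.eq_stopped (mem_Iic.1 hr)]
        exact mul_le_mul_of_nonneg_right ((hC _ _ (hX _ fun u =>
          dist_lt_of_supDist_lt hp.2.2 u)).trans (le_abs_self C)) (abs_nonneg _)
      · rw [indicator_of_notMem hr, norm_zero]
        positivity
    · filter_upwards [hne, ae_pos μ] with r hr hr0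
      rcases lt_or_gt_of_ne hr with hrt | hrt
      · rw [indicator_of_mem (mem_Iic.2 hrt.le)]
        have h1 : ∀ᶠ p in nhdsLeft t X, r < p.1 :=
          (tendsto_fst_nhdsLeft t X) (mem_nhdsWithin_of_mem_nhds (Ioi_mem_nhds hrt))
        refine (((hφ.fixedCont r hr0 X).comp (tendsto_snd_nhdsFixed hrt X)).mul_const
          (ρ r)).congr' ?_
        filter_upwards [h1] with p hp
        rw [indicator_of_mem (mem_Iic.2 hp.le)]
        rfl
      · rw [indicator_of_notMem (notMem_Iic.2 hrt)]
        refine tendsto_const_nhds.congr' ?_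
        filter_upwards [(nhdsLeft_hasBasis t X).mem_of_mem hδ] with p hp
        rw [indicator_of_notMem (notMem_Iic.2 (hp.1.trans_lt hrt))]
  unifCont X ε hε := by
    obtain ⟨K, hK, hKU, δ, hδ, hX⟩ := X.exists_compact_nhd hU
    obtain ⟨C, hC⟩ := hφ.bddPres K hK hKU
    have hXK : ∀ u, X u ∈ K := hX X fun u => by rwa [dist_self]
    have hint : ∀ Y, Integrable (fun r => φ r X * ρ r - φ r Y * ρ r) μ := fun Y =>
      (hφ.integrable hU hρ X).sub (hφ.integrable hU hρ Y)
    -- The `L¹` distance over all of `[0,T]` bounds the difference of the integrals over `[0,u]` for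
    -- all `u` simultaneously.
    have key : Tendsto (fun Y => ∫ r, ‖φ r X * ρ r - φ r Y * ρ r‖ ∂μ) (nhdsSup X) (𝓝 0) := by
      rw [show 𝓝 (0 : ℝ) = 𝓝 (∫ r : Time T, (0 : ℝ) ∂μ) by simp]
      refine tendsto_integral_filter_of_dominated_convergence (fun r => 2 * |C| * |ρ r|) ?_ ?_
        (hρ.abs.const_mul _) ?_
      · exact Eventually.of_forall fun Y => (hint Y).norm.aestronglyMeasurable
      · filter_upwards [(nhdsSup_hasBasis X).mem_of_mem hδ] with Y hY
        refine ae_of_all _ fun r => ?_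
        rw [norm_norm, ← sub_mul, norm_mul, Real.norm_eq_abs, Real.norm_eq_abs]
        gcongr
        have h1 := hC r X hXK
        have h2 := hC r Y (hX Y fun u => dist_lt_of_supDist_lt hY u)
        have h3 := le_abs_self C
        linarith [abs_sub (φ r X) (φ r Y)]
      · filter_upwards [ae_pos μ] with r hr
        have h1 : Tendsto (fun Y => φ r Y) (nhdsSup X) (𝓝 (φ r X)) :=
          (hφ.fixedCont r hr X).mono_left (nhdsSup_le_nhdsFixed r X)
        have h2 := (tendsto_const_nhds (x := φ r X * ρ r)).sub (h1.mul_const (ρ r))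
        rw [sub_self] at h2
        simpa using h2.norm
    filter_upwards [key (gt_mem_nhds hε)] with Y hY u
    rw [← integral_sub (hφ.integrable hU hρ X).integrableOn (hφ.integrable hU hρ Y).integrableOn,
      ← Real.norm_eq_abs]
    exact ((norm_integral_le_integral_norm _).trans (setIntegral_le_integral (hint Y).norm
      (ae_of_all _ fun r => norm_nonneg _))).trans_lt hY

theorem IsVertTrivial.sum {ι : Type*} (s : Finset ι) {J : ι → PathFun T U}
    (h : ∀ i ∈ s, IsVertTrivial (J i)) : IsVertTrivial (fun t X => ∑ i ∈ s, J i t X) where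
  adapted t X := Finset.sum_congr rfl fun i hi => (h i hi).adapted t X
  leftCont t ht X := tendsto_finsetSum s fun i hi => (h i hi).leftCont t ht X
  congr t X Y hXY := Finset.sum_congr rfl fun i hi => (h i hi).congr t X Y hXY
  bddPres K hK hKU := by
    have : ∀ i : s, ∃ C : ℝ, ∀ (t : Time T) (X : Cadlag T U), (∀ u, X u ∈ K) → |J i t X| ≤ C :=
      fun i => (h i i.2).bddPres K hK hKU
    choose C hC using this
    refine ⟨∑ i, C i, fun t X hX => ?_⟩
    change |∑ i ∈ s, J i t X| ≤ _
    rw [← Finset.sum_coe_sort s fun i => J i t X]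
    exact (Finset.abs_sum_le_sum_abs _ _).trans (Finset.sum_le_sum fun i _ => hC i t X hX)
  unifCont X ε hε := by
    have hpos : 0 < ε / (s.card + 1) := by positivity
    have := (Filter.eventually_all_finset s).2 fun i hi =>
      (h i hi).unifCont X (ε / (s.card + 1)) hpos
    filter_upwards [this] with Y hY u
    rw [← Finset.sum_sub_distrib]
    refine (Finset.abs_sum_le_sum_abs _ _).trans_lt ?_
    refine (Finset.sum_le_card_nsmul s _ (ε / (s.card + 1)) fun i hi => (hY i hi u).le).trans_lt ?_
    rw [nsmul_eq_mul, mul_div_assoc', div_lt_iff₀ (by positivity)]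
    nlinarith

theorem IsVertTrivial.const (c : ℝ) : IsVertTrivial (fun (_ : Time T) (_ : Cadlag T U) => c) where
  adapted _ _ := rfl
  leftCont _ _ _ := tendsto_const_nhds
  congr _ _ _ _ := rfl
  bddPres _ _ _ := ⟨|c|, fun _ _ _ => le_rfl⟩
  unifCont _ ε hε := Eventually.of_forall fun _ _ => by simpa using hε

theorem continuous_integral_Iic {μ : Measure (Time T)} [NullSingletonClass μ] {ψ : Time T → ℝ}
    (hψ : Integrable ψ μ) : Continuous fun t => ∫ r in Iic t, ψ r ∂μ := by
  refine continuous_iff_continuousAt.2 fun t => ?_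
  have hne : ∀ᵐ r ∂μ, r ≠ t := (countable_singleton t).ae_notMem μ
  unfold ContinuousAt
  simp_rw [← integral_indicator (μ := μ) (measurableSet_Iic (α := Time T))]
  refine tendsto_integral_filter_of_dominated_convergence (fun r => ‖ψ r‖)
    (Eventually.of_forall fun s => (hψ.indicator measurableSet_Iic).aestronglyMeasurable)
    (Eventually.of_forall fun s => ae_of_all _ fun r => norm_indicator_le_norm_self _ _)
    hψ.norm ?_
  filter_upwards [hne] with r hr
  refine tendsto_const_nhds.congr' ?_
  rcases lt_or_gt_of_ne hr with h | h
  · filter_upwards [Ioi_mem_nhds h] with s hs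
    rw [indicator_of_mem (mem_Iic.2 h.le), indicator_of_mem (mem_Iic.2 (mem_Ioi.1 hs).le)]
  · filter_upwards [Iio_mem_nhds h] with s hs
    rw [indicator_of_notMem (notMem_Iic.2 h), indicator_of_notMem (notMem_Iic.2 (mem_Iio.1 hs))]

end IntegralFunctionals


/-! ### Vertical calculus -/

section VerticalCalculus

variable {T : ℝ} {d : ℕ} {U : Set (Vec d)}

noncomputable def pgrad (f : PathFun T U) (t : Time T) (X : Cadlag T U) : Vec d :=
  gradient (fun v : Vec d => f t (X.bump t v)) 0

noncomputable def ppartial (i : Fin d) (f : PathFun T U) : PathFun T U :=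
  fun t X => pgrad f t X i

def VertDiff (f : PathFun T U) : Prop :=
  ∀ (t : Time T) (X : Cadlag T U), DifferentiableAt ℝ (fun v : Vec d => f t (X.bump t v)) 0

theorem Adapted.bump_eventuallyEq (hU : IsOpen U) {f : PathFun T U} (hf : Adapted f) (t : Time T)
    (X : Cadlag T U) :
    (fun v => f t (X.bump t v)) =ᶠ[𝓝 0] fun v => f t (X.jump t (X t + v)) := by
  filter_upwards [X.eventually_bump_stopped hU t] with v hv
  rw [hf, hv]

theorem eventually_add_mem (hU : IsOpen U) {x : Vec d} (hx : x ∈ U) :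
    ∀ᶠ v in 𝓝 (0 : Vec d), x + v ∈ U :=
  (continuous_const.add continuous_id).tendsto' (0 : Vec d) x (by simp) (hU.mem_nhds hx)

theorem Adapted.pgrad_stopped (hU : IsOpen U) {f : PathFun T U} (hf : Adapted f) (t : Time T)
    (X : Cadlag T U) : pgrad f t (X.stopped t) = pgrad f t X := by
  refine Filter.EventuallyEq.gradient_eq ?_
  refine (hf.bump_eventuallyEq hU t _).trans (EventuallyEq.trans ?_
    (hf.bump_eventuallyEq hU t X).symm)
  filter_upwards [eventually_add_mem hU (X.mem t)] with v hv
  rw [X.stopped_of_le le_rfl, X.stopped_jump t hv]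

theorem Adapted.ppartial (hU : IsOpen U) {f : PathFun T U} (hf : Adapted f) (i : Fin d) :
    Adapted (ppartial i f) := fun t X => by
  rw [PathwiseIto.ppartial, PathwiseIto.ppartial, hf.pgrad_stopped hU]

theorem HasGradientAt.comp_sub_const {g : Vec d → ℝ} {v x : Vec d}
    (h : HasGradientAt (fun w => g (x + w)) v 0) : HasGradientAt g v x := by
  rw [hasGradientAt_iff_hasFDerivAt] at h ⊢
  have h1 : HasFDerivAt (fun y : Vec d => y - x) (ContinuousLinearMap.id ℝ (Vec d)) x :=
    (hasFDerivAt_id x).sub_const x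
  have h2 : HasFDerivAt (fun w => g (x + w)) (InnerProductSpace.toDual ℝ (Vec d) v)
      ((fun y : Vec d => y - x) x) := by simpa using h
  have := HasFDerivAt.comp (f := fun y : Vec d => y - x) x h2 h1
  simpa [Function.comp_def] using this

theorem HasGradientAt.comp_const_add {g : Vec d → ℝ} {v x : Vec d}
    (h : HasGradientAt g v x) : HasGradientAt (fun w => g (x + w)) v 0 := by
  rw [hasGradientAt_iff_hasFDerivAt] at h ⊢
  have h1 : HasFDerivAt (fun y : Vec d => x + y) (ContinuousLinearMap.id ℝ (Vec d)) 0 :=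
    (hasFDerivAt_id (0 : Vec d)).const_add x
  rw [← add_zero x] at h
  have := HasFDerivAt.comp (0 : Vec d) h h1
  simpa [Function.comp_def] using this

/-- Applying vertical differentiability to the path that already has the value `x` gives
differentiability at every `x ∈ U`, as the mean value theorem and Taylor's formula require. -/
theorem VertDiff.hasGradientAt_jump (hU : IsOpen U) {f : PathFun T U} (hf : VertDiff f)
    (t : Time T) (X : Cadlag T U) {x : Vec d} (hx : x ∈ U) :
    HasGradientAt (fun y => f t (X.jump t y)) (pgrad f t (X.jump t x)) x := by
  have h1 : HasGradientAt (fun v => f t ((X.jump t x).bump t v)) (pgrad f t (X.jump t x)) 0 :=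
    (hf t (X.jump t x)).hasGradientAt
  refine HasGradientAt.comp_sub_const (h1.congr_of_eventuallyEq ?_)
  filter_upwards [eventually_add_mem hU hx] with v hv
  rw [X.jump_bump t hx hv]

theorem Adapted.hasGradientAt_bump (hU : IsOpen U) {f : PathFun T U} (hf : Adapted f)
    {t : Time T} {X : Cadlag T U} {g : Vec d}
    (h : HasGradientAt (fun y => f t (X.jump t y)) g (X t)) :
    HasGradientAt (fun v => f t (X.bump t v)) g 0 :=
  (HasGradientAt.comp_const_add h).congr_of_eventuallyEq (hf.bump_eventuallyEq hU t X)

/-- The regularity demanded by `ℂ^{1,2}_c`, apart from horizontal differentiability. -/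
structure IsRegular (f : PathFun T U) : Prop where
  adapted : Adapted f
  leftCont : LeftCont f
  unifCont : UnifCont f
  bddPres : BddPres f
  vdiff : VertDiff f
  vdiff_two : ∀ i, VertDiff (ppartial i f)
  grad_leftCont : ∀ i, LeftCont (ppartial i f)
  grad_bddPres : ∀ i, BddPres (ppartial i f)
  hess_leftCont : ∀ i j, LeftCont (ppartial i (ppartial j f))
  hess_bddPres : ∀ i j, BddPres (ppartial i (ppartial j f))

/-- Regular functionals with vanishing horizontal derivative. -/
structure IsFlat (f : PathFun T U) : Prop extends IsRegular f where
  flat : ∀ s t, s ≤ t → ∀ X : Cadlag T U, f t (X.stopped s) = f s (X.stopped s)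

theorem IsVertTrivial.bump {J : PathFun T U} (hJ : IsVertTrivial J) (t : Time T) (X : Cadlag T U)
    (v : Vec d) : J t (X.bump t v) = J t X :=
  hJ.congr _ _ _ fun _ hu => X.bump_of_lt v hu

theorem pgrad_sub_vertTrivial {f J : PathFun T U} (hf : VertDiff f) (hJ : IsVertTrivial J)
    (t : Time T) (X : Cadlag T U) :
    HasGradientAt (fun v => f t (X.bump t v) - J t (X.bump t v)) (pgrad f t X) 0 := by
  have h1 : HasGradientAt (fun v => f t (X.bump t v)) (pgrad f t X) 0 := (hf t X).hasGradientAt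
  simp only [hJ.bump]
  rw [hasGradientAt_iff_hasFDerivAt] at h1 ⊢
  exact h1.sub_const _

theorem pgrad_sub {f J : PathFun T U} (hf : VertDiff f) (hJ : IsVertTrivial J) :
    pgrad (fun t X => f t X - J t X) = pgrad f := by
  funext t X
  exact (pgrad_sub_vertTrivial hf hJ t X).gradient

/-- A bump at `t` does not affect `J` at time `t`, so all conditions on gradient and Hessian are
inherited verbatim from `f`. -/
theorem IsRegular.sub {f J : PathFun T U} (hf : IsRegular f) (hJ : IsVertTrivial J) :
    IsRegular (fun t X => f t X - J t X) := by
  have hp : ∀ i, ppartial i (fun t X => f t X - J t X) = ppartial i f := fun i => by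
    unfold ppartial
    rw [pgrad_sub hf.vdiff hJ]
  refine ⟨fun t X => ?_, fun t ht X => ?_, fun X ε hε => ?_, fun K hK hKU => ?_, fun t X => ?_,
    fun i => ?_, fun i => ?_, fun i => ?_, fun i j => ?_, fun i j => ?_⟩
  · rw [← hf.adapted, ← hJ.adapted]
  · exact (hf.leftCont t ht X).sub (hJ.leftCont t ht X)
  · filter_upwards [hf.unifCont X (ε / 2) (by positivity),
      hJ.unifCont X (ε / 2) (by positivity)] with Y h1 h2 u
    have h3 := abs_sub (f u X - f u Y) (J u X - J u Y)
    have h4 : f u X - J u X - (f u Y - J u Y) = f u X - f u Y - (J u X - J u Y) := by ring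
    rw [h4]
    linarith [h1 u, h2 u]
  · obtain ⟨C, hC⟩ := hf.bddPres K hK hKU
    obtain ⟨C', hC'⟩ := hJ.bddPres K hK hKU
    exact ⟨C + C', fun t X hX => (abs_sub _ _).trans (add_le_add (hC t X hX) (hC' t X hX))⟩
  · exact (pgrad_sub_vertTrivial hf.vdiff hJ t X).differentiableAt
  · rw [hp]; exact hf.vdiff_two i
  · rw [hp]; exact hf.grad_leftCont i
  · rw [hp]; exact hf.grad_bddPres i
  · rw [hp]; exact hf.hess_leftCont i j
  · rw [hp]; exact hf.hess_bddPres i j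

end VerticalCalculus

/-! ### Slices of functionals at a fixed path of bounded variation -/

section Slices

variable {T : ℝ} {d m : ℕ} {U : Set (Vec d)} {S : Set (Vec m)}

theorem CBV.stopped_stopped_self (A : CBV T S) (t : Time T) :
    (A.stopped t).stopped t = A.stopped t := by
  ext1; funext u
  change A (min t (min t u)) = A (min t u)
  rw [← min_assoc, min_self]

theorem Cadlag.stopped_stopped_self (X : Cadlag T U) (t : Time T) :
    (X.stopped t).stopped t = X.stopped t := by
  rw [X.stopped_stopped, min_self]

theorem NonAnticipative.stopped_right {F : Functional T U S} (hF : NonAnticipative F) (t : Time T)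
    (X : Cadlag T U) (A : CBV T S) : F t X (A.stopped t) = F t X A := by
  rw [hF t X (A.stopped t), hF t X A, CBV.stopped_stopped_self]

theorem NonAnticipative.adapted {F : Functional T U S} (hF : NonAnticipative F) (A : CBV T S) :
    Adapted fun t X => F t X A := fun t X => by
  change F t X A = F t (X.stopped t) A
  rw [hF t X A, hF t (X.stopped t) A, Cadlag.stopped_stopped_self]

theorem vpartial_stopped_right (F : Functional T U S) (i : Fin d) (t : Time T) (X : Cadlag T U)
    (A : CBV T S) : vpartial i F t X (A.stopped t) = vpartial i F t X A := by
  simp only [vpartial, vgrad, CBV.stopped_stopped_self]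

/-- The vertical derivative is taken with `A` stopped at `t`, which is immaterial for
non-anticipative `F`, and by construction for vertical partial derivatives. Hence derivatives can be
iterated with `A` frozen. -/
theorem vgrad_eq_pgrad {F : Functional T U S} (hF : ∀ t X A, F t X (A.stopped t) = F t X A)
    (t : Time T) (X : Cadlag T U) (A : CBV T S) :
    vgrad F t X A = pgrad (fun t X => F t X A) t X := by
  simp only [vgrad, pgrad, hF]

theorem vpartial_eq_ppartial {F : Functional T U S}
    (hF : ∀ t X A, F t X (A.stopped t) = F t X A) (i : Fin d) (A : CBV T S) :
    (fun t X => vpartial i F t X A) = ppartial i (fun t X => F t X A) := by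
  funext t X
  rw [vpartial, ppartial, vgrad_eq_pgrad hF]

theorem vpartial_vpartial_eq_ppartial {F : Functional T U S}
    (hF : ∀ t X A, F t X (A.stopped t) = F t X A) (i j : Fin d) (A : CBV T S) :
    (fun t X => vpartial i (vpartial j F) t X A) =
      ppartial i (ppartial j (fun t X => F t X A)) := by
  rw [vpartial_eq_ppartial (vpartial_stopped_right F j), vpartial_eq_ppartial hF]

theorem verticallyDifferentiable_iff {F : Functional T U S}
    (hF : ∀ t X A, F t X (A.stopped t) = F t X A) :
    VerticallyDifferentiable F ↔ ∀ A, VertDiff fun t X => F t X A := by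
  simp only [VerticallyDifferentiable, VertDiff, hF]
  exact ⟨fun h A t X => h t X A, fun h t X A => h A t X⟩

theorem leftContinuous_iff {F : Functional T U S} :
    LeftContinuous F ↔ ∀ A, LeftCont fun t X => F t X A := by
  have key : ∀ (t : Time T) X A, Tendsto (fun p : Time T × Cadlag T U => F p.1 p.2 A)
      (nhdsLeft t X) (𝓝 (F t X A)) ↔ ∀ ε > (0 : ℝ), ∃ δ > (0 : ℝ),
    ∀ s : Time T, s ≤ t → (t : ℝ) - s < δ → ∀ Y : Cadlag T U,
      supDist (X.stopped t) (Y.stopped s) < ENNReal.ofReal δ → |F t X A - F s Y A| < ε := by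
    intro t X A
    rw [((nhdsLeft_hasBasis t X).tendsto_iff Metric.nhds_basis_ball)]
    refine forall₂_congr fun ε hε => exists_congr fun δ => and_congr_right fun hδ => ?_
    constructor
    · intro h s hs hs' Y hY
      have := h (s, Y) ⟨hs, hs', hY⟩
      rwa [Metric.mem_ball, dist_comm] at this
    · rintro h ⟨s, Y⟩ ⟨hs, hs', hY⟩
      rw [Metric.mem_ball, dist_comm]
      exact h s hs hs' Y hY
  constructor
  · intro h A t ht X
    exact (key t X A).2 fun ε hε => h t ht ε hε X A
  · intro h t ht ε hε X A
    exact (key t X A).1 (h A t ht X) ε hε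

theorem boundednessPreserving_iff {F : Functional T U S} :
    BoundednessPreserving F ↔ ∀ A, BddPres fun t X => F t X A := Iff.rfl

/-- Finitely many of the time intervals from the local condition cover `[0,T]`. -/
theorem ContinuousLocUnif.unifCont {F : Functional T U S} (hF : ContinuousLocUnif F)
    (A : CBV T S) : UnifCont fun t X => F t X A := by
  intro X ε hε
  have key : ∀ᶠ Y in nhdsSup X, ∀ u ∈ (univ : Set (Time T)), |F u X A - F u Y A| < ε := by
    refine IsCompact.induction_on (p := fun s : Set (Time T) =>
      ∀ᶠ Y in nhdsSup X, ∀ u ∈ s, |F u X A - F u Y A| < ε) isCompact_univ ?_ ?_ ?_ ?_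
    · exact Eventually.of_forall fun Y u hu => hu.elim
    · intro s t hst h
      exact h.mono fun Y hY u hu => hY u (hst hu)
    · intro s t hs ht
      filter_upwards [hs, ht] with Y h1 h2 u hu
      exact hu.elim (h1 u) (h2 u)
    · intro t _
      obtain ⟨δ, hδ, h⟩ := hF ε hε t X A
      refine ⟨Metric.ball t δ, by rw [nhdsWithin_univ]; exact Metric.ball_mem_nhds t hδ, ?_⟩
      filter_upwards [(nhdsSup_hasBasis X).mem_of_mem hδ] with Y hY u hu
      refine h u Y hY ?_
      rwa [Metric.mem_ball, dist_comm] at hu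
  exact key.mono fun Y hY u => hY u (mem_univ u)

theorem continuousLocUnif_of_unifCont {F : Functional T U S}
    (hF : ∀ A, UnifCont fun t X => F t X A) : ContinuousLocUnif F := by
  intro ε hε t X A
  obtain ⟨δ, hδ, h⟩ := (nhdsSup_hasBasis X).eventually_iff.1 (hF A X ε hε)
  exact ⟨δ, hδ, fun u Y hY _ => h hY u⟩

theorem IsC12c.isRegular {F : Functional T U S} (hF : IsC12c F) (A : CBV T S) :
    IsRegular fun t X => F t X A := by
  have hinv := hF.nonAnticipative.stopped_right
  refine ⟨hF.nonAnticipative.adapted A, leftContinuous_iff.1 hF.leftContinuous A,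
    hF.continuousLocUnif.unifCont A, hF.boundednessPreserving A,
    (verticallyDifferentiable_iff hinv).1 hF.vdiff A, fun i => ?_, fun i => ?_, fun i => ?_,
    fun i j => ?_, fun i j => ?_⟩
  · rw [← vpartial_eq_ppartial hinv]
    exact (verticallyDifferentiable_iff (vpartial_stopped_right F i)).1 (hF.vdiff_two i) A
  · rw [← vpartial_eq_ppartial hinv]
    exact leftContinuous_iff.1 (hF.grad_leftContinuous i) A
  · rw [← vpartial_eq_ppartial hinv]
    exact hF.grad_boundednessPreserving i A
  · rw [← vpartial_vpartial_eq_ppartial hinv]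
    exact leftContinuous_iff.1 (hF.hess_leftContinuous i j) A
  · rw [← vpartial_vpartial_eq_ppartial hinv]
    exact hF.hess_boundednessPreserving i j A

theorem isC12c_of_slices {F : Functional T U S} (hF : NonAnticipative F)
    (hreg : ∀ A, IsRegular fun t X => F t X A) (hhor : ∃ D : Fin (m + 1) → Functional T U S,
      IsHorizontalDerivative F D ∧ ∀ i, ContinuousAtFixedTimes (D i)) : IsC12c F := by
  have hinv := hF.stopped_right
  refine ⟨⟨hF, leftContinuous_iff.2 fun A => (hreg A).leftCont, hhor,
    (verticallyDifferentiable_iff hinv).2 fun A => (hreg A).vdiff, fun i => ?_, fun i => ?_,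
    fun i => ?_, fun i j => ?_, fun i j => ?_⟩,
    continuousLocUnif_of_unifCont fun A => (hreg A).unifCont, fun A => (hreg A).bddPres⟩
  · refine (verticallyDifferentiable_iff (vpartial_stopped_right F i)).2 fun A => ?_
    rw [vpartial_eq_ppartial hinv]
    exact (hreg A).vdiff_two i
  · refine leftContinuous_iff.2 fun A => ?_
    rw [vpartial_eq_ppartial hinv]
    exact (hreg A).grad_leftCont i
  · refine boundednessPreserving_iff.2 fun A => ?_
    rw [vpartial_eq_ppartial hinv]
    exact (hreg A).grad_bddPres i
  · refine leftContinuous_iff.2 fun A => ?_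
    rw [vpartial_vpartial_eq_ppartial hinv]
    exact (hreg A).hess_leftCont i j
  · refine boundednessPreserving_iff.2 fun A => ?_
    rw [vpartial_vpartial_eq_ppartial hinv]
    exact (hreg A).hess_bddPres i j

theorem lsIntegral_zero (a : Time T → ℝ) (B : Set (Time T)) : lsIntegral (fun _ => 0) a B = 0 := by
  unfold lsIntegral
  split_ifs
  · exact VectorMeasure.integral_zero
  · rfl

/-- With `m = 0` and zero horizontal derivative, the horizontal integral identity is exactly
flatness. -/
theorem IsFlat.isAdmissible {f : PathFun T U} (hf : IsFlat f) : IsAdmissible (pgrad f) := by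
  let A : CBV T (univ : Set (Vec 0)) := ⟨fun _ => 0, fun _ => mem_univ _, continuous_const,
    fun i => i.elim0⟩
  have hNA : NonAnticipative (fun (t : Time T) (X : Cadlag T U) (_ : CBV T (univ : Set (Vec 0))) =>
    f t X) := fun t X _ => hf.adapted t X
  refine ⟨0, univ, A, fun t X _ => f t X, isOpen_univ, isC12c_of_slices hNA
    (fun _ => hf.toIsRegular) ⟨fun _ _ _ _ => 0, ⟨fun _ _ _ _ => rfl, fun _ _ _ _ _ =>
      ⟨0, fun _ _ _ => by simp⟩, fun _ _ _ _ _ _ => measurable_const, fun s t hst X _ => ?_⟩,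
      fun _ ε hε _ _ _ => ⟨1, one_pos, fun _ _ => by simpa using hε⟩⟩, fun t X => ?_⟩
  · simp only [lsIntegral_zero, Finset.sum_const_zero]
    rw [hf.flat s t hst.le, sub_self]
  · exact (vgrad_eq_pgrad (F := fun (t : Time T) (X : Cadlag T U)
      (_ : CBV T (univ : Set (Vec 0))) => f t X) (fun _ _ _ => rfl) t X A).symm

theorem CBV.continuous_component (A : CBV T S) (i : Fin (m + 1)) : Continuous (A.component i) := by
  refine Fin.cases ?_ (fun j => ?_) i
  · exact continuous_subtype_val
  · exact (EuclideanSpace.proj j).continuous.comp A.cont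

theorem CBV.boundedVariationOn_component (A : CBV T S) (i : Fin (m + 1)) :
    BoundedVariationOn (A.component i) univ := by
  refine Fin.cases ?_ (fun j => ?_) i
  · exact Monotone.boundedVariationOn_time fun a b hab => hab
  · exact A.bv j

theorem continuousAtFixedTimes_iff {F : Functional T U S} : ContinuousAtFixedTimes F ↔
    ∀ t X A, Tendsto (fun Y => F t Y A) (nhdsFixed t X) (𝓝 (F t X A)) := by
  have key : ∀ (t : Time T) X A, Tendsto (fun Y => F t Y A) (nhdsFixed t X) (𝓝 (F t X A)) ↔
      ∀ ε > (0 : ℝ), ∃ δ > (0 : ℝ), ∀ Y : Cadlag T U,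
      supDist (X.stopped t) (Y.stopped t) < ENNReal.ofReal δ → |F t X A - F t Y A| < ε := by
    intro t X A
    rw [((nhdsFixed_hasBasis t X).tendsto_iff Metric.nhds_basis_ball)]
    refine forall₂_congr fun ε hε => exists_congr fun δ => and_congr_right fun hδ => ?_
    refine forall_congr' fun Y => imp_congr_right fun _ => ?_
    rw [Metric.mem_ball, dist_comm]
    rfl
  constructor
  · intro h t X A
    exact (key t X A).2 fun ε hε => h ε hε t X A
  · intro h ε hε t X A
    exact (key t X A).1 (h t X A) ε hε

theorem IsHorizontalDerivative.isIntegrand (hT : 0 ≤ T) {F : Functional T U S}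
    {D : Fin (m + 1) → Functional T U S} (hD : IsHorizontalDerivative F D)
    (hc : ∀ i, ContinuousAtFixedTimes (D i)) (A : CBV T S) (μ : Measure (Time T))
    [NullSingletonClass μ] (i : Fin (m + 1)) : IsIntegrand μ fun r X => D i r X A := by
  have hfc : FixedCont fun r X => D i r X A :=
    fun t _ X => continuousAtFixedTimes_iff.1 (hc i) t X A
  refine ⟨(hD.nonAnticipative i).adapted A, hD.boundednessPreserving i A, hfc,
    fun X => hfc.aestronglyMeasurable hT (fun s X => ?_) X μ⟩
  let e : Time T := ⟨T, hT, le_rfl⟩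
  -- Measurability is granted on `[s,t]` for `s < t`; take `t = T`. For `s = T` the condition `s <
  -- r` never holds.
  by_cases hs : s < e
  · refine measurable_of_restrict_of_restrict_compl (s := Icc s e) measurableSet_Icc ?_ ?_
    · refine Measurable.ite (measurableSet_lt measurable_const measurable_subtype_coe)
        (hD.measurable i s e hs X A) measurable_const
    · convert measurable_const (a := (0 : ℝ)) using 1
      funext r
      rw [domRestrict_apply, if_neg]
      intro h
      exact r.2 ⟨h.le, r.1.2.2⟩
  · convert measurable_const (a := (0 : ℝ)) using 1
    funext r
    rw [if_neg]
    intro h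
    exact hs (h.trans_le r.2.2)

/-- Subtracting the integrals of the horizontal derivative makes a functional flat. -/
theorem IsC12c.isFlat_sub (hT : 0 ≤ T) (hU : IsOpen U) {F : Functional T U S} (hF : IsC12c F)
    {D : Fin (m + 1) → Functional T U S} (hD : IsHorizontalDerivative F D)
    (hc : ∀ i, ContinuousAtFixedTimes (D i)) (A : CBV T S) {μ : Measure (Time T)}
    [NullSingletonClass μ] {ρ : Fin (m + 1) → Time T → ℝ}
    (hρ : ∀ i, HasLSDensity (A.component i) μ (ρ i)) :
    IsVertTrivial (fun t (X : Cadlag T U) => ∑ i, ∫ r in Iic t, D i r X A * ρ i r ∂μ) ∧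
    IsFlat (fun t X => F t X A - ∑ i, ∫ r in Iic t, D i r X A * ρ i r ∂μ) := by
  have hint := fun i => hD.isIntegrand hT hc A μ i
  have hJ : IsVertTrivial (fun t (X : Cadlag T U) => ∑ i, ∫ r in Iic t, D i r X A * ρ i r ∂μ) :=
    IsVertTrivial.sum _ fun i _ => (hint i).isVertTrivial hU (hρ i).integrable
  refine ⟨hJ, (hF.isRegular A).sub hJ, fun s t hst X => ?_⟩
  rcases hst.eq_or_lt with rfl | hlt
  · rfl
  · have h1 := hD.integral_eq s t hlt X A
    have h2 : ∀ i, lsIntegral (fun r => D i r (X.stopped s) A) (A.component i) (Ioc s t) =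
        (∫ r in Iic t, D i r (X.stopped s) A * ρ i r ∂μ) -
          ∫ r in Iic s, D i r (X.stopped s) A * ρ i r ∂μ := by
      intro i
      obtain ⟨C, hC⟩ := (hint i).bddPres.exists_bound hU (X.stopped s)
      rw [(hρ i).lsIntegral_eq (A.continuous_component i) (A.boundedVariationOn_component i)
        ((hint i).aesm _) hC measurableSet_Ioc]
      exact ((hasLSDensity_integral_Iic
        ((hint i).integrable hU (hρ i).integrable (X.stopped s))).sub_eq s t hst).symm
    simp only [h2, Finset.sum_sub_distrib] at h1
    linarith

/-- Every admissible integrand is the vertical derivative of a flat functional. -/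
theorem IsAdmissible.exists_isFlat (hT : 0 ≤ T) (hU : IsOpen U)
    {ξ : Time T → Cadlag T U → Vec d} (hξ : IsAdmissible ξ) :
    ∃ f : PathFun T U, IsFlat f ∧ ∀ t X, ξ t X = pgrad f t X := by
  obtain ⟨m, S, A, F, _, hF, hξF⟩ := hξ
  obtain ⟨D, hD, hc⟩ := hF.horizontal
  obtain ⟨μ, ρ, _, _, hρ⟩ := exists_hasLSDensity A.component A.continuous_component
    A.boundedVariationOn_component
  obtain ⟨hJ, hfl⟩ := hF.isFlat_sub hT hU hD hc A hρ
  refine ⟨_, hfl, fun t X => ?_⟩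
  rw [pgrad_sub (hF.isRegular A).vdiff hJ, hξF,
    vgrad_eq_pgrad hF.nonAnticipative.stopped_right]

end Slices


/-! ### Partitions -/

section Partitions

variable {T : ℝ}

theorem le_nextPt (P : Finset (Time T)) (t : Time T) : t ≤ nextPt P t := by
  classical
  unfold nextPt
  split_ifs with h
  · exact (Finset.mem_filter.1 (Finset.min'_mem _ h)).2.le
  · exact le_rfl

theorem nextPt_le (P : Finset (Time T)) {t p : Time T} (hp : p ∈ P) (h : t < p) :
    nextPt P t ≤ p := by
  classical
  have hm : p ∈ P.filter (t < ·) := Finset.mem_filter.2 ⟨hp, h⟩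
  unfold nextPt
  rw [dif_pos ⟨p, by convert hm⟩]
  exact Finset.min'_le _ _ (by convert hm)

theorem nextPt_spec (P : Finset (Time T)) {t p : Time T} (hp : p ∈ P) (h : t < p) :
    nextPt P t ∈ P ∧ t < nextPt P t := by
  classical
  have hm : p ∈ P.filter (t < ·) := Finset.mem_filter.2 ⟨hp, h⟩
  unfold nextPt
  rw [dif_pos ⟨p, by convert hm⟩]
  exact Finset.mem_filter.1 (Finset.min'_mem _ _)

/-- The hypothesis `h'` excludes `s < u` with no partition point after `s`: then `nextPt P u = u`
would vary with `u`. -/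
theorem nextPt_congr (P : Finset (Time T)) {s u : Time T} (hsu : s ≤ u)
    (h : ∀ p ∈ P, s < p → u < p) (h' : (∃ p ∈ P, s < p) ∨ s = u) : nextPt P u = nextPt P s := by
  classical
  rcases h' with ⟨p, hp, hsp⟩ | rfl
  · obtain ⟨h1, h2⟩ := nextPt_spec P hp hsp
    obtain ⟨h3, h4⟩ := nextPt_spec P hp (h p hp hsp)
    exact le_antisymm (nextPt_le P h1 (h _ h1 h2)) (nextPt_le P h3 (hsu.trans_lt h4))
  · rfl

theorem nextPt_eq_of_lt (P : Finset (Time T)) {s u : Time T} (hsu : s ≤ u)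
    (h : u < nextPt P s) : nextPt P u = nextPt P s := by
  classical
  refine nextPt_congr P hsu (fun p hp hsp => h.trans_le (nextPt_le P hp hsp)) ?_
  by_contra hcon
  push Not at hcon
  have : nextPt P s = s := by
    unfold nextPt
    rw [dif_neg]
    rintro ⟨p, hp⟩
    have := Finset.mem_filter.1 hp
    exact absurd this.2 (not_lt.2 (hcon.1 p this.1))
  rw [this] at h
  exact absurd h (not_lt.2 hsu)

theorem exists_floor (P : Finset (Time T)) {z t : Time T} (hz : z ∈ P) (hzt : z ≤ t) :
    ∃ s ∈ P, s ≤ t ∧ ∀ p ∈ P, p ≤ t → p ≤ s := by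
  classical
  have hne : (P.filter (· ≤ t)).Nonempty := ⟨z, Finset.mem_filter.2 ⟨hz, hzt⟩⟩
  have hm := Finset.mem_filter.1 (Finset.max'_mem _ hne)
  exact ⟨_, hm.1, hm.2, fun p hp hpt => Finset.le_max' _ _ (Finset.mem_filter.2 ⟨hp, hpt⟩)⟩

/-- `P` contains the end points `z` and `e` of `[0,T]`. -/
structure HasEnds (P : Finset (Time T)) (z e : Time T) : Prop where
  zmem : z ∈ P
  emem : e ∈ P
  zle : ∀ u, z ≤ u
  lee : ∀ u, u ≤ e

theorem HasEnds.nextPt_floor {P : Finset (Time T)} {z e : Time T} (hP : HasEnds P z e)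
    {s t : Time T} (hst : s ≤ t) (hmax : ∀ p ∈ P, p ≤ t → p ≤ s) :
    nextPt P t = nextPt P s := by
  refine nextPt_congr P hst (fun p hp hsp => ?_) ?_
  · by_contra hcon
    exact absurd (hmax p hp (not_lt.1 hcon)) (not_le.2 hsp)
  · rcases (hP.lee s).eq_or_lt with h | h
    · right
      exact le_antisymm hst (h ▸ hP.lee t)
    · exact Or.inl ⟨e, hP.emem, h⟩

theorem HasEnds.nextPt_sub_lt {P : Finset (Time T)} {z e : Time T} (hP : HasEnds P z e) {ε : ℝ}
    (h : ∀ s ∈ P, (nextPt P s : ℝ) - s < ε) (u : Time T) : (nextPt P u : ℝ) - u < ε := by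
  obtain ⟨s, hs, hsu, hmax⟩ := exists_floor P hP.zmem (hP.zle u)
  rw [hP.nextPt_floor hsu hmax]
  have : (s : ℝ) ≤ u := hsu
  linarith [h s hs]

/-- Induction on the number of partition points up to `t`. The largest one, `s`, has the same
successor as `t`; it is split off, and the partition point preceding it has successor `s`. -/
theorem HasEnds.sum_telescope {P : Finset (Time T)} {z e : Time T} (hP : HasEnds P z e)
    (g : Time T → ℝ) (t : Time T) :
    ∑ s ∈ P with s ≤ t, (g (nextPt P s) - g s) = g (nextPt P t) - g z := by
  classical
  induction hn : (P.filter (· ≤ t)).card using Nat.strong_induction_on generalizing t with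
  | _ n ih =>
    obtain ⟨s, hs, hst, hmax⟩ := exists_floor P hP.zmem (hP.zle t)
    rw [hP.nextPt_floor hst hmax]
    have hins : P.filter (· ≤ t) = insert s (P.filter (· < s)) := by
      ext p
      simp only [Finset.mem_filter, Finset.mem_insert]
      constructor
      · rintro ⟨hp, hpt⟩
        rcases (hmax p hp hpt).eq_or_lt with h | h
        · exact Or.inl h
        · exact Or.inr ⟨hp, h⟩
      · rintro (rfl | ⟨hp, hps⟩)
        · exact ⟨hs, hst⟩
        · exact ⟨hp, hps.le.trans hst⟩
    have hnot : s ∉ P.filter (· < s) := by simp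
    rw [hins, Finset.sum_insert hnot]
    rcases (hP.zle s).eq_or_lt with h | h
    · have hempty : P.filter (· < s) = ∅ := by
        refine Finset.filter_eq_empty_iff.2 fun p _ => not_lt.2 ?_
        rw [← h]
        exact hP.zle p
      rw [hempty, Finset.sum_empty, add_zero, h]
    · have hne : (P.filter (· < s)).Nonempty := ⟨z, Finset.mem_filter.2 ⟨hP.zmem, h⟩⟩
      set r := (P.filter (· < s)).max' hne with hr
      have hr1 := Finset.mem_filter.1 (Finset.max'_mem _ hne)
      rw [← hr] at hr1
      have hfil : P.filter (· < s) = P.filter (· ≤ r) := by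
        ext p
        simp only [Finset.mem_filter]
        constructor
        · rintro ⟨hp, hps⟩
          exact ⟨hp, Finset.le_max' _ _ (Finset.mem_filter.2 ⟨hp, hps⟩)⟩
        · rintro ⟨hp, hpr⟩
          exact ⟨hp, hpr.trans_lt hr1.2⟩
      have hnext : nextPt P r = s := by
        refine le_antisymm (nextPt_le P hs hr1.2) ?_
        obtain ⟨h1, h2⟩ := nextPt_spec P hs hr1.2
        by_contra hcon
        have := Finset.le_max' (P.filter (· < s)) _ (Finset.mem_filter.2 ⟨h1, not_le.1 hcon⟩)
        exact absurd h2 (not_lt.2 this)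
      have hcard : (P.filter (· ≤ r)).card < n := by
        rw [← hn, hins, ← hfil, Finset.card_insert_of_notMem hnot]
        exact Nat.lt_succ_self _
      rw [hfil, ih _ hcard r rfl, hnext]
      ring

theorem IsRefiningPartition.hasEnds (hT : 0 ≤ T) {P : ℕ → Finset (Time T)}
    (hP : IsRefiningPartition P) (n : ℕ) :
    HasEnds (P n) ⟨0, le_rfl, hT⟩ ⟨T, hT, le_rfl⟩ := by
  obtain ⟨s, hs, hs0⟩ := hP.zero_mem n
  obtain ⟨e, he, heT⟩ := hP.end_mem n
  exact ⟨(Subtype.ext hs0 : s = ⟨0, le_rfl, hT⟩) ▸ hs, (Subtype.ext heT : e = ⟨T, hT, le_rfl⟩) ▸ he,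
    fun u => u.2.1, fun u => u.2.2⟩

end Partitions

/-! ### Convergence of weighted sums -/

section WeightedSums

variable {T : ℝ}

/-- Choose `g` close to the supremum of `G`, which need not be attained: the rest of `G` lies in a
short interval, whose mass is small since `t ↦ μ [0,t]` is uniformly continuous. -/
theorem exists_mem_measure_inter_Ioc_le {μ : Measure (Time T)} [IsFiniteMeasure μ]
    [NullSingletonClass μ] (G : Set (Time T)) (hG : G.Nonempty) {ε : ℝ} (hε : 0 < ε) :
    ∃ g ∈ G, μ.real (G ∩ Ioi g) ≤ ε := by
  have hcont : Continuous fun t : Time T => μ.real (Iic t) := by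
    have := continuous_integral_Iic (μ := μ) (integrable_const (1 : ℝ))
    simpa using this
  obtain ⟨η, hη, hunif⟩ := Metric.uniformContinuous_iff.1
    (CompactSpace.uniformContinuous_of_continuous hcont) ε hε
  have hbdd : BddAbove ((fun r : Time T => (r : ℝ)) '' G) := ⟨T, by
    rintro _ ⟨r, _, rfl⟩
    exact r.2.2⟩
  set σ := sSup ((fun r : Time T => (r : ℝ)) '' G) with hσ
  obtain ⟨_, ⟨g, hg, rfl⟩, hgσ⟩ := exists_lt_of_lt_csSup (hG.image _) (sub_lt_self σ hη)
  have hle : ∀ x ∈ G, (x : ℝ) ≤ σ := fun x hx => le_csSup hbdd ⟨x, hx, rfl⟩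
  have hσT : σ ≤ T := csSup_le (hG.image _) (by rintro _ ⟨r, _, rfl⟩; exact r.2.2)
  let y : Time T := ⟨σ, g.2.1.trans (hle g hg), hσT⟩
  have hgy : g ≤ y := hle g hg
  refine ⟨g, hg, ?_⟩
  have hsub : G ∩ Ioi g ⊆ Iic y \ Iic g := fun x hx =>
    ⟨mem_Iic.2 (hle x hx.1), notMem_Iic.2 hx.2⟩
  refine (measureReal_mono hsub).trans ?_
  rw [measureReal_sdiff (Iic_subset_Iic.2 hgy) measurableSet_Iic]
  have hd : dist y g < η := by
    rw [Subtype.dist_eq, Real.dist_eq, abs_of_nonneg (sub_nonneg.2 (show (g : ℝ) ≤ y from hgy))]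
    change σ - (g : ℝ) < η
    linarith
  have := hunif hd
  rw [Real.dist_eq] at this
  exact (le_abs_self _).trans this.le

variable {P : ℕ → Finset (Time T)} {w a : ℕ → Time T → ℝ} {φ : Time T → ℝ}
  {μ : Measure (Time T)} [IsFiniteMeasure μ]

/-- The error `∑_{σ ≤ t} a(σ) w(σ) - ∫_{[0,t]} φ dμ`. -/
noncomputable def sumError (P : ℕ → Finset (Time T)) (w a : ℕ → Time T → ℝ) (φ : Time T → ℝ)
    (μ : Measure (Time T)) (n : ℕ) (t : Time T) : ℝ :=
  ∑ s ∈ P n with s ≤ t, a n s * w n s - ∫ r in Iic t, φ r ∂μ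

theorem sum_filter_sub_sum_filter (Q : Finset (Time T)) (b : Time T → ℝ) {u v : Time T}
    (huv : u ≤ v) : ∑ s ∈ Q with s ≤ v, b s - ∑ s ∈ Q with s ≤ u, b s =
      ∑ s ∈ Q with u < s ∧ s ≤ v, b s := by
  classical
  rw [sub_eq_iff_eq_add', ← Finset.sum_union]
  · refine Finset.sum_congr ?_ fun _ _ => rfl
    ext p
    simp only [Finset.mem_filter, Finset.mem_union]
    constructor
    · rintro ⟨hp, hpv⟩
      rcases le_or_gt p u with h | h
      · exact Or.inl ⟨hp, h⟩
      · exact Or.inr ⟨hp, h, hpv⟩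
    · rintro (⟨hp, h⟩ | ⟨hp, _, h⟩)
      · exact ⟨hp, h.trans huv⟩
      · exact ⟨hp, h⟩
  · refine Finset.disjoint_left.2 fun p hp hp' => ?_
    exact absurd (Finset.mem_filter.1 hp).2 (not_le.2 (Finset.mem_filter.1 hp').2.1)

/-- If `a_n` and `φ` are within `ε` of a constant `c` on `(u,v]`, then sum and integral are each
within `ε` times the mass of `c` times the mass. The masses of the weights converge; `ε'` absorbs
their error. -/
theorem eventually_sumError_le (hw0 : ∀ n s, 0 ≤ w n s)
    (hw : ∀ t, Tendsto (fun n => ∑ s ∈ P n with s ≤ t, w n s) atTop (𝓝 (μ.real (Iic t))))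
    (hφ : Integrable φ μ) {u v : Time T} (huv : u ≤ v) {c ε ε' : ℝ} (hε' : 0 < ε')
    (ha : ∀ᶠ n in atTop, ∀ s ∈ P n, u < s → s ≤ v → |a n s - c| ≤ ε)
    (hc : ∀ r, u < r → r ≤ v → |φ r - c| ≤ ε) :
    ∀ᶠ n in atTop, |sumError P w a φ μ n v - sumError P w a φ μ n u| ≤
      2 * ε * μ.real (Ioc u v) + ε' := by
  set m := μ.real (Ioc u v) with hm
  have hW : Tendsto (fun n => ∑ s ∈ P n with u < s ∧ s ≤ v, w n s) atTop (𝓝 m) := by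
    have h1 := (hw v).sub (hw u)
    simp only [sum_filter_sub_sum_filter _ _ huv] at h1
    rw [← measureReal_sdiff (Iic_subset_Iic.2 huv) measurableSet_Iic, Iic_sdiff_Iic] at h1
    exact h1
  have hbound : Tendsto (fun n => ε * (∑ s ∈ P n with u < s ∧ s ≤ v, w n s) +
      |c| * |(∑ s ∈ P n with u < s ∧ s ≤ v, w n s) - m| + ε * m) atTop (𝓝 (2 * ε * m)) := by
    have h1 := ((hW.const_mul ε).add (((hW.sub_const m).abs).const_mul |c|)).add_const (ε * m)
    convert h1 using 2
    rw [sub_self, abs_zero]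
    ring
  filter_upwards [ha, hbound (gt_mem_nhds (lt_add_of_pos_right _ hε'))] with n hn hlt
  refine le_trans ?_ (le_of_lt hlt)
  have hI : (∫ r in Iic v, φ r ∂μ) - ∫ r in Iic u, φ r ∂μ = ∫ r in Ioc u v, φ r ∂μ :=
    (hasLSDensity_integral_Iic hφ).sub_eq u v huv
  have hIc : |(∫ r in Ioc u v, φ r ∂μ) - c * m| ≤ ε * m := by
    have h1 : (∫ r in Ioc u v, φ r ∂μ) - c * m = ∫ r in Ioc u v, (φ r - c) ∂μ := by
      rw [integral_sub hφ.integrableOn (integrable_const c)]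
      simp [hm, mul_comm]
    rw [h1, ← Real.norm_eq_abs]
    exact norm_setIntegral_le_of_norm_le_const (measure_lt_top _ _) fun r hr =>
      hc r hr.1 hr.2
  have hS : |∑ s ∈ P n with u < s ∧ s ≤ v, a n s * w n s -
      c * ∑ s ∈ P n with u < s ∧ s ≤ v, w n s| ≤ ε * ∑ s ∈ P n with u < s ∧ s ≤ v, w n s := by
    rw [Finset.mul_sum, Finset.mul_sum, ← Finset.sum_sub_distrib]
    refine (Finset.abs_sum_le_sum_abs _ _).trans (Finset.sum_le_sum fun s hs => ?_)
    rw [Finset.mem_filter] at hs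
    rw [← sub_mul, abs_mul, abs_of_nonneg (hw0 n s)]
    exact mul_le_mul_of_nonneg_right (hn s hs.1 hs.2.1 hs.2.2) (hw0 n s)
  have hdec : sumError P w a φ μ n v - sumError P w a φ μ n u =
      (∑ s ∈ P n with u < s ∧ s ≤ v, a n s * w n s -
        c * ∑ s ∈ P n with u < s ∧ s ≤ v, w n s) +
      c * ((∑ s ∈ P n with u < s ∧ s ≤ v, w n s) - m) -
      ((∫ r in Ioc u v, φ r ∂μ) - c * m) := by
    rw [← sum_filter_sub_sum_filter _ _ huv, ← hI, sumError, sumError]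
    ring
  rw [hdec]
  refine (abs_sub _ _).trans (add_le_add ((abs_add_le _ _).trans (add_le_add hS ?_)) hIc)
  rw [abs_mul]

/-- Weighted sums along partitions whose weights converge to an atomless measure `μ` converge to
the integral, provided the summands converge from the left, `a_n(s) → φ(r)` as `s ↑ r`. -/
theorem tendsto_sum_mul_weights (hT : 0 ≤ T) [NullSingletonClass μ] (hw0 : ∀ n s, 0 ≤ w n s)
    (hw : ∀ t, Tendsto (fun n => ∑ s ∈ P n with s ≤ t, w n s) atTop (𝓝 (μ.real (Iic t))))
    {C : ℝ} (haC : ∀ᶠ n in atTop, ∀ s ∈ P n, |a n s| ≤ C) (hφC : ∀ r, |φ r| ≤ C)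
    (hφ : AEStronglyMeasurable φ μ)
    (hloc : ∀ r : Time T, 0 < (r : ℝ) → ∀ ε > (0 : ℝ), ∃ δ > (0 : ℝ), ∃ N : ℕ,
      (∀ n ≥ N, ∀ s ∈ P n, s ≤ r → (r : ℝ) - s < δ → |a n s - φ r| ≤ ε) ∧
      ∀ s, s ≤ r → (r : ℝ) - s < δ → |φ s - φ r| ≤ ε) (t : Time T) :
    Tendsto (fun n => ∑ s ∈ P n with s ≤ t, a n s * w n s) atTop (𝓝 (∫ r in Iic t, φ r ∂μ)) := by
  have hφi : Integrable φ μ := Integrable.of_bound hφ C (ae_of_all _ hφC)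
  have hC0 : 0 ≤ C := (abs_nonneg _).trans (hφC t)
  suffices h : Tendsto (fun n => sumError P w a φ μ n t) atTop (𝓝 0) by
    have := h.add_const (∫ r in Iic t, φ r ∂μ)
    simpa [sumError] using this
  let z : Time T := ⟨0, le_rfl, hT⟩
  have hzle : ∀ u : Time T, z ≤ u := fun u => u.2.1
  have hIicz : Iic z = {z} := by
    ext u
    exact ⟨fun h => le_antisymm h (hzle u), fun h => h.le⟩
  have hzero : Tendsto (fun n => sumError P w a φ μ n z) atTop (𝓝 0) := by
    have hI : ∫ r in Iic z, φ r ∂μ = 0 := by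
      rw [hIicz]
      exact setIntegral_measure_zero _ (measure_singleton z)
    have h1 : Tendsto (fun n => C * ∑ s ∈ P n with s ≤ z, w n s) atTop (𝓝 0) := by
      have := (hw z).const_mul C
      rwa [hIicz, measureReal_def, measure_singleton, ENNReal.toReal_zero, mul_zero] at this
    refine squeeze_zero_norm' ?_ h1
    filter_upwards [haC] with n hn
    rw [sumError, hI, sub_zero, Finset.mul_sum]
    refine (norm_sum_le _ _).trans (Finset.sum_le_sum fun s hs => ?_)
    rw [norm_mul, Real.norm_eq_abs, Real.norm_eq_abs, abs_of_nonneg (hw0 n s)]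
    exact mul_le_mul_of_nonneg_right (hn s (Finset.mem_filter.1 hs).1) (hw0 n s)
  -- It suffices to bound the error by a multiple of an arbitrary `ε`.
  suffices hmain : ∀ ε > (0 : ℝ), ∀ᶠ n in atTop,
      |sumError P w a φ μ n t| ≤ (2 * μ.real univ + 4 * C + 3) * ε by
    refine Metric.tendsto_atTop'.2 ?_
    intro ε hε
    set B := 2 * μ.real univ + 4 * C + 3 with hB
    have hBpos : 0 < B := by positivity
    obtain ⟨N, hN⟩ := eventually_atTop.1 (hmain (ε / (2 * B)) (by positivity))
    refine ⟨N, fun n hn => ?_⟩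
    rw [dist_zero_right, Real.norm_eq_abs]
    refine (hN n hn.le).trans_lt ?_
    rw [mul_div_assoc', div_lt_iff₀ (by positivity)]
    nlinarith
  intro ε hε
  -- An Egorov-type argument: `G N` collects the times at which the approximation from the left
  -- holds with the common thresholds `n ≥ N` and `1 / (N + 1)`. These sets increase to `(0,t]`, so
  -- one of them misses mass less than `ε`. No measurability of `G N` is needed.
  let G : ℕ → Set (Time T) := fun N => {r | (z < r ∧ r ≤ t) ∧
    (∀ n ≥ N, ∀ s ∈ P n, s ≤ r → (r : ℝ) - s < 1 / (N + 1) → |a n s - φ r| ≤ ε) ∧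
    ∀ s, s ≤ r → (r : ℝ) - s < 1 / (N + 1) → |φ s - φ r| ≤ ε}
  have hGmono : Monotone G := by
    intro M N hMN r hr
    have h1 : (1 : ℝ) / (N + 1) ≤ 1 / (M + 1) := by
      have : (M : ℝ) ≤ N := by exact_mod_cast hMN
      exact one_div_le_one_div_of_le (by positivity) (by linarith)
    exact ⟨hr.1, fun n hn s hs hsr hlt => hr.2.1 n (hMN.trans hn) s hs hsr (hlt.trans_le h1),
      fun s hsr hlt => hr.2.2 s hsr (hlt.trans_le h1)⟩
  have hGU : ⋃ N, G N = Ioc z t := by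
    refine Subset.antisymm (iUnion_subset fun N r hr => hr.1) fun r hr => ?_
    obtain ⟨δ, hδ, N, h1, h2⟩ := hloc r hr.1 ε hε
    obtain ⟨M, hM⟩ := exists_nat_one_div_lt hδ
    refine mem_iUnion.2 ⟨max M N, hr, fun n hn s hs hsr hlt =>
      h1 n ((le_max_right _ _).trans hn) s hs hsr (hlt.trans (lt_of_le_of_lt ?_ hM)),
      fun s hsr hlt => h2 s hsr (hlt.trans (lt_of_le_of_lt ?_ hM))⟩
    all_goals
      refine one_div_le_one_div_of_le (by positivity) ?_
      push_cast
      linarith [le_max_left (M : ℝ) N]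
  obtain ⟨N, hN⟩ : ∃ N, μ.real (Ioc z t) - ε < μ.real (G N) := by
    have h1 := tendsto_measure_iUnion_atTop (μ := μ) hGmono
    rw [hGU] at h1
    have h2 := (ENNReal.tendsto_toReal (measure_ne_top μ _)).comp h1
    exact (h2.eventually (lt_mem_nhds (sub_lt_self _ hε))).exists
  -- a grid of mesh less than `1 / (N + 1)`
  obtain ⟨M, hM⟩ := exists_nat_gt (((t : ℝ) + 1) * (N + 1))
  have hMpos : (0 : ℝ) < M := lt_of_le_of_lt (by have := t.2.1; positivity) hM
  let p : ℕ → Time T := fun i => projIcc 0 T hT (min (i * ((t : ℝ) / M)) t)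
  have hp : ∀ i, (p i : ℝ) = min (i * ((t : ℝ) / M)) t := fun i => by
    have h0 : 0 ≤ min (i * ((t : ℝ) / M)) (t : ℝ) :=
      le_min (mul_nonneg (Nat.cast_nonneg i) (div_nonneg t.2.1 hMpos.le)) t.2.1
    change (max 0 (min T _) : ℝ) = _
    rw [min_eq_right ((min_le_right _ _).trans t.2.2), max_eq_right h0]
  have hpmono : ∀ i, p i ≤ p (i + 1) := fun i => by
    have : (p i : ℝ) ≤ p (i + 1) := by
      rw [hp, hp]
      refine min_le_min_right _ (mul_le_mul_of_nonneg_right ?_ (div_nonneg t.2.1 hMpos.le))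
      push_cast; linarith
    exact this
  have hpmesh : ∀ i, (p (i + 1) : ℝ) - p i < 1 / (N + 1) := fun i => by
    have h1 : (t : ℝ) / M < 1 / (N + 1) := by
      rw [div_lt_div_iff₀ hMpos (by positivity)]
      have h2 : (0 : ℝ) < (N : ℝ) + 1 := by positivity
      nlinarith
    rw [hp, hp]
    push_cast
    rcases le_total ((i : ℝ) * ((t : ℝ) / M)) t with h | h
    · rw [min_eq_left h]
      have := min_le_left (((i : ℝ) + 1) * ((t : ℝ) / M)) (t : ℝ)
      linarith
    · rw [min_eq_right h]
      have := min_le_right (((i : ℝ) + 1) * ((t : ℝ) / M)) (t : ℝ)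
      have : (0 : ℝ) < 1 / (N + 1) := by positivity
      linarith
  have hp0 : p 0 = z := Subtype.ext (by rw [hp]; simp [z, t.2.1])
  have hpM : p M = t := Subtype.ext (by rw [hp, mul_div_cancel₀ _ hMpos.ne', min_self])
  -- on each grid interval split at a good point `g`
  have hsplit : ∀ i, ∃ g, p i ≤ g ∧ g ≤ p (i + 1) ∧
      μ.real (G N ∩ Ioc g (p (i + 1))) ≤ ε / M ∧ (p i < g → g ∈ G N) := by
    intro i
    -- Take `g` nearly the last good point of the interval. All of `(p i, g]` then lies in the
    -- window to the left of `g`, while hardly any good points remain after `g`. Without good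
    -- points, `g = p i` declares the whole interval bad.
    by_cases hne : (G N ∩ Ioc (p i) (p (i + 1))).Nonempty
    · obtain ⟨g, hg, hle⟩ := exists_mem_measure_inter_Ioc_le (μ := μ) _ hne (div_pos hε hMpos)
      refine ⟨g, hg.2.1.le, hg.2.2, (measureReal_mono ?_).trans hle, fun _ => hg.1⟩
      rintro r ⟨h1, h2, h3⟩
      exact ⟨⟨h1, hg.2.1.trans h2, h3⟩, h2⟩
    · refine ⟨p i, le_rfl, hpmono i, ?_, fun h => absurd h (lt_irrefl _)⟩
      rw [not_nonempty_iff_eq_empty.1 hne, measureReal_empty]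
      exact (div_pos hε hMpos).le
  choose g hg1 hg2 hg3 hg4 using hsplit
  have hpm : Monotone p := monotone_nat_of_le_succ hpmono
  -- the bad part has small measure
  have hbad : ∑ i ∈ Finset.range M, μ.real (Ioc (g i) (p (i + 1))) ≤ 2 * ε := by
    have hdisj : Set.PairwiseDisjoint (↑(Finset.range M) : Set ℕ)
        (fun i => Ioc (g i) (p (i + 1))) := by
      intro i _ j _ hij
      refine disjoint_left.2 fun r hr hr' => ?_
      rcases lt_or_gt_of_ne hij with h | h
      · exact absurd (hr.2.trans (hpm h)) (not_le.2 ((hg1 j).trans_lt hr'.1))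
      · exact absurd (hr'.2.trans (hpm h)) (not_le.2 ((hg1 i).trans_lt hr.1))
    set R := ⋃ i ∈ Finset.range M, Ioc (g i) (p (i + 1)) with hR
    have hRm : MeasurableSet R := Finset.measurableSet_biUnion _ fun i _ => measurableSet_Ioc
    have hRsum : μ.real R = ∑ i ∈ Finset.range M, μ.real (Ioc (g i) (p (i + 1))) :=
      measureReal_biUnion_finset hdisj fun i _ => measurableSet_Ioc
    have hRsub : R ⊆ Ioc z t := by
      refine iUnion₂_subset fun i hi r hr => ⟨(hzle _).trans_lt hr.1, hr.2.trans ?_⟩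
      rw [← hpM]
      exact hpm (Finset.mem_range.1 hi)
    -- The good part of `R` costs at most `M` times `ε / M`; the remainder of `R` is controlled by
    -- the mass less than `ε` missed by `G N`.
    have h1 : μ.real (G N ∩ R) ≤ ε := by
      have hsub : G N ∩ R ⊆ ⋃ i ∈ Finset.range M, (G N ∩ Ioc (g i) (p (i + 1))) := by
        rw [hR, inter_iUnion₂]
      refine (measureReal_mono hsub (measure_ne_top _ _)).trans
        ((measureReal_biUnion_finset_le _ _).trans ?_)
      refine (Finset.sum_le_card_nsmul _ _ (ε / M) fun i _ => hg3 i).trans ?_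
      rw [Finset.card_range, nsmul_eq_mul, mul_div_cancel₀ _ hMpos.ne']
    have h2 : μ.real (G N) ≤ μ.real (G N ∩ R) + μ.real (Ioc z t \ R) := by
      refine (measureReal_mono (fun r hr => ?_)).trans (measureReal_union_le _ _)
      by_cases h : r ∈ R
      · exact Or.inl ⟨hr, h⟩
      · exact Or.inr ⟨hr.1, h⟩
    rw [measureReal_sdiff hRsub hRm] at h2
    rw [← hRsum]
    linarith
  -- On `(p i, g i]` the reference constant is `φ (g i)` with error `ε`; on `(g i, p (i + 1)]` it is
  -- `0` with the crude error `C`.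
  have hstep : ∀ i ∈ Finset.range M, ∀ᶠ n in atTop,
      |sumError P w a φ μ n (p (i + 1)) - sumError P w a φ μ n (p i)| ≤
        2 * ε * μ.real (Ioc (p i) (p (i + 1))) + 2 * C * μ.real (Ioc (g i) (p (i + 1))) +
          2 * (ε / M) := by
    intro i _
    have hεM : 0 < ε / M := div_pos hε hMpos
    have h1 : ∀ᶠ n in atTop, |sumError P w a φ μ n (g i) - sumError P w a φ μ n (p i)| ≤
        2 * ε * μ.real (Ioc (p i) (g i)) + ε / M := by
      have hclose : ∀ s : Time T, p i < s → (g i : ℝ) - s < 1 / (N + 1) := fun s hs => by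
        have h1 : (p i : ℝ) < s := hs
        have h2 : (g i : ℝ) ≤ p (i + 1) := hg2 i
        linarith [hpmesh i]
      refine eventually_sumError_le hw0 hw hφi (hg1 i) (c := φ (g i)) hεM ?_ ?_
      · filter_upwards [eventually_ge_atTop N] with n hn s hs h1 h2
        exact (hg4 i (h1.trans_le h2)).2.1 n hn s hs h2 (hclose s h1)
      · intro r h1 h2
        exact (hg4 i (h1.trans_le h2)).2.2 r h2 (hclose r h1)
    have h2 : ∀ᶠ n in atTop, |sumError P w a φ μ n (p (i + 1)) - sumError P w a φ μ n (g i)| ≤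
        2 * C * μ.real (Ioc (g i) (p (i + 1))) + ε / M := by
      refine eventually_sumError_le hw0 hw hφi (hg2 i) (c := 0) hεM ?_ ?_
      · filter_upwards [haC] with n hn s hs _ _
        simpa using hn s hs
      · intro r _ _
        simpa using hφC r
    filter_upwards [h1, h2] with n hn1 hn2
    have h3 : μ.real (Ioc (p i) (g i)) ≤ μ.real (Ioc (p i) (p (i + 1))) :=
      measureReal_mono (Ioc_subset_Ioc_right (hg2 i))
    have h4 := abs_add_le (sumError P w a φ μ n (p (i + 1)) - sumError P w a φ μ n (g i))
      (sumError P w a φ μ n (g i) - sumError P w a φ μ n (p i))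
    rw [sub_add_sub_cancel] at h4
    nlinarith
  have hsumI : ∑ i ∈ Finset.range M, μ.real (Ioc (p i) (p (i + 1))) ≤ μ.real univ := by
    have h1 : ∀ i, μ.real (Ioc (p i) (p (i + 1))) = μ.real (Iic (p (i + 1))) - μ.real (Iic (p i)) :=
      fun i => by
        rw [← Iic_sdiff_Iic, measureReal_sdiff (Iic_subset_Iic.2 (hpmono i)) measurableSet_Iic]
    simp only [h1]
    rw [Finset.sum_range_sub fun i => μ.real (Iic (p i))]
    have h2 : μ.real (Iic (p M)) ≤ μ.real univ := measureReal_mono (subset_univ _)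
    have h3 : 0 ≤ μ.real (Iic (p 0)) := measureReal_nonneg
    linarith
  filter_upwards [(Filter.eventually_all_finset _).2 hstep,
    (hzero.abs) (gt_mem_nhds (by rwa [abs_zero] : |(0 : ℝ)| < ε))] with n hn hn0
  have hn0 : |sumError P w a φ μ n z| < ε := hn0
  have htel : sumError P w a φ μ n t = sumError P w a φ μ n z +
      ∑ i ∈ Finset.range M, (sumError P w a φ μ n (p (i + 1)) - sumError P w a φ μ n (p i)) := by
    rw [Finset.sum_range_sub fun i => sumError P w a φ μ n (p i), hp0, hpM]
    ring
  -- The three terms come from the good parts, from the bad parts of total mass at most `2 * ε`, and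
  -- from the slack `ε / M` used twice per interval. With the `ε` from time `0` they add up to `(2 *
  -- μ.real univ + 4 * C + 3) * ε`.
  have hle : |∑ i ∈ Finset.range M,
      (sumError P w a φ μ n (p (i + 1)) - sumError P w a φ μ n (p i))| ≤
      2 * ε * μ.real univ + 2 * C * (2 * ε) + 2 * ε := by
    refine (Finset.abs_sum_le_sum_abs _ _).trans ((Finset.sum_le_sum hn).trans ?_)
    rw [Finset.sum_add_distrib, Finset.sum_add_distrib, ← Finset.mul_sum, ← Finset.mul_sum,
      Finset.sum_const, Finset.card_range, nsmul_eq_mul]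
    have h1 : (M : ℝ) * (2 * (ε / M)) = 2 * ε := by field_simp
    rw [h1]
    gcongr
  rw [htel]
  refine (abs_add_le _ _).trans ?_
  linarith

end WeightedSums


/-! ### Quadratic variation -/

section QuadraticVariation

variable {T : ℝ}

theorem boundedVariationOn_of_abs_sub_le {a p : Time T → ℝ}
    (h : ∀ s t, s ≤ t → |a t - a s| ≤ p t - p s) : BoundedVariationOn a univ := by
  have hp : Monotone p := fun s t hst => sub_nonneg.1 ((abs_nonneg _).trans (h s t hst))
  refine ne_top_of_le_ne_top (Monotone.boundedVariationOn_time hp) (iSup_mono fun u => ?_)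
  refine Finset.sum_le_sum fun i _ => ?_
  rw [edist_dist, edist_dist, Real.dist_eq, Real.dist_eq]
  exact ENNReal.ofReal_le_ofReal ((h _ _ (u.2.2.1 (Nat.le_succ i))).trans (le_abs_self _))

theorem setIntegral_sub_sub {μ : Measure (Time T)} {f g h : Time T → ℝ} (hf : Integrable f μ)
    (hg : Integrable g μ) (hh : Integrable h μ) (B : Set (Time T)) :
    ∫ r in B, (f r - g r - h r) ∂μ =
      ∫ r in B, f r ∂μ - ∫ r in B, g r ∂μ - ∫ r in B, h r ∂μ := by
  have h1 := integral_sub (hf.sub hg).integrableOn (hh.integrableOn (s := B))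
  have h2 := integral_sub hf.integrableOn (hg.integrableOn (s := B))
  simp only [Pi.sub_apply] at h1
  rw [h1, h2]

variable {P : ℕ → Finset (Time T)} {x q : Time T → ℝ}

theorem sqSum_mono (P : Finset (Time T)) (x : Time T → ℝ) : Monotone (sqSum P x) := fun _ _ hst =>
  Finset.sum_le_sum_of_subset_of_nonneg
    (Finset.monotone_filter_right _ fun _ _ h => h.trans hst) fun _ _ _ => sq_nonneg _

theorem sqSum_nonneg (P : Finset (Time T)) (x : Time T → ℝ) (t : Time T) : 0 ≤ sqSum P x t :=
  Finset.sum_nonneg fun _ _ => sq_nonneg _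

theorem HasQV.monotone (h : HasQV P x q) : Monotone q := by
  intro s t hst
  rcases s.2.1.eq_or_lt with hs | hs
  · rw [h.zero s hs.symm]
    rcases t.2.1.eq_or_lt with ht | ht
    · exact (h.zero t ht.symm).ge
    · exact ge_of_tendsto' (h.tendsto t ht) fun n => sqSum_nonneg _ _ _
  · have hst' : (s : ℝ) ≤ t := hst
    exact le_of_tendsto_of_tendsto' (h.tendsto s hs) (h.tendsto t (hs.trans_le hst'))
      fun n => sqSum_mono _ _ hst

theorem Time.exists_pos_lt_of_continuous (hT : 0 < T) (hq : Continuous q) {z : Time T}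
    (hz : (z : ℝ) = 0) {ε : ℝ} (hε : q z < ε) : ∃ t : Time T, 0 < (t : ℝ) ∧ q t < ε := by
  obtain ⟨δ, hδ, hball⟩ := Metric.mem_nhds_iff.1 (hq.continuousAt.eventually (gt_mem_nhds hε))
  have hm : 0 < min (δ / 2) T := lt_min (half_pos hδ) hT
  refine ⟨⟨min (δ / 2) T, hm.le, min_le_right _ _⟩, hm, hball ?_⟩
  rw [Metric.mem_ball, Subtype.dist_eq, Real.dist_eq, hz, sub_zero, abs_of_pos hm]
  exact (min_le_left _ _).trans_lt (half_lt_self hδ)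

/-- Convergence is assumed at positive times only. At time `0` the sum is dominated by those at
small positive times, whose limits are small as `q` is continuous and vanishes at `0`. -/
theorem HasQV.tendsto_sqSum (hT : 0 < T) (h : HasQV P x q) (t : Time T) :
    Tendsto (fun n => sqSum (P n) x t) atTop (𝓝 (q t)) := by
  rcases t.2.1.eq_or_lt with ht | ht
  · have h0 := h.zero t ht.symm
    rw [h0]
    refine tendsto_order.2 ⟨fun a ha => Eventually.of_forall fun n =>
      ha.trans_le (sqSum_nonneg _ _ _), fun a ha => ?_⟩
    obtain ⟨u, hu, hua⟩ := Time.exists_pos_lt_of_continuous hT h.cont ht.symm (h0.trans_lt ha)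
    filter_upwards [(h.tendsto u hu).eventually (gt_mem_nhds hua)] with n hn
    refine (sqSum_mono _ _ ?_).trans_lt hn
    change (t : ℝ) ≤ u
    rw [← ht]
    exact hu.le
  · exact h.tendsto t ht

/-- `a_n(s)` converges to `φ(r)` as `n → ∞` and `s ↑ r`, with the uniform bound `C`. -/
structure LeftApprox (P : ℕ → Finset (Time T)) (a : ℕ → Time T → ℝ) (φ : Time T → ℝ) (C : ℝ) :
    Prop where
  bound : ∀ᶠ n in atTop, ∀ s ∈ P n, |a n s| ≤ C
  bound_limit : ∀ r, |φ r| ≤ C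
  aesm : ∀ μ : Measure (Time T), IsFiniteMeasure μ → NullSingletonClass μ →
    AEStronglyMeasurable φ μ
  limit : ∀ r : Time T, 0 < (r : ℝ) → ∀ ε > (0 : ℝ), ∃ δ > (0 : ℝ), ∃ N : ℕ,
      (∀ n ≥ N, ∀ s ∈ P n, s ≤ r → (r : ℝ) - s < δ → |a n s - φ r| ≤ ε) ∧
      ∀ s, s ≤ r → (r : ℝ) - s < δ → |φ s - φ r| ≤ ε

variable {a : ℕ → Time T → ℝ} {φ : Time T → ℝ} {C : ℝ}

theorem HasQV.tendsto_sum_mul_sq (hT : 0 < T) (h : HasQV P x q) (ha : LeftApprox P a φ C)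
    (t : Time T) :
    Tendsto (fun n => ∑ s ∈ P n with s ≤ t, a n s * (x (nextPt (P n) s) - x s) ^ 2) atTop
      (𝓝 (lsIntegral φ q (Iic t))) := by
  obtain ⟨μ, hμ, hμ', hq⟩ := exists_measure_of_monotone h.cont h.monotone
  have hd := hasLSDensity_one hq
  rw [hd.lsIntegral_eq h.cont (Monotone.boundedVariationOn_time h.monotone) (ha.aesm μ hμ hμ')
    ha.bound_limit measurableSet_Iic]
  simp only [mul_one]
  refine tendsto_sum_mul_weights hT.le (fun n s => sq_nonneg _) (fun u => ?_) ha.bound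
    ha.bound_limit (ha.aesm μ hμ hμ') ha.limit t
  let z : Time T := ⟨0, le_rfl, hT.le⟩
  have hz : z ≤ u := u.2.1
  have h1 : μ.real (Iic u) = q u := by
    have h2 : Iic u = Icc z u := by
      ext r
      exact ⟨fun hr => ⟨r.2.1, hr⟩, fun hr => hr.2⟩
    rw [h2, measureReal_def, measure_congr Ioc_ae_eq_Icc.symm, ← measureReal_def, hq z u hz,
      h.zero z rfl, sub_zero]
  rw [h1]
  exact h.tendsto_sqSum hT u

variable {d : ℕ} {U : Set (Vec d)} {X : CPath T U} {Q : Fin d → Fin d → Time T → ℝ}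

theorem HasQVMatrix.continuous (h : HasQVMatrix P X Q) (i j : Fin d) : Continuous (Q i j) := by
  obtain ⟨qij, qi, qj, h1, h2, h3, h4⟩ := h i j
  rw [show Q i j = fun t => (1 / 2) * (qij t - qi t - qj t) from funext h4]
  exact ((h1.cont.sub h2.cont).sub h3.cont).const_mul _

theorem HasQVMatrix.boundedVariationOn (h : HasQVMatrix P X Q) (i j : Fin d) :
    BoundedVariationOn (Q i j) univ := by
  obtain ⟨qij, qi, qj, h1, h2, h3, h4⟩ := h i j
  refine boundedVariationOn_of_abs_sub_le (p := fun t => qij t + qi t + qj t) fun s t hst => ?_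
  rw [h4, h4]
  have := h1.monotone hst
  have := h2.monotone hst
  have := h3.monotone hst
  exact abs_le.2 ⟨by linarith, by linarith⟩

/-- Polarization of the products of increments. Densities with respect to a common measure make the
Stieltjes integral linear in the integrator. -/
theorem HasQVMatrix.tendsto_sum_mul (hT : 0 < T) (h : HasQVMatrix P X Q)
    (ha : LeftApprox P a φ C) (i j : Fin d) (t : Time T) :
    Tendsto (fun n => ∑ s ∈ P n with s ≤ t, a n s *
      ((X (nextPt (P n) s) i - X s i) * (X (nextPt (P n) s) j - X s j))) atTop
      (𝓝 (lsIntegral φ (Q i j) (Iic t))) := by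
  obtain ⟨qij, qi, qj, h1, h2, h3, h4⟩ := h i j
  have hlim := (((h1.tendsto_sum_mul_sq hT ha t).sub (h2.tendsto_sum_mul_sq hT ha t)).sub
    (h3.tendsto_sum_mul_sq hT ha t)).const_mul (1 / 2)
  have hcont : ∀ k : Fin 3, Continuous (![qij, qi, qj] k) := by
    intro k
    fin_cases k
    exacts [h1.cont, h2.cont, h3.cont]
  have hbv : ∀ k : Fin 3, BoundedVariationOn (![qij, qi, qj] k) univ := by
    intro k
    fin_cases k
    exacts [Monotone.boundedVariationOn_time h1.monotone,
      Monotone.boundedVariationOn_time h2.monotone, Monotone.boundedVariationOn_time h3.monotone]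
  obtain ⟨μ, ρ, hμ, hμ', hρ⟩ := exists_hasLSDensity ![qij, qi, qj] hcont hbv
  have hφ := ha.aesm μ hμ hμ'
  have d1 : HasLSDensity qij μ (ρ 0) := hρ 0
  have d2 : HasLSDensity qi μ (ρ 1) := hρ 1
  have d3 : HasLSDensity qj μ (ρ 2) := hρ 2
  have hQ : HasLSDensity (Q i j) μ fun r => (1 / 2) * (ρ 0 r - ρ 1 r - ρ 2 r) := by
    refine ⟨((d1.integrable.sub d2.integrable).sub d3.integrable).const_mul _, fun s t hst => ?_⟩
    rw [integral_const_mul, setIntegral_sub_sub d1.integrable d2.integrable d3.integrable, ← d1.sub_eq s t hst, ← d2.sub_eq s t hst, ← d3.sub_eq s t hst,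
      h4, h4]
    ring
  have hI : lsIntegral φ (Q i j) (Iic t) = (1 / 2) * (lsIntegral φ qij (Iic t) -
      lsIntegral φ qi (Iic t) - lsIntegral φ qj (Iic t)) := by
    have e1 := d1.lsIntegral_eq (hcont 0) (hbv 0) hφ ha.bound_limit (measurableSet_Iic (a := t))
    have e2 := d2.lsIntegral_eq (hcont 1) (hbv 1) hφ ha.bound_limit (measurableSet_Iic (a := t))
    have e3 := d3.lsIntegral_eq (hcont 2) (hbv 2) hφ ha.bound_limit (measurableSet_Iic (a := t))
    have i1 := integrable_bdd_mul hφ ha.bound_limit d1.integrable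
    have i2 := integrable_bdd_mul hφ ha.bound_limit d2.integrable
    have i3 := integrable_bdd_mul hφ ha.bound_limit d3.integrable
    rw [hQ.lsIntegral_eq (h.continuous i j) (h.boundedVariationOn i j) hφ ha.bound_limit
      measurableSet_Iic, e1, e2, e3, ← setIntegral_sub_sub i1 i2 i3,
      ← integral_const_mul]
    exact integral_congr_ae (ae_of_all _ fun r => by ring)
  rw [hI]
  refine hlim.congr fun n => ?_
  rw [← Finset.sum_sub_distrib, ← Finset.sum_sub_distrib, Finset.mul_sum]
  exact Finset.sum_congr rfl fun s _ => by ring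

end QuadraticVariation


/-! ### Taylor expansion -/

section Taylor

variable {d : ℕ}

theorem Vec.inner_eq (a b : Vec d) : inner ℝ a b = ∑ i, a i * b i := by
  simp [PiLp.inner_apply, mul_comm]

theorem HasGradientAt.hasDerivAt_line {g : Vec d → ℝ} {G x v : Vec d} {s : ℝ}
    (h : HasGradientAt g G (x + s • v)) :
    HasDerivAt (fun s : ℝ => g (x + s • v)) (∑ i, G i * v i) s := by
  have h1 : HasDerivAt (fun s : ℝ => x + s • v) v s := by
    simpa using ((hasDerivAt_id s).smul_const v).const_add x
  have h2 := h.hasFDerivAt.comp_hasDerivAt s h1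
  rwa [InnerProductSpace.toDual_apply_apply, Vec.inner_eq] at h2

theorem add_smul_sub_mem_segment (x y : Vec d) {s : ℝ} (h0 : 0 ≤ s) (h1 : s ≤ 1) :
    x + s • (y - x) ∈ segment ℝ x y := by
  rw [segment_eq_image']
  exact ⟨s, ⟨h0, h1⟩, rfl⟩

/-- The mean value theorem. -/
theorem exists_segment_mean_value {U : Set (Vec d)} {g : Vec d → ℝ} {G : Vec d → Vec d}
    (hg : ∀ z ∈ U, HasGradientAt g (G z) z) {x y : Vec d} (hxy : segment ℝ x y ⊆ U) :
    ∃ z ∈ segment ℝ x y, g y - g x = ∑ i, G z i * (y - x) i := by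
  have hd : ∀ s : ℝ, 0 ≤ s → s ≤ 1 → HasDerivAt (fun s : ℝ => g (x + s • (y - x)))
      (∑ i, G (x + s • (y - x)) i * (y - x) i) s := fun s h0 h1 =>
    HasGradientAt.hasDerivAt_line (hg _ (hxy (add_smul_sub_mem_segment x y h0 h1)))
  obtain ⟨c, hc, h⟩ := exists_hasDerivAt_eq_slope (fun s : ℝ => g (x + s • (y - x)))
    (fun s => ∑ i, G (x + s • (y - x)) i * (y - x) i) zero_lt_one
    (fun s hs => (hd s hs.1 hs.2).continuousAt.continuousWithinAt)
    (fun s hs => hd s hs.1.le hs.2.le)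
  refine ⟨x + c • (y - x), add_smul_sub_mem_segment x y hc.1.le hc.2.le, ?_⟩
  rw [h]
  simp

/-- Taylor's formula of second order. -/
theorem exists_segment_taylor {U : Set (Vec d)} {g : Vec d → ℝ} {G : Vec d → Vec d}
    {H : Fin d → Vec d → Vec d} (hg : ∀ z ∈ U, HasGradientAt g (G z) z)
    (hG : ∀ j, ∀ z ∈ U, HasGradientAt (fun w => G w j) (H j z) z) {x y : Vec d}
    (hxy : segment ℝ x y ⊆ U) :
    ∃ z ∈ segment ℝ x y, g y - g x = ∑ i, G x i * (y - x) i +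
      (1 / 2) * ∑ i, ∑ j, H j z i * ((y - x) i * (y - x) j) := by
  set v := y - x with hv
  have hmem : ∀ s : ℝ, 0 ≤ s → s ≤ 1 → x + s • v ∈ U := fun s h0 h1 =>
    hxy (add_smul_sub_mem_segment x y h0 h1)
  let h1 : ℝ → ℝ := fun s => ∑ i, G (x + s • v) i * v i
  let h2 : ℝ → ℝ := fun s => ∑ j, (∑ i, H j (x + s • v) i * v i) * v j
  have hd : ∀ s : ℝ, 0 ≤ s → s ≤ 1 → HasDerivAt (fun s : ℝ => g (x + s • v)) (h1 s) s :=
    fun s h0 h1 => HasGradientAt.hasDerivAt_line (hg _ (hmem s h0 h1))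
  have hd1 : ∀ s : ℝ, 0 ≤ s → s ≤ 1 → HasDerivAt h1 (h2 s) s := fun s h0 h1 => by
    refine HasDerivAt.fun_sum fun j _ => ?_
    exact (HasGradientAt.hasDerivAt_line (hG j _ (hmem s h0 h1))).mul_const (v j)
  -- Cauchy's mean value theorem for this function against `(1 - s) ^ 2` gives the Lagrange
  -- remainder. It needs only existence of the second derivatives, neither their continuity nor
  -- symmetry.
  have hk : ∀ s : ℝ, 0 ≤ s → s ≤ 1 → HasDerivAt (fun s : ℝ => g (x + s • v) + h1 s * (1 - s))
      (h2 s * (1 - s)) s := fun s h0 h1' => by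
    have := (hd s h0 h1').add ((hd1 s h0 h1').mul ((hasDerivAt_id s).const_sub 1))
    refine this.congr_deriv ?_
    simp
  have hl : ∀ s : ℝ, HasDerivAt (fun s : ℝ => (1 - s) ^ 2) (-2 * (1 - s)) s := fun s => by
    have := ((hasDerivAt_id s).const_sub 1).pow 2
    refine this.congr_deriv ?_
    simp
  obtain ⟨c, hc, h⟩ := exists_ratio_hasDerivAt_eq_ratio_slope
    (fun s : ℝ => g (x + s • v) + h1 s * (1 - s)) (fun s => h2 s * (1 - s)) zero_lt_one
    (fun s hs => (hk s hs.1 hs.2).continuousAt.continuousWithinAt)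
    (fun s hs => hk s hs.1.le hs.2.le) (fun s : ℝ => (1 - s) ^ 2) (fun s => -2 * (1 - s))
    (fun s _ => (hl s).continuousAt.continuousWithinAt) (fun s _ => hl s)
  refine ⟨x + c • v, add_smul_sub_mem_segment x y hc.1.le hc.2.le, ?_⟩
  have hc1 : (1 : ℝ) - c ≠ 0 := (sub_pos.2 hc.2).ne'
  have e1 : x + (1 : ℝ) • v = y := by rw [hv]; simp
  have e0 : x + (0 : ℝ) • v = x := by simp
  have e2 : h2 c = ∑ i, ∑ j, H j (x + c • v) i * (v i * v j) := by
    simp only [h2, Finset.sum_mul]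
    rw [Finset.sum_comm]
    simp only [mul_assoc]
  have e3 : h1 0 = ∑ i, G x i * v i := by simp only [h1, e0]
  rw [← e2, ← e3]
  simp only [e1, e0] at h
  have h' : (1 - c) * (h2 c - 2 * (g y - g x - h1 0)) = 0 := by linear_combination -h
  rcases mul_eq_zero.1 h' with h'' | h''
  · exact absurd h'' hc1
  · linear_combination (-1 / 2) * h''

end Taylor

/-! ### The pathwise Itô formula -/

section ItoFormula

variable {T : ℝ} {d : ℕ} {U : Set (Vec d)}

theorem CPath.approx_of_lt (X : CPath T U) (P : Finset (Time T)) {s u : Time T} (h : u < s) :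
    X.approx P s u = X (nextPt P u) := if_pos h

theorem CPath.approx_of_ge (X : CPath T U) (P : Finset (Time T)) {s u : Time T} (h : s ≤ u) :
    X.approx P s u = X s := if_neg (not_lt.2 h)

theorem CPath.approx_jump (X : CPath T U) (P : Finset (Time T)) (s : Time T) :
    (X.approx P s).jump s (X s) = X.approx P s := by
  ext1; funext u
  rcases lt_or_ge u s with h | h
  · rw [Cadlag.jump_of_lt _ _ h]
  · rw [Cadlag.jump_of_le _ (X.mem s) h, X.approx_of_ge P h]

/-- On `[s,s')` the path `X^n` has the value `X(s')`, which is also the frozen value from `s'` on.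
Moving to the next partition point thus only changes the constant value from `s` on, and increments
of functionals become increments in one vector. -/
theorem CPath.approx_nextPt (X : CPath T U) (P : Finset (Time T)) (s : Time T) :
    X.approx P (nextPt P s) = (X.approx P s).jump s (X (nextPt P s)) := by
  ext1; funext u
  rcases lt_or_ge u s with h | h
  · rw [Cadlag.jump_of_lt _ _ h, X.approx_of_lt P h, X.approx_of_lt P (h.trans_le (le_nextPt P s))]
  · rw [Cadlag.jump_of_le _ (X.mem _) h]
    rcases lt_or_ge u (nextPt P s) with h' | h'
    · rw [X.approx_of_lt P h', nextPt_eq_of_lt P h h']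
    · rw [X.approx_of_ge P h']

/-- The path `X^{n,s'-}` is constant from `s` on, so flatness moves the time from `s'` back to `s`.
-/
theorem IsFlat.approx_nextPt {f : PathFun T U} (hf : IsFlat f) (X : CPath T U)
    (P : Finset (Time T)) (s : Time T) :
    f (nextPt P s) (X.approx P (nextPt P s)) = f s (X.approx P (nextPt P s)) := by
  have h : (X.approx P (nextPt P s)).stopped s = X.approx P (nextPt P s) := by
    rw [X.approx_nextPt, Cadlag.jump_stopped _ _ (X.mem _)]
  have := hf.flat s (nextPt P s) (le_nextPt P s) (X.approx P (nextPt P s))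
  rwa [h] at this

theorem CPath.approx_close (X : CPath T U) {η : ℝ} (hη : 0 < η) :
    ∃ δ > (0 : ℝ), ∀ (P : Finset (Time T)) (a e : Time T), HasEnds P a e →
      (∀ s ∈ P, (nextPt P s : ℝ) - s < δ) → ∀ s r : Time T, s ≤ r → (r : ℝ) - s < δ →
      ∀ z ∈ segment ℝ (X s) (X (nextPt P s)), dist (X s) z < η ∧
      (z ∈ U → ∀ u, dist (X.toCadlag.stopped r u) ((X.approx P s).jump s z u) ≤ η) := by
  obtain ⟨δ, hδ, hX⟩ := Metric.uniformContinuous_iff.1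
    (CompactSpace.uniformContinuous_of_continuous X.cont) η hη
  -- Both `s` and its successor are within `δ` of any time `p ∈ [s,r]`, so both values lie in the
  -- ball about `X p`, and by convexity so does each intermediate point `z`.
  refine ⟨δ / 2, half_pos hδ, fun P a e hP hmesh s r hsr hrs z hz => ?_⟩
  have hball : ∀ p : Time T, s ≤ p → (p : ℝ) - s < δ / 2 → dist z (X p) < η := by
    intro p hsp hps
    have h1 : X s ∈ Metric.ball (X p) η := hX <| by
      rw [Subtype.dist_eq, Real.dist_eq, abs_sub_comm, abs_of_nonneg
        (sub_nonneg.2 (show (s : ℝ) ≤ p from hsp))]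
      linarith
    have h2 : X (nextPt P s) ∈ Metric.ball (X p) η := hX <| by
      have h3 : (s : ℝ) ≤ nextPt P s := le_nextPt P s
      have h4 := hP.nextPt_sub_lt hmesh s
      have h5 : (s : ℝ) ≤ p := hsp
      rw [Subtype.dist_eq, Real.dist_eq, abs_lt]
      constructor <;> linarith
    exact (convex_ball (X p) η).segment_subset h1 h2 hz
  refine ⟨?_, fun hzU u => ?_⟩
  · rw [dist_comm]
    exact hball s le_rfl (by simpa using half_pos hδ)
  · change dist (X (min r u)) _ ≤ η
    rcases lt_or_ge u s with h | h
    · rw [Cadlag.jump_of_lt _ _ h, X.approx_of_lt P h, min_eq_right (h.le.trans hsr)]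
      refine (hX ?_).le
      have h3 : (u : ℝ) ≤ nextPt P u := le_nextPt P u
      rw [Subtype.dist_eq, Real.dist_eq, abs_sub_comm, abs_of_nonneg (sub_nonneg.2 h3)]
      linarith [hP.nextPt_sub_lt hmesh u]
    · rw [Cadlag.jump_of_le _ hzU h, dist_comm]
      refine (hball _ (le_min hsr h) ?_).le
      have : ((min r u : Time T) : ℝ) ≤ r := min_le_left r u
      linarith

/-- For fine partitions the segments between successive values stay in `U`, so Taylor's formula is
applicable, and all intermediate paths share one compact set, so the coefficients are bounded. -/
theorem CPath.exists_compact_approx (hU : IsOpen U) (X : CPath T U) :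
    ∃ K : Set (Vec d), IsCompact K ∧ K ⊆ U ∧ (∀ u, X u ∈ K) ∧
      ∃ δ > (0 : ℝ), ∀ (P : Finset (Time T)) (a e : Time T), HasEnds P a e →
      (∀ s ∈ P, (nextPt P s : ℝ) - s < δ) → ∀ s : Time T,
      segment ℝ (X s) (X (nextPt P s)) ⊆ U ∧
      ∀ z ∈ segment ℝ (X s) (X (nextPt P s)), ∀ u, (X.approx P s).jump s z u ∈ K := by
  obtain ⟨K, hK, hKU, hXK⟩ := X.toCadlag.exists_compact hU
  obtain ⟨η, hη, hsub⟩ := hK.exists_cthickening_subset_open hU hKU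
  obtain ⟨δ, hδ, h⟩ := X.approx_close hη
  refine ⟨Metric.cthickening η K, hK.cthickening, hsub,
    fun u => Metric.self_subset_cthickening K (hXK u), δ, hδ, fun P a e hP hmesh s => ?_⟩
  have h' := h P a e hP hmesh s s le_rfl (by simpa using hδ)
  have hseg : segment ℝ (X s) (X (nextPt P s)) ⊆ U := fun z hz => hsub <| by
    refine Metric.mem_cthickening_of_dist_le z (X s) η K (hXK s) ?_
    rw [dist_comm]
    exact (h' z hz).1.le
  refine ⟨hseg, fun z hz u => ?_⟩
  refine Metric.mem_cthickening_of_dist_le _ _ η K (hXK (min s u)) ?_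
  rw [dist_comm]
  exact (h' z hz).2 (hseg hz) u

variable {P : ℕ → Finset (Time T)}

/-- The approximating path with the Taylor point `z n s` as final value tends to `X^r` uniformly as
`s ↑ r` and `n → ∞`. Left-continuity along arbitrary nearby paths is just what the weighted sums
need. -/
theorem LeftCont.leftApprox (hT : 0 ≤ T) (hU : IsOpen U) {f : PathFun T U} (hf : LeftCont f)
    (hb : BddPres f) (hP : IsRefiningPartition P) (X : CPath T U) {z : ℕ → Time T → Vec d}
    (hz : ∀ n s, z n s ∈ segment ℝ (X s) (X (nextPt (P n) s))) (hzU : ∀ n s, z n s ∈ U) :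
    ∃ C, LeftApprox P (fun n s => f s ((X.approx (P n) s).jump s (z n s)))
      (fun r => f r X.toCadlag) C := by
  obtain ⟨K, hK, hKU, hXK, δ, hδ, happ⟩ := X.exists_compact_approx hU
  obtain ⟨C, hC⟩ := hb K hK hKU
  refine ⟨C, ?_, fun r => hC r _ hXK, fun μ _ _ => hf.aestronglyMeasurable hT _ μ, ?_⟩
  · filter_upwards [hP.mesh δ hδ] with n hn s _
    exact hC s _ ((happ _ _ _ (hP.hasEnds hT n) hn s).2 _ (hz n s))
  · intro r hr ε hε
    obtain ⟨η, hη, hη'⟩ := (nhdsLeft_hasBasis r X.toCadlag).eventually_iff.1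
      ((hf r hr X.toCadlag).eventually (Metric.closedBall_mem_nhds _ hε))
    obtain ⟨δ₁, hδ₁, hclose⟩ := X.approx_close (half_pos hη)
    obtain ⟨N, hN⟩ := eventually_atTop.1 (hP.mesh δ₁ hδ₁)
    obtain ⟨δ₂, hδ₂, h2⟩ := (nhdsLE_hasBasis r).eventually_iff.1
      (((hf r hr X.toCadlag).comp (tendsto_nhdsLeft_of_continuousAt X.toCadlag
        X.cont.continuousAt)).eventually (Metric.closedBall_mem_nhds _ hε))
    refine ⟨min (min δ₁ δ₂) η, lt_min (lt_min hδ₁ hδ₂) hη, N, fun n hn s _ hsr hlt => ?_,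
      fun s hsr hlt => ?_⟩
    · have h1 := (hclose (P n) _ _ (hP.hasEnds hT n) (hN n hn) s r hsr
        (hlt.trans_le ((min_le_left _ _).trans (min_le_left _ _))) _ (hz n s)).2 (hzU n s)
      refine hη' (x := (s, (X.approx (P n) s).jump s (z n s)))
        ⟨hsr, hlt.trans_le (min_le_right _ _), ?_⟩
      rw [Cadlag.jump_stopped _ _ (hzU n s)]
      exact supDist_lt_of_dist_le h1 (half_lt_self hη) hη
    · exact h2 ⟨hsr, hlt.trans_le ((min_le_left _ _).trans (min_le_right _ _))⟩

/-- The pathwise functional Itô formula for functionals without horizontal derivative. -/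
theorem IsFlat.hasItoIntegral (hT : 0 < T) (hU : IsOpen U) (hP : IsRefiningPartition P)
    {f : PathFun T U} (hf : IsFlat f) {X : CPath T U} {Q : Fin d → Fin d → Time T → ℝ}
    (hQ : HasQVMatrix P X Q) (t : Time T) :
    HasItoIntegral P (pgrad f) X t (f t X.toCadlag - f ⟨0, le_rfl, hT.le⟩ X.toCadlag -
      (1 / 2) * ∑ i, ∑ j, lsIntegral (fun r => ppartial i (ppartial j f) r X.toCadlag) (Q i j)
        (Iic t)) := by
  set o : Time T := ⟨0, le_rfl, hT.le⟩ with ho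
  obtain ⟨K, hK, hKU, hXK, δ, hδ, happ⟩ := X.exists_compact_approx hU
  have hz : ∀ n s, ∃ z ∈ segment ℝ (X s) (X (nextPt (P n) s)), z ∈ U ∧
      (segment ℝ (X s) (X (nextPt (P n) s)) ⊆ U →
        f s ((X.approx (P n) s).jump s (X (nextPt (P n) s))) - f s (X.approx (P n) s) =
        inner ℝ (pgrad f s (X.approx (P n) s)) (X (nextPt (P n) s) - X s) +
        (1 / 2) * ∑ i, ∑ j, ppartial i (ppartial j f) s ((X.approx (P n) s).jump s z) *
          ((X (nextPt (P n) s) i - X s i) * (X (nextPt (P n) s) j - X s j))) := by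
    intro n s
    by_cases hseg : segment ℝ (X s) (X (nextPt (P n) s)) ⊆ U
    · obtain ⟨z, hz, h⟩ := exists_segment_taylor
        (g := fun y => f s ((X.approx (P n) s).jump s y))
        (G := fun y => pgrad f s ((X.approx (P n) s).jump s y))
        (H := fun j y => pgrad (ppartial j f) s ((X.approx (P n) s).jump s y))
        (fun z hz => hf.vdiff.hasGradientAt_jump hU s _ hz)
        (fun j z hz => (hf.vdiff_two j).hasGradientAt_jump hU s _ hz) hseg
      refine ⟨z, hz, hseg hz, fun _ => ?_⟩
      simp only [X.approx_jump] at h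
      rw [h, Vec.inner_eq]
      rfl
    · exact ⟨X s, left_mem_segment _ _ _, X.mem s, fun h => absurd h hseg⟩
  choose z hz hzU htay using hz
  have hlim : Tendsto (fun n => ∑ i, ∑ j, ∑ s ∈ P n with s ≤ t,
      ppartial i (ppartial j f) s ((X.approx (P n) s).jump s (z n s)) *
      ((X (nextPt (P n) s) i - X s i) * (X (nextPt (P n) s) j - X s j))) atTop
      (𝓝 (∑ i, ∑ j, lsIntegral (fun r => ppartial i (ppartial j f) r X.toCadlag) (Q i j)
        (Iic t))) := by
    refine tendsto_finsetSum _ fun i _ => tendsto_finsetSum _ fun j _ => ?_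
    obtain ⟨C, hC⟩ := (hf.hess_leftCont i j).leftApprox hT.le hU (hf.hess_bddPres i j) hP X hz hzU
    exact hQ.tendsto_sum_mul hT hC i j t
  -- The telescoped sum ends with the path at the successor of `t`, which is constant from `t` on
  -- and uniformly close to `X^t`. Uniform continuity, unlike left-continuity, also covers `t = 0`.
  have hend : Tendsto (fun n => f t (X.approx (P n) (nextPt (P n) t))) atTop
      (𝓝 (f t X.toCadlag)) := by
    refine Metric.tendsto_atTop'.2 fun ε hε => ?_
    obtain ⟨η, hη, h⟩ := (nhdsSup_hasBasis _).eventually_iff.1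
      (hf.unifCont (X.toCadlag.stopped t) ε hε)
    obtain ⟨δ₁, hδ₁, hclose⟩ := X.approx_close (half_pos hη)
    obtain ⟨N, hN⟩ := eventually_atTop.1 (hP.mesh δ₁ hδ₁)
    refine ⟨N, fun n hn => ?_⟩
    have h1 := (hclose (P n) _ _ (hP.hasEnds hT.le n) (hN n hn.le) t t le_rfl (by simpa using hδ₁)
      (X (nextPt (P n) t)) (right_mem_segment _ _ _)).2 (X.mem _)
    rw [← X.approx_nextPt] at h1
    have h2 := h (supDist_lt_of_dist_le h1 (half_lt_self hη) hη) t
    rwa [← hf.adapted, abs_sub_comm] at h2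
  have hstart : ∀ n, f o (X.approx (P n) o) = f o X.toCadlag := fun n => by
    refine hf.adapted.congr fun u hu => ?_
    have : u = o := le_antisymm hu u.2.1
    rw [this, X.approx_of_ge _ le_rfl]
    rfl
  refine ((hend.sub_const (f o X.toCadlag)).sub (hlim.const_mul (1 / 2))).congr' ?_
  filter_upwards [hP.mesh δ hδ] with n hn
  have htel := (hP.hasEnds hT.le n).sum_telescope (fun s => f s (X.approx (P n) s)) t
  simp only [hf.approx_nextPt] at htel
  rw [← ho, hstart n] at htel
  rw [← htel, itoSum, sub_eq_iff_eq_add]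
  have hsum : ∀ s ∈ P n, f s (X.approx (P n) (nextPt (P n) s)) - f s (X.approx (P n) s) =
      inner ℝ (pgrad f s (X.approx (P n) s)) (X (nextPt (P n) s) - X s) +
      (1 / 2) * ∑ i, ∑ j, ppartial i (ppartial j f) s ((X.approx (P n) s).jump s (z n s)) *
        ((X (nextPt (P n) s) i - X s i) * (X (nextPt (P n) s) j - X s j)) := fun s _ => by
    rw [X.approx_nextPt]
    exact htay n s (happ _ _ _ (hP.hasEnds hT.le n) hn s).1
  rw [Finset.sum_congr rfl fun s hs => hsum s (Finset.mem_filter.1 hs).1, Finset.sum_add_distrib,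
    ← Finset.mul_sum]
  congr 2
  rw [Finset.sum_comm]
  refine Finset.sum_congr rfl fun i _ => ?_
  rw [Finset.sum_comm]

end ItoFormula


/-! ### The chain rule along paths of bounded variation -/

section ChainRule

variable {T : ℝ} {ν : ℕ}

/-- The path that follows `Ψ` up to `τ 0` and has the value `Ψ (τ (k + 1))` on
`[τ k, τ (k + 1))`, stopped at `τ k`. -/
noncomputable def stepPath {U : Set (Vec ν)} (Ψ : Cadlag T U) (τ : ℕ → Time T) : ℕ → Cadlag T U
  | 0 => Ψ.stopped (τ 0)
  | k + 1 => (stepPath Ψ τ k).jump (τ k) (Ψ (τ (k + 1)))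

theorem stepPath_of_ge {U : Set (Vec ν)} (Ψ : Cadlag T U) {τ : ℕ → Time T} (hτ : Monotone τ)
    (k : ℕ) {u : Time T} (hu : τ k ≤ u) : stepPath Ψ τ k u = Ψ (τ k) := by
  cases k with
  | zero => exact Ψ.stopped_of_le hu
  | succ k => exact Cadlag.jump_of_le _ (Ψ.mem _) ((hτ k.le_succ).trans hu)

theorem stepPath_jump {U : Set (Vec ν)} (Ψ : Cadlag T U) {τ : ℕ → Time T} (hτ : Monotone τ)
    (k : ℕ) : (stepPath Ψ τ k).jump (τ k) (Ψ (τ k)) = stepPath Ψ τ k := by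
  ext1; funext u
  rcases lt_or_ge u (τ k) with h | h
  · rw [Cadlag.jump_of_lt _ _ h]
  · rw [Cadlag.jump_of_le _ (Ψ.mem _) h, stepPath_of_ge Ψ hτ k h]

/-- The step path runs ahead of `Ψ` by at most one grid interval, so it errs by at most the
oscillation `η`. -/
theorem dist_stepPath_le {U : Set (Vec ν)} (Ψ : Cadlag T U) {τ : ℕ → Time T} (hτ : Monotone τ)
    {η : ℝ} (hη : 0 ≤ η) (hosc : ∀ k u v, u ∈ Icc (τ k) (τ (k + 1)) → v ∈ Icc (τ k) (τ (k + 1)) →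
      dist (Ψ u) (Ψ v) ≤ η) (k : ℕ) (u : Time T) :
    dist (Ψ.stopped (τ k) u) (stepPath Ψ τ k u) ≤ η := by
  induction k generalizing u with
  | zero => simpa [stepPath] using hη
  | succ k ih =>
    have hk := hτ k.le_succ
    rcases lt_or_ge u (τ k) with h | h
    · rw [stepPath, Cadlag.jump_of_lt _ _ h, Cadlag.stopped_of_ge _ (h.le.trans hk)]
      simpa [Cadlag.stopped_of_ge _ h.le] using ih u
    · rw [stepPath, Cadlag.jump_of_le _ (Ψ.mem _) h]
      exact hosc k _ _ ⟨le_min hk h, min_le_left _ _⟩ ⟨hk, le_rfl⟩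

theorem dist_stepPath_jump_le {U : Set (Vec ν)} (Ψ : Cadlag T U) {τ : ℕ → Time T}
    (hτ : Monotone τ) {η : ℝ} (hη : 0 ≤ η)
    (hosc : ∀ k u v, u ∈ Icc (τ k) (τ (k + 1)) → v ∈ Icc (τ k) (τ (k + 1)) →
      dist (Ψ u) (Ψ v) ≤ η) (k : ℕ) {r : Time T} (hr : r ∈ Icc (τ k) (τ (k + 1))) {z : Vec ν}
    (hz : z ∈ segment ℝ (Ψ (τ k)) (Ψ (τ (k + 1)))) (hzU : z ∈ U) (u : Time T) :
    dist (Ψ.stopped r u) ((stepPath Ψ τ k).jump (τ k) z u) ≤ η := by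
  have hk := hτ k.le_succ
  rcases lt_or_ge u (τ k) with h | h
  · rw [Cadlag.jump_of_lt _ _ h, Cadlag.stopped_of_ge _ (h.le.trans hr.1)]
    simpa [Cadlag.stopped_of_ge _ h.le] using dist_stepPath_le Ψ hτ hη hosc k u
  · rw [Cadlag.jump_of_le _ hzU h, Cadlag.stopped_apply, dist_comm]
    have hm : min r u ∈ Icc (τ k) (τ (k + 1)) := ⟨le_min hr.1 h, (min_le_left _ _).trans hr.2⟩
    exact (convex_closedBall (Ψ (min r u)) η).segment_subset
      (hosc k _ _ ⟨le_rfl, hk⟩ hm) (hosc k _ _ ⟨hk, le_rfl⟩ hm) hz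

theorem exists_mem_Ioc_of_monotone {τ : ℕ → Time T} {N : ℕ} {r : Time T}
    (hr : r ∈ Ioc (τ 0) (τ N)) : ∃ k < N, r ∈ Ioc (τ k) (τ (k + 1)) := by
  classical
  have hex : ∃ k, r ≤ τ k := ⟨N, hr.2⟩
  have h0 : Nat.find hex ≠ 0 := fun h => by
    have := Nat.find_spec hex
    rw [h] at this
    exact absurd hr.1 (not_lt.2 this)
  obtain ⟨k, hk⟩ := Nat.exists_eq_succ_of_ne_zero h0
  have h1 : r ≤ τ (k + 1) := by
    have := Nat.find_spec hex
    rwa [hk] at this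
  have h2 : ¬ r ≤ τ k := Nat.find_min hex (by omega)
  have h3 : Nat.find hex ≤ N := Nat.find_min' hex hr.2
  exact ⟨k, by omega, not_le.1 h2, h1⟩

theorem sum_indicator_Ioc_eq {τ : ℕ → Time T} (hτ : Monotone τ) {N k : ℕ} (hk : k < N)
    {r : Time T} (hr : r ∈ Ioc (τ k) (τ (k + 1))) (c : ℕ → ℝ) :
    ∑ j ∈ Finset.range N, (Ioc (τ j) (τ (j + 1))).indicator (fun _ => c j) r = c k := by
  rw [Finset.sum_eq_single k]
  · rw [indicator_of_mem hr]
  · intro j _ hjk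
    refine indicator_of_notMem (fun hj => ?_) _
    rcases lt_or_gt_of_ne hjk with h | h
    · exact absurd (hj.2.trans (hτ h)) (not_le.2 hr.1)
    · exact absurd (hr.2.trans (hτ h)) (not_le.2 hj.1)
  · exact fun h => absurd (Finset.mem_range.2 hk) h

/-- The uniform grid on `[s,t]` with `n + 1` intervals. -/
theorem exists_grid {s t : Time T} (hst : s ≤ t) (n : ℕ) : ∃ τ : ℕ → Time T, Monotone τ ∧
    τ 0 = s ∧ τ (n + 1) = t ∧ ∀ k, (τ (k + 1) : ℝ) - τ k ≤ ((t : ℝ) - s) / (n + 1) := by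
  have hst' : (s : ℝ) ≤ t := hst
  have hn : (0 : ℝ) < n + 1 := by positivity
  set c := ((t : ℝ) - s) / (n + 1) with hc
  have hc0 : 0 ≤ c := div_nonneg (sub_nonneg.2 hst') hn.le
  refine ⟨fun k => ⟨min (s + (k : ℝ) * c) t, le_min (by have := s.2.1; positivity) t.2.1,
    (min_le_right _ _).trans t.2.2⟩, ?_, ?_, ?_, ?_⟩
  · intro j k hjk
    change min ((s : ℝ) + j * c) (t : ℝ) ≤ min ((s : ℝ) + k * c) (t : ℝ)
    have : (j : ℝ) ≤ k := by exact_mod_cast hjk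
    gcongr
  · exact Subtype.ext (by simp [hst'])
  · refine Subtype.ext ?_
    change min ((s : ℝ) + ((n + 1 : ℕ) : ℝ) * c) (t : ℝ) = t
    have : ((n + 1 : ℕ) : ℝ) * c = t - s := by
      rw [hc]; push_cast; field_simp
    rw [this]; simp
  · intro k
    change min ((s : ℝ) + ((k + 1 : ℕ) : ℝ) * c) (t : ℝ) - min ((s : ℝ) + k * c) (t : ℝ) ≤ c
    push_cast
    rcases le_total ((s : ℝ) + k * c) t with h | h
    · rw [min_eq_left h]
      have := min_le_left ((s : ℝ) + (k + 1) * c) (t : ℝ)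
      linarith
    · rw [min_eq_right h]
      have := min_le_right ((s : ℝ) + (k + 1) * c) (t : ℝ)
      linarith

/-- As in Itô's formula, the step path at `k + 1` is constant from `τ k` on, and flatness reduces
the increment to one in a single vector; here the first-order mean value theorem suffices. -/
theorem IsFlat.stepPath_sub {h : PathFun T (univ : Set (Vec ν))} (hh : IsFlat h)
    (Ψ : Cadlag T (univ : Set (Vec ν))) {τ : ℕ → Time T} (hτ : Monotone τ) (k : ℕ) :
    ∃ z ∈ segment ℝ (Ψ (τ k)) (Ψ (τ (k + 1))),
      h (τ (k + 1)) (stepPath Ψ τ (k + 1)) - h (τ k) (stepPath Ψ τ k) =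
      ∑ l, ppartial l h (τ k) ((stepPath Ψ τ k).jump (τ k) z) *
        (Ψ (τ (k + 1)) l - Ψ (τ k) l) := by
  obtain ⟨z, hz, hmv⟩ := exists_segment_mean_value (U := univ)
    (g := fun y => h (τ k) ((stepPath Ψ τ k).jump (τ k) y))
    (G := fun y => pgrad h (τ k) ((stepPath Ψ τ k).jump (τ k) y))
    (fun z hz => hh.vdiff.hasGradientAt_jump isOpen_univ (τ k) _ hz)
    (subset_univ (segment ℝ (Ψ (τ k)) (Ψ (τ (k + 1)))))
  refine ⟨z, hz, ?_⟩
  have h1 := hh.flat (τ k) (τ (k + 1)) (hτ k.le_succ) (stepPath Ψ τ (k + 1))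
  have h2 : (stepPath Ψ τ (k + 1)).stopped (τ k) = stepPath Ψ τ (k + 1) := by
    rw [stepPath, Cadlag.jump_stopped _ _ (mem_univ _)]
  rw [h2] at h1
  simp only [stepPath_jump Ψ hτ] at hmv
  rw [h1]
  exact hmv

/-- Telescoping along step paths writes the increment of `h` as an integral of step functions
against `θ l`. By left-continuity of the gradient they converge pointwise, and they are bounded, so
dominated convergence applies. Before `s` the path may be any càdlàg path. -/
theorem IsFlat.sub_eq_integral {h : PathFun T (univ : Set (Vec ν))} (hh : IsFlat h)
    {μ : Measure (Time T)} [NullSingletonClass μ] {θ : Fin ν → Time T → ℝ}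
    (hθ : ∀ l, Integrable (θ l) μ) {Ψ : Cadlag T (univ : Set (Vec ν))} {s t : Time T}
    (hΨ : ∀ l u v, s ≤ u → u ≤ v → Ψ v l - Ψ u l = ∫ r in Ioc u v, θ l r ∂μ) (hst : s ≤ t) :
    h t Ψ - h s Ψ = ∑ l, ∫ r in Ioc s t, ppartial l h r Ψ * θ l r ∂μ := by
  -- Only the part of `Ψ` from `s` on is known to be continuous.
  have hcont : Continuous fun u => Ψ (max s u) := by
    refine (PiLp.continuous_toLp 2 _).comp (continuous_pi fun l => ?_)
    have : (fun u => Ψ (max s u) l) = fun u => Ψ s l +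
        ((∫ r in Iic (max s u), θ l r ∂μ) - ∫ r in Iic s, θ l r ∂μ) := by
      funext u
      rw [(hasLSDensity_integral_Iic (hθ l)).sub_eq s _ (le_max_left _ _),
        ← hΨ l s _ le_rfl (le_max_left _ _)]
      ring
    change Continuous fun u => Ψ (max s u) l
    rw [this]
    exact continuous_const.add (((continuous_integral_Iic (hθ l)).comp
      (continuous_const.max continuous_id)).sub continuous_const)
  have hunif := Metric.uniformContinuous_iff.1
    (CompactSpace.uniformContinuous_of_continuous hcont)
  choose τ hτ hτ0 hτt hτmesh using exists_grid hst
  have hmesh : Tendsto (fun n : ℕ => ((t : ℝ) - s) / (n + 1)) atTop (𝓝 0) := by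
    simpa [div_eq_mul_inv] using
      (tendsto_one_div_add_atTop_nhds_zero_nat (𝕜 := ℝ)).const_mul ((t : ℝ) - s)
  have hsτ : ∀ n k, s ≤ τ n k := fun n k => (hτ0 n).symm.le.trans (hτ n (Nat.zero_le k))
  have hosc : ∀ η > (0 : ℝ), ∀ᶠ n in atTop, ∀ k u v, u ∈ Icc (τ n k) (τ n (k + 1)) →
      v ∈ Icc (τ n k) (τ n (k + 1)) → dist (Ψ u) (Ψ v) ≤ η := by
    intro η hη
    obtain ⟨δ, hδ, hunif⟩ := hunif η hη
    filter_upwards [hmesh.eventually (gt_mem_nhds hδ)] with n hn k u v hu hv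
    have h1 := hunif (a := u) (b := v) <| by
      have a1 : (τ n k : ℝ) ≤ u := hu.1
      have a2 : (u : ℝ) ≤ τ n (k + 1) := hu.2
      have a3 : (τ n k : ℝ) ≤ v := hv.1
      have a4 : (v : ℝ) ≤ τ n (k + 1) := hv.2
      have a5 := hτmesh n k
      rw [Subtype.dist_eq, Real.dist_eq, abs_lt]
      constructor <;> linarith
    rw [max_eq_right ((hsτ n k).trans hu.1), max_eq_right ((hsτ n k).trans hv.1)] at h1
    exact h1.le
  choose z hz hstep using fun n k => hh.stepPath_sub Ψ (hτ n) k
  let c : Fin ν → ℕ → ℕ → ℝ := fun l n k =>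
    ppartial l h (τ n k) ((stepPath Ψ (τ n) k).jump (τ n k) (z n k))
  -- On `(τ k, τ (k + 1)]` this is the mean value coefficient, so its integral against `θ l`
  -- reproduces coefficient times increment.
  let a : Fin ν → ℕ → Time T → ℝ := fun l n r => ∑ k ∈ Finset.range (n + 1),
    (Ioc (τ n k) (τ n (k + 1))).indicator (fun _ => c l n k) r
  have ha : ∀ l n, Measurable (a l n) := fun l n =>
    Finset.measurable_sum _ fun k _ => measurable_const.indicator measurableSet_Ioc
  have hbound : ∀ l, ∃ C, ∀ᶠ n in atTop, ∀ r ∈ Ioc s t, |a l n r| ≤ C := by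
    intro l
    obtain ⟨K, hK, hKU, hΨK⟩ := Ψ.exists_compact isOpen_univ
    obtain ⟨C, hC⟩ := hh.grad_bddPres l (Metric.cthickening 1 K) hK.cthickening (subset_univ _)
    refine ⟨C, ?_⟩
    filter_upwards [hosc 1 one_pos] with n hn r hr
    rw [← hτ0 n, ← hτt n] at hr
    obtain ⟨k, hk, hrk⟩ := exists_mem_Ioc_of_monotone hr
    simp only [a, sum_indicator_Ioc_eq (hτ n) hk hrk]
    refine hC _ _ fun u => ?_
    refine Metric.mem_cthickening_of_dist_le _ _ 1 K (hΨK (min r u)) ?_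
    rw [dist_comm]
    exact dist_stepPath_jump_le Ψ (hτ n) zero_le_one hn k ⟨hrk.1.le, hrk.2⟩ (hz n k)
      (mem_univ _) u
  have hlim : ∀ l, ∀ r ∈ Ioc s t, Tendsto (fun n => a l n r) atTop (𝓝 (ppartial l h r Ψ)) := by
    intro l r hr
    have hr0 : 0 < (r : ℝ) := s.2.1.trans_lt hr.1
    refine Metric.tendsto_atTop.2 fun ε hε => eventually_atTop.1 ?_
    obtain ⟨δ, hδ, hδ'⟩ := (nhdsLeft_hasBasis r Ψ).eventually_iff.1
      ((hh.grad_leftCont l r hr0 Ψ).eventually (Metric.ball_mem_nhds _ hε))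
    filter_upwards [hosc (δ / 2) (half_pos hδ), hmesh.eventually (gt_mem_nhds hδ)] with n hn hn'
    have hr' := hr
    rw [← hτ0 n, ← hτt n] at hr'
    obtain ⟨k, hk, hrk⟩ := exists_mem_Ioc_of_monotone hr'
    simp only [a, sum_indicator_Ioc_eq (hτ n) hk hrk]
    refine hδ' (x := (τ n k, (stepPath Ψ (τ n) k).jump (τ n k) (z n k))) ⟨hrk.1.le, ?_, ?_⟩
    · have h1 : (r : ℝ) ≤ τ n (k + 1) := hrk.2
      change (r : ℝ) - τ n k < δ
      linarith [hτmesh n k]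
    · rw [Cadlag.jump_stopped _ _ (mem_univ _)]
      exact supDist_lt_of_dist_le (dist_stepPath_jump_le Ψ (hτ n) (half_pos hδ).le hn k
        ⟨hrk.1.le, hrk.2⟩ (hz n k) (mem_univ _)) (half_lt_self hδ) hδ
  have hint : ∀ l, Tendsto (fun n => ∫ r in Ioc s t, a l n r * θ l r ∂μ) atTop
      (𝓝 (∫ r in Ioc s t, ppartial l h r Ψ * θ l r ∂μ)) := by
    intro l
    obtain ⟨C, hC⟩ := hbound l
    refine tendsto_integral_filter_of_dominated_convergence (fun r => C * ‖θ l r‖) ?_ ?_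
      ((hθ l).norm.const_mul C).integrableOn ?_
    · exact Eventually.of_forall fun n =>
        (ha l n).aestronglyMeasurable.mul (hθ l).aestronglyMeasurable.restrict
    · filter_upwards [hC] with n hn
      filter_upwards [ae_restrict_mem measurableSet_Ioc] with r hr
      rw [norm_mul]
      exact mul_le_mul_of_nonneg_right (hn r hr) (norm_nonneg _)
    · filter_upwards [ae_restrict_mem measurableSet_Ioc] with r hr
      exact (hlim l r hr).mul_const _
  have hsum : ∀ n, h t (stepPath Ψ (τ n) (n + 1)) - h s Ψ =
      ∑ l, ∫ r in Ioc s t, a l n r * θ l r ∂μ := by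
    intro n
    have h0 : h s Ψ = h (τ n 0) (stepPath Ψ (τ n) 0) := by
      rw [stepPath, ← hh.adapted, hτ0]
    have h1 : h t (stepPath Ψ (τ n) (n + 1)) =
      h (τ n (n + 1)) (stepPath Ψ (τ n) (n + 1)) := by rw [hτt]
    rw [h0, h1, ← Finset.sum_range_sub fun k => h (τ n k) (stepPath Ψ (τ n) k)]
    simp only [hstep]
    rw [Finset.sum_comm]
    refine Finset.sum_congr rfl fun l _ => ?_
    have h2 : ∀ k ∈ Finset.range (n + 1), IntegrableOn (fun r =>
        (Ioc (τ n k) (τ n (k + 1))).indicator (fun _ => c l n k) r * θ l r) (Ioc s t) μ := by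
      intro k _
      refine ((hθ l).bdd_mul (c := |c l n k|)
        (measurable_const.indicator measurableSet_Ioc).aestronglyMeasurable
        (ae_of_all _ fun r => ?_)).integrableOn
      exact (norm_indicator_le_norm_self _ r)
    simp only [a, Finset.sum_mul]
    rw [integral_finsetSum _ h2]
    refine Finset.sum_congr rfl fun k hk => ?_
    have h3 : (fun r => (Ioc (τ n k) (τ n (k + 1))).indicator (fun _ => c l n k) r * θ l r) =
        (Ioc (τ n k) (τ n (k + 1))).indicator fun r => c l n k * θ l r := by
      funext r
      rw [indicator_mul_left]
    rw [h3, setIntegral_indicator measurableSet_Ioc, inter_eq_self_of_subset_right,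
      integral_const_mul, ← hΨ l _ _ (hsτ n k) (hτ n k.le_succ)]
    refine Ioc_subset_Ioc (hsτ n k) ?_
    rw [← hτt n]
    exact hτ n (Finset.mem_range.1 hk)
  have hend : Tendsto (fun n => h t (stepPath Ψ (τ n) (n + 1))) atTop (𝓝 (h t Ψ)) := by
    refine Metric.tendsto_atTop.2 fun ε hε => eventually_atTop.1 ?_
    obtain ⟨η, hη, hη'⟩ := (nhdsSup_hasBasis _).eventually_iff.1
      (hh.unifCont (Ψ.stopped t) ε hε)
    filter_upwards [hosc (η / 2) (half_pos hη)] with n hn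
    have h1 := dist_stepPath_le Ψ (hτ n) (half_pos hη).le hn (n + 1)
    rw [hτt] at h1
    have h2 := hη' (supDist_lt_of_dist_le h1 (half_lt_self hη) hη) t
    rwa [← hh.adapted, abs_sub_comm] at h2
  refine tendsto_nhds_unique (hend.sub_const (h s Ψ)) ?_
  simp only [hsum]
  exact tendsto_finsetSum _ fun l _ => hint l

end ChainRule


/-! ### Products and sums of path functionals -/

section Algebra

variable {T : ℝ} {d : ℕ} {U : Set (Vec d)} {a b : PathFun T U}

theorem LeftCont.mul (ha : LeftCont a) (hb : LeftCont b) : LeftCont fun t X => a t X * b t X :=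
  fun t ht X => (ha t ht X).mul (hb t ht X)

theorem LeftCont.add (ha : LeftCont a) (hb : LeftCont b) : LeftCont fun t X => a t X + b t X :=
  fun t ht X => (ha t ht X).add (hb t ht X)

theorem LeftCont.sum {ι : Type*} (s : Finset ι) {a : ι → PathFun T U}
    (ha : ∀ i ∈ s, LeftCont (a i)) : LeftCont fun t X => ∑ i ∈ s, a i t X :=
  fun t ht X => tendsto_finsetSum s fun i hi => ha i hi t ht X

theorem BddPres.mul (ha : BddPres a) (hb : BddPres b) : BddPres fun t X => a t X * b t X := by
  intro K hK hKU
  obtain ⟨C, hC⟩ := ha K hK hKU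
  obtain ⟨C', hC'⟩ := hb K hK hKU
  refine ⟨C * C', fun t X hX => ?_⟩
  rw [abs_mul]
  exact mul_le_mul (hC t X hX) (hC' t X hX) (abs_nonneg _) ((abs_nonneg _).trans (hC t X hX))

theorem BddPres.add (ha : BddPres a) (hb : BddPres b) : BddPres fun t X => a t X + b t X := by
  intro K hK hKU
  obtain ⟨C, hC⟩ := ha K hK hKU
  obtain ⟨C', hC'⟩ := hb K hK hKU
  exact ⟨C + C', fun t X hX => (abs_add_le _ _).trans (add_le_add (hC t X hX) (hC' t X hX))⟩

theorem BddPres.sum {ι : Type*} [Fintype ι] {a : ι → PathFun T U} (ha : ∀ i, BddPres (a i)) :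
    BddPres fun t X => ∑ i, a i t X := by
  intro K hK hKU
  choose C hC using fun i => ha i K hK hKU
  exact ⟨∑ i, C i, fun t X hX => (Finset.abs_sum_le_sum_abs _ _).trans
    (Finset.sum_le_sum fun i _ => hC i t X hX)⟩

theorem Cadlag.bump_zero (X : Cadlag T U) (t : Time T) : X.bump t 0 = X :=
  X.bump_eq X t 0 fun u => by simp

theorem VertDiff.hasGradientAt (ha : VertDiff a) (t : Time T) (X : Cadlag T U) :
    HasGradientAt (fun v => a t (X.bump t v)) (pgrad a t X) 0 := (ha t X).hasGradientAt

theorem VertDiff.hasGradientAt_mul (ha : VertDiff a) (hb : VertDiff b) (t : Time T)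
    (X : Cadlag T U) : HasGradientAt (fun v => a t (X.bump t v) * b t (X.bump t v))
      (a t X • pgrad b t X + b t X • pgrad a t X) 0 := by
  have h1 := (ha.hasGradientAt t X).hasFDerivAt
  have h2 := (hb.hasGradientAt t X).hasFDerivAt
  have h := h1.fun_mul h2
  rw [hasGradientAt_iff_hasFDerivAt, map_add, map_smul, map_smul]
  rw [X.bump_zero] at h
  exact h

theorem VertDiff.mul (ha : VertDiff a) (hb : VertDiff b) : VertDiff fun t X => a t X * b t X :=
  fun t X => (ha.hasGradientAt_mul hb t X).differentiableAt

theorem VertDiff.ppartial_mul (ha : VertDiff a) (hb : VertDiff b) (i : Fin d) :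
    ppartial i (fun t X => a t X * b t X) =
      fun t X => a t X * ppartial i b t X + b t X * ppartial i a t X := by
  funext t X
  have := (ha.hasGradientAt_mul hb t X).gradient
  simp only [ppartial, pgrad] at this ⊢
  rw [this]
  simp

theorem VertDiff.hasGradientAt_sum {ι : Type*} [Fintype ι] {a : ι → PathFun T U}
    (ha : ∀ i, VertDiff (a i)) (t : Time T) (X : Cadlag T U) :
    HasGradientAt (fun v => ∑ i, a i t (X.bump t v)) (∑ i, pgrad (a i) t X) 0 := by
  rw [hasGradientAt_iff_hasFDerivAt, map_sum]
  exact HasFDerivAt.fun_sum fun i _ => ((ha i).hasGradientAt t X).hasFDerivAt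

theorem VertDiff.sum {ι : Type*} [Fintype ι] {a : ι → PathFun T U}
    (ha : ∀ i, VertDiff (a i)) : VertDiff fun t X => ∑ i, a i t X :=
  fun t X => (VertDiff.hasGradientAt_sum ha t X).differentiableAt

theorem VertDiff.ppartial_sum {ι : Type*} [Fintype ι] {a : ι → PathFun T U}
    (ha : ∀ i, VertDiff (a i)) (j : Fin d) :
    ppartial j (fun t X => ∑ i, a i t X) = fun t X => ∑ i, ppartial j (a i) t X := by
  funext t X
  have := (VertDiff.hasGradientAt_sum ha t X).gradient
  simp only [ppartial]
  rw [pgrad, this]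
  simp

end Algebra

/-! ### Path-valued functionals -/

section PathMaps

variable {T : ℝ} {d ν : ℕ} {U : Set (Vec d)}

theorem Vec.dist_le_of_abs_le {x y : Vec ν} {c : ℝ} (h : ∀ l, |x l - y l| ≤ c) :
    dist x y ≤ ν * c := by
  have h1 : dist x y ≤ ∑ l, |x l - y l| := by
    rw [dist_eq_norm, EuclideanSpace.norm_eq]
    refine Real.sqrt_le_iff.2 ⟨Finset.sum_nonneg fun _ _ => abs_nonneg _, ?_⟩
    exact Finset.sum_sq_le_sq_sum_of_nonneg fun _ _ => abs_nonneg _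
  refine h1.trans ((Finset.sum_le_sum fun l _ => h l).trans ?_)
  simp

theorem Cadlag.tendsto_stopped_right (X : Cadlag T U) (t : Time T) :
    Tendsto (fun u => X.stopped u) (𝓝[≥] t) (nhdsSup (X.stopped t)) := by
  refine (nhdsSup_hasBasis _).tendsto_right_iff.2 fun δ hδ => ?_
  obtain ⟨η, hη, h⟩ := Metric.continuousWithinAt_iff.1 (X.right_cont t) (δ / 2) (half_pos hδ)
  filter_upwards [self_mem_nhdsWithin, mem_nhdsWithin_of_mem_nhds (Metric.ball_mem_nhds t hη)]
    with u hu hu'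
  have hu : t ≤ u := hu
  refine supDist_lt_of_dist_le (fun v => ?_) (half_lt_self hδ) hδ
  rcases le_total v t with hv | hv
  · rw [X.stopped_of_ge hv, X.stopped_of_ge (hv.trans hu), dist_self]
    exact (half_pos hδ).le
  · rw [X.stopped_of_le hv, X.stopped_apply, dist_comm]
    refine (h (mem_Ici.2 (le_min hu hv)) (lt_of_le_of_lt ?_ hu')).le
    have h1 : (t : ℝ) ≤ (min u v : Time T) := le_min hu hv
    have h2 : ((min u v : Time T) : ℝ) ≤ u := min_le_left u v
    rw [Subtype.dist_eq, Subtype.dist_eq, Real.dist_eq, Real.dist_eq,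
      abs_of_nonneg (sub_nonneg.2 h1), abs_of_nonneg (sub_nonneg.2 (h1.trans h2))]
    linarith

/-- As `u ↑ t`, the stopped paths approach the path whose value from `t` on is the left limit `x`.
Hence the left limit of `f(u,X)` is `f(t, X.jump t x)`. -/
theorem Cadlag.tendsto_nhdsLeft_jump (X : Cadlag T U) {t : Time T} {x : Vec d} (hx : x ∈ U)
    (h : Tendsto X (𝓝[<] t) (𝓝 x)) :
    Tendsto (fun u => (u, X)) (𝓝[<] t) (nhdsLeft t (X.jump t x)) := by
  refine (nhdsLeft_hasBasis _ _).tendsto_right_iff.2 fun δ hδ => ?_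
  have h1 : ∀ᶠ u in 𝓝[<] t, ∀ v, u ≤ v → v < t → dist (X v) x < δ / 3 := by
    have h2 := h.eventually (Metric.ball_mem_nhds x (show 0 < δ / 3 by positivity))
    obtain ⟨η, hη, h3⟩ := Metric.mem_nhdsWithin_iff.1 h2
    filter_upwards [self_mem_nhdsWithin, mem_nhdsWithin_of_mem_nhds (Metric.ball_mem_nhds t hη)]
      with u hu hu' v huv hvt
    refine h3 ⟨?_, hvt⟩
    have a1 : (u : ℝ) ≤ v := huv
    have a2 : (v : ℝ) < t := hvt
    rw [Metric.mem_ball, Subtype.dist_eq, Real.dist_eq, abs_lt] at hu' ⊢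
    constructor <;> linarith [hu'.1]
  have h2 := (nhdsLE_hasBasis t).mem_of_mem hδ
  filter_upwards [h1, self_mem_nhdsWithin, nhdsWithin_mono t Iio_subset_Iic_self h2]
    with u hu hut hu2
  have hut : u < t := hut
  refine ⟨hut.le, hu2.2, ?_⟩
  rw [Cadlag.jump_stopped _ _ hx]
  refine supDist_lt_of_dist_le (c := 2 * (δ / 3)) (fun v => ?_) (by linarith) hδ
  have hu0 := hu u le_rfl hut
  rcases lt_or_ge v u with hvu | hvu
  · rw [Cadlag.jump_of_lt _ _ (hvu.trans hut), X.stopped_of_ge hvu.le, dist_self]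
    positivity
  · rw [X.stopped_of_le hvu]
    rcases lt_or_ge v t with hvt | hvt
    · rw [Cadlag.jump_of_lt _ _ hvt]
      linarith [dist_triangle_right (X v) (X u) x, hu v hvu hvt]
    · rw [Cadlag.jump_of_le _ hx hvt, dist_comm]
      linarith

/-- Adapted functionals `f_l` whose increments along stopped paths have the density
`∑ i, D_{l,i} ρ_i`. -/
structure HasDrift {ι : Type*} [Fintype ι] (μ : Measure (Time T)) (ρ : ι → Time T → ℝ)
    (f : Fin ν → PathFun T U) (D : Fin ν → ι → PathFun T U) : Prop where
  regular : ∀ l, IsRegular (f l)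
  integrand : ∀ l i, IsIntegrand μ (D l i)
  integrable : ∀ i, Integrable (ρ i) μ
  sub_eq : ∀ l s u v (Z : Cadlag T U), s ≤ u → u ≤ v →
    f l v (Z.stopped s) - f l u (Z.stopped s) =
      ∫ r in Ioc u v, ∑ i, D l i r (Z.stopped s) * ρ i r ∂μ

theorem HasDrift.integrable_drift {ι : Type*} [Fintype ι] {μ : Measure (Time T)}
    {ρ : ι → Time T → ℝ} {f : Fin ν → PathFun T U} {D : Fin ν → ι → PathFun T U}
    (h : HasDrift μ ρ f D) (hU : IsOpen U) (l : Fin ν) (Z : Cadlag T U) :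
    Integrable (fun r => ∑ i, D l i r Z * ρ i r) μ :=
  integrable_finsetSum _ fun i _ => (h.integrand l i).integrable hU (h.integrable i) Z

/-- The paths `F(·,Z)` are càdlàg. -/
theorem HasDrift.exists_pathMap {ι : Type*} [Fintype ι] {μ : Measure (Time T)}
    [NullSingletonClass μ] {ρ : ι → Time T → ℝ} {f : Fin ν → PathFun T U}
    {D : Fin ν → ι → PathFun T U} (h : HasDrift μ ρ f D) (hU : IsOpen U) :
    ∃ Φ : Cadlag T U → Cadlag T (univ : Set (Vec ν)), ∀ Z t l, Φ Z t l = f l t Z := by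
  have htend : ∀ (Z : Cadlag T U) (F : Filter (Time T)) (y : Vec ν),
      (∀ l, Tendsto (fun u => f l u Z) F (𝓝 (y l))) →
      Tendsto (fun u => WithLp.toLp 2 fun l => f l u Z) F (𝓝 y) := fun Z F y hy =>
    ((PiLp.continuous_toLp 2 _).tendsto (fun l => y l)).comp (tendsto_pi_nhds.2 hy)
  refine ⟨fun Z => ⟨fun t => WithLp.toLp 2 fun l => f l t Z, fun _ => mem_univ _, fun t => ?_,
    fun t => ?_⟩, fun Z t l => rfl⟩
  · refine htend Z _ _ fun l => ?_
    -- Right-continuity splits in two: the paths `Z^u` approach `Z^t` uniformly, which uniform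
    -- continuity of `f l` converts into this limit, and along the frozen path `Z^t` the drift
    -- identity gives continuity in time.
    have h1 : Tendsto (fun u => f l u Z - f l u (Z.stopped t)) (𝓝[≥] t) (𝓝 0) := by
      refine Metric.tendsto_nhds.2 fun ε hε => ?_
      filter_upwards [(Z.tendsto_stopped_right t).eventually
        ((h.regular l).unifCont (Z.stopped t) ε hε)] with u hu
      have := hu u
      rw [(h.regular l).adapted u Z, dist_zero_right, Real.norm_eq_abs, abs_sub_comm]
      exact this
    have h2 : Tendsto (fun u => f l u (Z.stopped t)) (𝓝[≥] t) (𝓝 (f l t Z)) := by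
      have hi := h.integrable_drift hU l (Z.stopped t)
      have h3 : Tendsto (fun u => f l t (Z.stopped t) +
          ((∫ r in Iic u, ∑ i, D l i r (Z.stopped t) * ρ i r ∂μ) -
          ∫ r in Iic t, ∑ i, D l i r (Z.stopped t) * ρ i r ∂μ)) (𝓝[≥] t)
          (𝓝 (f l t Z)) := by
        have h4 := ((((continuous_integral_Iic hi).tendsto t).mono_left
          (nhdsWithin_le_nhds (s := Ici t))).sub_const
          (∫ r in Iic t, ∑ i, D l i r (Z.stopped t) * ρ i r ∂μ)).const_add (f l t (Z.stopped t))
        rw [← (h.regular l).adapted] at h4 ⊢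
        rwa [sub_self, add_zero] at h4
      refine h3.congr' ?_
      filter_upwards [self_mem_nhdsWithin] with u hu
      rw [(hasLSDensity_integral_Iic hi).sub_eq t u hu, ← h.sub_eq l t t u Z le_rfl hu]
      ring
    simpa using h1.add h2
  · rcases t.2.1.eq_or_lt with ht | ht
    · refine ⟨0, mem_univ _, ?_⟩
      have : 𝓝[<] t = ⊥ := by
        have : Iio t = ∅ := by
          ext u
          simp only [mem_Iio, mem_empty_iff_false, iff_false, not_lt]
          change (t : ℝ) ≤ u
          rw [← ht]
          exact u.2.1
        rw [this, nhdsWithin_empty]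
      rw [this]
      exact tendsto_bot
    · obtain ⟨x, hx, hlim⟩ := Z.left_lim t
      refine ⟨WithLp.toLp 2 fun l => f l t (Z.jump t x), mem_univ _, htend Z _ _ fun l => ?_⟩
      exact ((h.regular l).leftCont t ht (Z.jump t x)).comp (Z.tendsto_nhdsLeft_jump hx hlim)

variable {f : Fin ν → PathFun T U} {Φ : Cadlag T U → Cadlag T (univ : Set (Vec ν))}

theorem pathMap_stopped (hf : ∀ l, Adapted (f l)) (hΦ : ∀ Z t l, Φ Z t l = f l t Z) (t : Time T)
    (Z : Cadlag T U) : (Φ (Z.stopped t)).stopped t = (Φ Z).stopped t := by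
  refine Cadlag.stopped_eq_stopped _ _ _ fun u hu => ?_
  ext l
  rw [hΦ, hΦ, (hf l).eq_stopped hu]

theorem tendsto_pathMap_nhdsSup (hf : ∀ l, UnifCont (f l)) (hΦ : ∀ Z t l, Φ Z t l = f l t Z)
    (Z : Cadlag T U) : Tendsto Φ (nhdsSup Z) (nhdsSup (Φ Z)) := by
  refine (nhdsSup_hasBasis _).tendsto_right_iff.2 fun δ hδ => ?_
  have hc : 0 < δ / (ν + 1) := by positivity
  filter_upwards [eventually_all.2 fun l => hf l Z _ hc] with Y hY
  refine supDist_lt_of_dist_le (c := ν * (δ / (ν + 1))) (fun u => ?_) ?_ hδ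
  · exact Vec.dist_le_of_abs_le fun l => by
      rw [hΦ, hΦ]
      exact (hY l u).le
  · rw [mul_div_assoc', div_lt_iff₀ (by positivity)]
    nlinarith

/-- Let `p = (s,Y)`. Up to `s` the image paths are compared by uniform continuity at `Z^t`; between
`s` and `t` both are compared with `f l t Z` by left-continuity. -/
theorem tendsto_pathMap_nhdsLeft (hf : ∀ l, Adapted (f l)) (hfu : ∀ l, UnifCont (f l))
    (hfl : ∀ l, LeftCont (f l)) (hΦ : ∀ Z t l, Φ Z t l = f l t Z) {t : Time T}
    (ht : 0 < (t : ℝ)) (Z : Cadlag T U) :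
    Tendsto (fun p : Time T × Cadlag T U => (p.1, Φ p.2)) (nhdsLeft t Z)
      (nhdsLeft t (Φ Z)) := by
  refine (nhdsLeft_hasBasis _ _).tendsto_right_iff.2 fun δ hδ => ?_
  have hc : 0 < δ / (2 * (ν + 1)) := by positivity
  set c := δ / (2 * (ν + 1)) with hcdef
  have hcδ : (ν : ℝ) * (2 * c) < δ := by
    have : c * (2 * (ν + 1)) = δ := div_mul_cancel₀ _ (by positivity)
    nlinarith
  have hev : ∀ l, ∃ η > (0 : ℝ), (∀ Y : Cadlag T U,
      supDist (Z.stopped t) Y < ENNReal.ofReal η → ∀ u, |f l u (Z.stopped t) - f l u Y| < c) ∧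
      ∀ p : Time T × Cadlag T U, p.1 ≤ t → (t : ℝ) - p.1 < η →
        supDist (Z.stopped t) (p.2.stopped p.1) < ENNReal.ofReal η →
        |f l p.1 p.2 - f l t Z| < c := by
    intro l
    obtain ⟨η₁, hη₁, h1⟩ := (nhdsSup_hasBasis _).eventually_iff.1 (hfu l (Z.stopped t) c hc)
    obtain ⟨η₂, hη₂, h2⟩ := (nhdsLeft_hasBasis t Z).eventually_iff.1
      ((hfl l t ht Z).eventually (Metric.ball_mem_nhds _ hc))
    refine ⟨min η₁ η₂, lt_min hη₁ hη₂, fun Y hY => h1 (hY.trans_le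
      (ENNReal.ofReal_le_ofReal (min_le_left _ _))), fun p hp1 hp2 hp3 => h2 ⟨hp1,
      hp2.trans_le (min_le_right _ _), hp3.trans_le
      (ENNReal.ofReal_le_ofReal (min_le_right _ _))⟩⟩
  have hloc : ∀ l, ∀ᶠ p in nhdsLeft t Z, ∀ u,
      |f l (min t u) Z - f l (min p.1 u) p.2| < 2 * c := by
    intro l
    obtain ⟨η, hη, h1, h2⟩ := hev l
    filter_upwards [(nhdsLeft_hasBasis t Z).mem_of_mem (show 0 < η / 3 by positivity)] with p hp u
    obtain ⟨hp1, hp2, hp3⟩ := hp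
    have hp3' : supDist (Z.stopped t) (p.2.stopped p.1) < ENNReal.ofReal η :=
      hp3.trans_le (ENNReal.ofReal_le_ofReal (by linarith))
    rcases le_total u p.1 with hu | hu
    · rw [min_eq_right (hu.trans hp1), min_eq_right hu, ← (hf l).eq_stopped (hu.trans hp1) Z,
        ← (hf l).eq_stopped hu p.2]
      linarith [h1 _ hp3' u]
    · rw [min_eq_left hu]
      have h3 := h2 p hp1 (by linarith) hp3'
      have hm1 : p.1 ≤ min t u := le_min hp1 hu
      -- Since `Y^s` is constant from `s` on, its closeness to `Z^t` forces `Z` to oscillate little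
      -- on `[s,t]`. So `(min t u, Z)` itself is a left neighbour of `(t,Z)`.
      have h4 : |f l (min t u) Z - f l t Z| < c := by
        have a1 : (p.1 : ℝ) ≤ (min t u : Time T) := hm1
        refine h2 (min t u, Z) (min_le_left _ _) (by linarith : (t : ℝ) - (min t u : Time T) < η) ?_
        refine supDist_lt_of_dist_le (c := 2 * (η / 3)) (fun v => ?_) (by linarith) hη
        change dist (Z.stopped t v) (Z.stopped (min t u) v) ≤ _
        rcases le_total v (min t u) with hv | hv
        · rw [Z.stopped_of_ge hv, Z.stopped_of_ge (hv.trans (min_le_left _ _)), dist_self]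
          positivity
        · have b1 := dist_lt_of_supDist_lt hp3 v
          have b2 := dist_lt_of_supDist_lt hp3 (min t u)
          rw [p.2.stopped_of_le (hm1.trans hv)] at b1
          rw [p.2.stopped_of_le hm1, Z.stopped_of_ge (min_le_left _ _)] at b2
          rw [Z.stopped_of_le hv]
          linarith [dist_triangle_right (Z.stopped t v) (Z (min t u)) (p.2 p.1)]
      have h5 := abs_sub_le (f l (min t u) Z) (f l t Z) (f l p.1 p.2)
      rw [abs_sub_comm (f l t Z)] at h5
      linarith
  filter_upwards [eventually_all.2 hloc, (nhdsLeft_hasBasis t Z).mem_of_mem hδ] with p hp hp'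
  refine ⟨hp'.1, hp'.2.1, supDist_lt_of_dist_le (c := ν * (2 * c)) (fun u => ?_) hcδ hδ⟩
  refine Vec.dist_le_of_abs_le fun l => ?_
  rw [Cadlag.stopped_apply, Cadlag.stopped_apply, hΦ, hΦ]
  exact (hp l u).le

variable {g : PathFun T (univ : Set (Vec ν))}

theorem Adapted.comp_pathMap (hg : Adapted g) (hf : ∀ l, Adapted (f l))
    (hΦ : ∀ Z t l, Φ Z t l = f l t Z) : Adapted fun t Z => g t (Φ Z) := fun t Z => by
  change g t (Φ Z) = g t (Φ (Z.stopped t))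
  rw [hg t (Φ Z), hg t (Φ (Z.stopped t)), pathMap_stopped hf hΦ]

theorem UnifCont.comp_pathMap (hg : UnifCont g) (hf : ∀ l, UnifCont (f l))
    (hΦ : ∀ Z t l, Φ Z t l = f l t Z) : UnifCont fun t Z => g t (Φ Z) := fun Z ε hε =>
  (tendsto_pathMap_nhdsSup hf hΦ Z).eventually (hg (Φ Z) ε hε)

theorem LeftCont.comp_pathMap (hg : LeftCont g) (hf : ∀ l, IsRegular (f l))
    (hΦ : ∀ Z t l, Φ Z t l = f l t Z) : LeftCont fun t Z => g t (Φ Z) := fun t ht Z =>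
  (hg t ht (Φ Z)).comp (tendsto_pathMap_nhdsLeft (fun l => (hf l).adapted)
    (fun l => (hf l).unifCont) (fun l => (hf l).leftCont) hΦ ht Z)

theorem BddPres.comp_pathMap (hg : BddPres g) (hf : ∀ l, BddPres (f l))
    (hΦ : ∀ Z t l, Φ Z t l = f l t Z) : BddPres fun t Z => g t (Φ Z) := by
  intro K hK hKU
  choose C hC using fun l => hf l K hK hKU
  obtain ⟨C', hC'⟩ := hg (Metric.closedBall 0 (ν * ∑ l, |C l|)) (isCompact_closedBall _ _)
    (subset_univ _)
  refine ⟨C', fun t Z hZ => hC' t _ fun u => ?_⟩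
  refine Vec.dist_le_of_abs_le fun l => ?_
  rw [hΦ]
  simp only [PiLp.zero_apply, sub_zero]
  exact ((hC l u Z hZ).trans (le_abs_self _)).trans
    (Finset.single_le_sum (f := fun l => |C l|) (fun _ _ => abs_nonneg _) (Finset.mem_univ l))

/-- Changing `Z` from `t` on does not affect `Φ Z` before `t`. A vertical perturbation of `Z` thus
acts as one of `Φ Z`, and the vertical chain rule is the ordinary one for `x ↦ Φ (Z.jump t x) t`. -/
theorem pathMap_jump_stopped (hf : ∀ l, Adapted (f l)) (hΦ : ∀ Z t l, Φ Z t l = f l t Z)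
    (t : Time T) (Z : Cadlag T U) (x : Vec d) :
    (Φ (Z.jump t x)).stopped t = (Φ Z).jump t (Φ (Z.jump t x) t) := by
  ext1; funext u
  rcases lt_or_ge u t with h | h
  · rw [Cadlag.jump_of_lt _ _ h, Cadlag.stopped_of_ge _ h.le]
    ext l
    rw [hΦ, hΦ]
    exact (hf l).congr fun v hv => Cadlag.jump_of_lt _ _ (hv.trans_lt h)
  · rw [Cadlag.jump_of_le _ (mem_univ _) h, Cadlag.stopped_of_le _ h]

theorem HasGradientAt.comp_vec {w : Vec d → Vec ν} {G : Fin ν → Vec d} {x : Vec d}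
    (hw : ∀ l, HasGradientAt (fun y => w y l) (G l) x) {q : Vec ν → ℝ} {H : Vec ν}
    (hq : HasGradientAt q H (w x)) : HasGradientAt (fun y => q (w y)) (∑ l, H l • G l) x := by
  let L : Vec d →L[ℝ] Vec ν :=
    ∑ l, (InnerProductSpace.toDual ℝ (Vec d) (G l)).smulRight (EuclideanSpace.single l (1 : ℝ))
  have hL : ∀ v l, L v l = inner ℝ (G l) v := by
    intro v l
    simp [L, Pi.single_apply]
  have hw' : HasFDerivAt w L x := by
    rw [← hasFDerivWithinAt_univ, hasFDerivWithinAt_euclidean]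
    intro l
    rw [hasFDerivWithinAt_univ]
    refine (hw l).hasFDerivAt.congr_fderiv ?_
    ext1 v
    simp [hL]
  rw [hasGradientAt_iff_hasFDerivAt]
  refine (hq.hasFDerivAt.comp x hw').congr_fderiv ?_
  ext1 v
  rw [ContinuousLinearMap.comp_apply, InnerProductSpace.toDual_apply_apply,
    InnerProductSpace.toDual_apply_apply, Vec.inner_eq, sum_inner]
  refine Finset.sum_congr rfl fun l _ => ?_
  rw [hL, inner_smul_left]
  rfl

theorem VertDiff.hasGradientAt_comp_pathMap (hU : IsOpen U) (hg : VertDiff g) (hga : Adapted g)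
    (hf : ∀ l, Adapted (f l)) (hfv : ∀ l, VertDiff (f l)) (hΦ : ∀ Z t l, Φ Z t l = f l t Z)
    (t : Time T) (Z : Cadlag T U) :
    HasGradientAt (fun v => g t (Φ (Z.bump t v)))
      (∑ l, ppartial l g t (Φ Z) • pgrad (f l) t Z) 0 := by
  refine (hga.comp_pathMap hf hΦ).hasGradientAt_bump hU (f := fun t Z => g t (Φ Z)) ?_
  have h1 : ∀ y, g t (Φ (Z.jump t y)) = g t ((Φ Z).jump t (Φ (Z.jump t y) t)) := fun y => by
    rw [hga, pathMap_jump_stopped hf hΦ]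
  simp only [h1]
  have h2 : Φ (Z.jump t (Z t)) t = Φ Z t := by
    ext l
    rw [hΦ, hΦ, Z.jump_self, ← hf l]
  refine HasGradientAt.comp_vec (q := fun y => g t ((Φ Z).jump t y))
    (w := fun y => Φ (Z.jump t y) t) (H := pgrad g t (Φ Z)) (fun l => ?_) ?_
  · simp only [hΦ]
    have := (hfv l).hasGradientAt_jump hU t Z (Z.mem t)
    rwa [Z.jump_self, (hf l).pgrad_stopped hU] at this
  · have := hg.hasGradientAt_jump isOpen_univ t (Φ Z) (mem_univ (Φ Z t))
    rw [Cadlag.jump_self, hga.pgrad_stopped isOpen_univ] at this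
    rwa [h2]

theorem VertDiff.comp_pathMap (hU : IsOpen U) (hg : VertDiff g) (hga : Adapted g)
    (hf : ∀ l, IsRegular (f l)) (hΦ : ∀ Z t l, Φ Z t l = f l t Z) :
    VertDiff fun t Z => g t (Φ Z) := fun t Z =>
  (hg.hasGradientAt_comp_pathMap hU hga (fun l => (hf l).adapted) (fun l => (hf l).vdiff) hΦ
    t Z).differentiableAt

theorem VertDiff.pgrad_comp_pathMap (hU : IsOpen U) (hg : VertDiff g) (hga : Adapted g)
    (hf : ∀ l, IsRegular (f l)) (hΦ : ∀ Z t l, Φ Z t l = f l t Z) :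
    pgrad (fun t Z => g t (Φ Z)) = fun t Z => ∑ l, ppartial l g t (Φ Z) • pgrad (f l) t Z := by
  funext t Z
  exact (hg.hasGradientAt_comp_pathMap hU hga (fun l => (hf l).adapted) (fun l => (hf l).vdiff)
    hΦ t Z).gradient

theorem VertDiff.ppartial_comp_pathMap (hU : IsOpen U) (hg : VertDiff g) (hga : Adapted g)
    (hf : ∀ l, IsRegular (f l)) (hΦ : ∀ Z t l, Φ Z t l = f l t Z) (j : Fin d) :
    ppartial j (fun t Z => g t (Φ Z)) =
      fun t Z => ∑ l, ppartial l g t (Φ Z) * ppartial j (f l) t Z := by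
  funext t Z
  rw [ppartial, hg.pgrad_comp_pathMap hU hga hf hΦ]
  simp [ppartial]

theorem IsRegular.ppartial_ppartial_comp_pathMap (hU : IsOpen U) (hg : IsRegular g)
    (hf : ∀ l, IsRegular (f l)) (hΦ : ∀ Z t l, Φ Z t l = f l t Z) (i j : Fin d) :
    ppartial i (ppartial j (fun t Z => g t (Φ Z))) = fun t Z =>
      ∑ l, (ppartial l g t (Φ Z) * ppartial i (ppartial j (f l)) t Z + ppartial j (f l) t Z *
        ∑ k, ppartial k (ppartial l g) t (Φ Z) * ppartial i (f k) t Z) := by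
  have hga : ∀ l, Adapted (ppartial l g) := fun l => hg.adapted.ppartial isOpen_univ l
  have hgv : ∀ l, VertDiff fun t Z => ppartial l g t (Φ Z) := fun l =>
    (hg.vdiff_two l).comp_pathMap hU (hga l) hf hΦ
  rw [hg.vdiff.ppartial_comp_pathMap hU hg.adapted hf hΦ,
    VertDiff.ppartial_sum fun l => (hgv l).mul ((hf l).vdiff_two j)]
  funext t Z
  refine Finset.sum_congr rfl fun l _ => ?_
  rw [(hgv l).ppartial_mul ((hf l).vdiff_two j),
    (hg.vdiff_two l).ppartial_comp_pathMap hU (hga l) hf hΦ]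

theorem IsRegular.comp_pathMap (hU : IsOpen U) (hg : IsRegular g) (hf : ∀ l, IsRegular (f l))
    (hΦ : ∀ Z t l, Φ Z t l = f l t Z) : IsRegular fun t Z => g t (Φ Z) := by
  have hga : ∀ l, Adapted (ppartial l g) := fun l => hg.adapted.ppartial isOpen_univ l
  refine ⟨hg.adapted.comp_pathMap (fun l => (hf l).adapted) hΦ, hg.leftCont.comp_pathMap hf hΦ,
    hg.unifCont.comp_pathMap (fun l => (hf l).unifCont) hΦ,
    hg.bddPres.comp_pathMap (fun l => (hf l).bddPres) hΦ,
    hg.vdiff.comp_pathMap hU hg.adapted hf hΦ, fun j => ?_, fun j => ?_, fun j => ?_,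
    fun i j => ?_, fun i j => ?_⟩
  · rw [hg.vdiff.ppartial_comp_pathMap hU hg.adapted hf hΦ]
    exact VertDiff.sum fun l =>
      ((hg.vdiff_two l).comp_pathMap hU (hga l) hf hΦ).mul ((hf l).vdiff_two j)
  · rw [hg.vdiff.ppartial_comp_pathMap hU hg.adapted hf hΦ]
    exact LeftCont.sum _ fun l _ =>
      ((hg.grad_leftCont l).comp_pathMap hf hΦ).mul ((hf l).grad_leftCont j)
  · rw [hg.vdiff.ppartial_comp_pathMap hU hg.adapted hf hΦ]
    exact BddPres.sum fun l => ((hg.grad_bddPres l).comp_pathMap (fun l => (hf l).bddPres) hΦ).mul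
      ((hf l).grad_bddPres j)
  · rw [hg.ppartial_ppartial_comp_pathMap hU hf hΦ]
    exact LeftCont.sum _ fun l _ => (((hg.grad_leftCont l).comp_pathMap hf hΦ).mul
      ((hf l).hess_leftCont i j)).add (((hf l).grad_leftCont j).mul (LeftCont.sum _ fun k _ =>
      ((hg.hess_leftCont k l).comp_pathMap hf hΦ).mul ((hf k).grad_leftCont i)))
  · rw [hg.ppartial_ppartial_comp_pathMap hU hf hΦ]
    have hfb := fun l => (hf l).bddPres
    exact BddPres.sum fun l => (((hg.grad_bddPres l).comp_pathMap hfb hΦ).mul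
      ((hf l).hess_bddPres i j)).add (((hf l).grad_bddPres j).mul (BddPres.sum fun k =>
      ((hg.hess_bddPres k l).comp_pathMap hfb hΦ).mul ((hf k).grad_bddPres i)))

end PathMaps


/-! ### Composition of flat functionals -/

section Composition

variable {T : ℝ} {d ν : ℕ} {U : Set (Vec d)} {μ : Measure (Time T)}

theorem LeftCont.isIntegrand (hT : 0 ≤ T) {φ : PathFun T U} (hφ : LeftCont φ) (ha : Adapted φ)
    (hb : BddPres φ) (μ : Measure (Time T)) [NullSingletonClass μ] : IsIntegrand μ φ :=
  ⟨ha, hb, hφ.fixedCont, fun X => hφ.aestronglyMeasurable hT X μ⟩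

theorem IsIntegrand.mul {φ ψ : PathFun T U} (hφ : IsIntegrand μ φ) (hψ : IsIntegrand μ ψ) :
    IsIntegrand μ fun t X => φ t X * ψ t X where
  adapted t X := by
    beta_reduce
    rw [← hφ.adapted, ← hψ.adapted]
  bddPres := hφ.bddPres.mul hψ.bddPres
  fixedCont t ht X := (hφ.fixedCont t ht X).mul (hψ.fixedCont t ht X)
  aesm X := (hφ.aesm X).mul (hψ.aesm X)

variable [NullSingletonClass μ] {ι : Type*} [Fintype ι] {ρ : ι → Time T → ℝ} {f : Fin ν → PathFun T U}
  {D : Fin ν → ι → PathFun T U} {Φ : Cadlag T U → Cadlag T (univ : Set (Vec ν))}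
  {h : PathFun T (univ : Set (Vec ν))}

/-- The composition of a flat functional `h` with `Φ Z = f(·,Z)`, corrected by the drift of `f`. -/
noncomputable def driftComp (μ : Measure (Time T)) (ρ : ι → Time T → ℝ)
    (D : Fin ν → ι → PathFun T U) (Φ : Cadlag T U → Cadlag T (univ : Set (Vec ν)))
    (h : PathFun T (univ : Set (Vec ν))) : PathFun T U := fun t Z =>
  h t (Φ Z) - ∑ l, ∑ i, ∫ r in Iic t, ppartial l h r (Φ Z) * D l i r Z * ρ i r ∂μ

theorem HasDrift.isIntegrand_comp (hD : HasDrift μ ρ f D) (hT : 0 ≤ T) (hh : IsFlat h)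
    (hΦ : ∀ Z t l, Φ Z t l = f l t Z) (l : Fin ν) (i : ι) :
    IsIntegrand μ fun t Z => ppartial l h t (Φ Z) * D l i t Z := by
  have hfb := fun l => (hD.regular l).bddPres
  exact (((hh.grad_leftCont l).comp_pathMap hD.regular hΦ).isIntegrand hT
    ((hh.adapted.ppartial isOpen_univ l).comp_pathMap (fun l => (hD.regular l).adapted) hΦ)
    ((hh.grad_bddPres l).comp_pathMap hfb hΦ) μ).mul (hD.integrand l i)

theorem HasDrift.isVertTrivial_comp (hD : HasDrift μ ρ f D) (hT : 0 ≤ T) (hU : IsOpen U)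
    (hh : IsFlat h) (hΦ : ∀ Z t l, Φ Z t l = f l t Z) :
    IsVertTrivial fun t (Z : Cadlag T U) =>
      ∑ l, ∑ i, ∫ r in Iic t, ppartial l h r (Φ Z) * D l i r Z * ρ i r ∂μ :=
  IsVertTrivial.sum _ fun l _ => IsVertTrivial.sum _ fun i _ =>
    (hD.isIntegrand_comp hT hh hΦ l i).isVertTrivial hU (hD.integrable i)

/-- From `s` on, the path `Φ (Z^s)` has the density prescribed by the drift, so the chain rule
computes the change of `h` along it; this is exactly what the correction subtracts. -/
theorem HasDrift.isFlat_driftComp (hD : HasDrift μ ρ f D) (hT : 0 ≤ T) (hU : IsOpen U)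
    (hh : IsFlat h) (hΦ : ∀ Z t l, Φ Z t l = f l t Z) : IsFlat (driftComp μ ρ D Φ h) := by
  refine ⟨(hh.toIsRegular.comp_pathMap hU hD.regular hΦ).sub
    (hD.isVertTrivial_comp hT hU hh hΦ), fun s t hst Z => ?_⟩
  have hc := hh.sub_eq_integral (fun l => hD.integrable_drift hU l (Z.stopped s))
    (Ψ := Φ (Z.stopped s)) (s := s) (fun l u v hsu huv => by
      rw [hΦ, hΦ, hD.sub_eq l s u v Z hsu huv]) hst
  have hint : ∀ l i, Integrable (fun r => ppartial l h r (Φ (Z.stopped s)) *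
      D l i r (Z.stopped s) * ρ i r) μ := fun l i =>
    (hD.isIntegrand_comp hT hh hΦ l i).integrable hU (hD.integrable i) (Z.stopped s)
  have hsum : h t (Φ (Z.stopped s)) - h s (Φ (Z.stopped s)) =
      ∑ l, ∑ i, ((∫ r in Iic t, ppartial l h r (Φ (Z.stopped s)) * D l i r (Z.stopped s) *
        ρ i r ∂μ) - ∫ r in Iic s, ppartial l h r (Φ (Z.stopped s)) * D l i r (Z.stopped s) *
        ρ i r ∂μ) := by
    rw [hc]
    refine Finset.sum_congr rfl fun l _ => ?_
    simp only [fun i => (hasLSDensity_integral_Iic (hint l i)).sub_eq s t hst]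
    rw [← integral_finsetSum _ fun i _ => (hint l i).integrableOn]
    refine integral_congr_ae (ae_of_all _ fun r => ?_)
    simp only [Finset.mul_sum, mul_assoc]
  simp only [Finset.sum_sub_distrib] at hsum
  unfold driftComp
  linarith

/-- The correction is insensitive to bumps, so only the vertical chain rule contributes. This
gradient is the integrand `ζ`. -/
theorem HasDrift.pgrad_driftComp (hD : HasDrift μ ρ f D) (hT : 0 ≤ T) (hU : IsOpen U)
    (hh : IsFlat h) (hΦ : ∀ Z t l, Φ Z t l = f l t Z) :
    pgrad (driftComp μ ρ D Φ h) =
      fun t Z => ∑ l, ppartial l h t (Φ Z) • pgrad (f l) t Z := by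
  rw [← hh.vdiff.pgrad_comp_pathMap hU hh.adapted hD.regular hΦ]
  exact pgrad_sub (hh.vdiff.comp_pathMap hU hh.adapted hD.regular hΦ)
    (hD.isVertTrivial_comp hT hU hh hΦ)

theorem HasDrift.ppartial_ppartial_driftComp (hD : HasDrift μ ρ f D) (hT : 0 ≤ T)
    (hU : IsOpen U) (hh : IsFlat h) (hΦ : ∀ Z t l, Φ Z t l = f l t Z) (i j : Fin d) :
    ppartial i (ppartial j (driftComp μ ρ D Φ h)) = fun t Z =>
      ∑ l, (ppartial l h t (Φ Z) * ppartial i (ppartial j (f l)) t Z + ppartial j (f l) t Z *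
        ∑ k, ppartial k (ppartial l h) t (Φ Z) * ppartial i (f k) t Z) := by
  rw [← hh.toIsRegular.ppartial_ppartial_comp_pathMap hU hD.regular hΦ]
  congr 1
  funext t Z
  rw [ppartial, ppartial, hD.pgrad_driftComp hT hU hh hΦ,
    hh.vdiff.pgrad_comp_pathMap hU hh.adapted hD.regular hΦ]
end Composition


/-! ### The drift of a pathwise Itô integral -/

section Drift

variable {T : ℝ} {d ν : ℕ} {U : Set (Vec d)} {μ : Measure (Time T)} [NullSingletonClass μ]

theorem LeftCont.integrable (hT : 0 ≤ T) (hU : IsOpen U) {φ : PathFun T U} (hφ : LeftCont φ)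
    (hb : BddPres φ) (X : Cadlag T U) {ρ : Time T → ℝ} (hρ : Integrable ρ μ) :
    Integrable (fun r => φ r X * ρ r) μ := by
  obtain ⟨C, hC⟩ := hb.exists_bound hU X
  exact integrable_bdd_mul (hφ.aestronglyMeasurable hT X μ) hC hρ

theorem LeftCont.lsIntegral_eq (hT : 0 ≤ T) (hU : IsOpen U) {φ : PathFun T U} (hφ : LeftCont φ)
    (hb : BddPres φ) (X : Cadlag T U) {a ρ : Time T → ℝ} (h : HasLSDensity a μ ρ)
    (ha : Continuous a) (hbv : BoundedVariationOn a univ) {B : Set (Time T)}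
    (hB : MeasurableSet B) :
    lsIntegral (fun r => φ r X) a B = ∫ r in B, φ r X * ρ r ∂μ := by
  obtain ⟨C, hC⟩ := hb.exists_bound hU X
  exact h.lsIntegral_eq ha hbv (hφ.aestronglyMeasurable hT X μ) hC hB

theorem setIntegral_Iic_zero (hT : 0 ≤ T) (ψ : Time T → ℝ) :
    ∫ r in Iic (⟨0, le_rfl, hT⟩ : Time T), ψ r ∂μ = 0 := by
  have h : Iic (⟨0, le_rfl, hT⟩ : Time T) = {⟨0, le_rfl, hT⟩} := by
    ext u
    exact ⟨fun h => le_antisymm h u.2.1, fun h => h.le⟩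
  rw [h]
  exact setIntegral_measure_zero _ (measure_singleton _)

theorem ae_eq_zero_of_setIntegral_Iic {ψ : Time T → ℝ} (hψ : Integrable ψ μ)
    (h : ∀ t, ∫ r in Iic t, ψ r ∂μ = 0) : ψ =ᵐ[μ] 0 := by
  refine Integrable.ae_eq_of_withDensityᵥ_eq hψ (integrable_zero _ _ _)
    (signedMeasure_ext_Icc fun s t hst => ?_)
  rw [withDensityᵥ_apply hψ measurableSet_Icc, withDensityᵥ_zero, integral_Icc_eq_integral_Ioc,
    ← (hasLSDensity_integral_Iic hψ).sub_eq s t hst, h, h, sub_zero]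
  rfl

variable {ι : Type*} [Fintype ι] {ρ : ι → Time T → ℝ} {f : Fin ν → PathFun T U}
  {D : Fin ν → ι → PathFun T U}

theorem HasDrift.isVertTrivial (hD : HasDrift μ ρ f D) (hU : IsOpen U) (l : Fin ν) :
    IsVertTrivial fun t (Z : Cadlag T U) => ∑ i, ∫ r in Iic t, D l i r Z * ρ i r ∂μ :=
  IsVertTrivial.sum _ fun i _ => (hD.integrand l i).isVertTrivial hU (hD.integrable i)

theorem HasDrift.isFlat_sub (hD : HasDrift μ ρ f D) (hU : IsOpen U) (l : Fin ν) :
    IsFlat fun t Z => f l t Z - ∑ i, ∫ r in Iic t, D l i r Z * ρ i r ∂μ := by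
  refine ⟨(hD.regular l).sub (hD.isVertTrivial hU l), fun s t hst Z => ?_⟩
  have hi := fun i => (hD.integrand l i).integrable hU (hD.integrable i) (Z.stopped s)
  have h := hD.sub_eq l s s t Z le_rfl hst
  rw [integral_finsetSum _ fun i _ => (hi i).integrableOn] at h
  simp only [← fun i => (hasLSDensity_integral_Iic (hi i)).sub_eq s t hst,
    Finset.sum_sub_distrib] at h
  linarith

theorem HasDrift.pgrad_sub (hD : HasDrift μ ρ f D) (hU : IsOpen U) (l : Fin ν) :
    pgrad (fun t Z => f l t Z - ∑ i, ∫ r in Iic t, D l i r Z * ρ i r ∂μ) = pgrad (f l) :=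
  PathwiseIto.pgrad_sub (hD.regular l).vdiff (hD.isVertTrivial hU l)

theorem IsC12c.hasDrift (hT : 0 ≤ T) (hU : IsOpen U) {q : ℕ} {S : Set (Vec q)}
    {F : Fin ν → Functional T U S} (hF : ∀ l, IsC12c (F l))
    {D : Fin ν → Fin (q + 1) → Functional T U S}
    (hD : ∀ l, IsHorizontalDerivative (F l) (D l))
    (hc : ∀ l i, ContinuousAtFixedTimes (D l i)) (A : CBV T S) {ρ : Fin (q + 1) → Time T → ℝ}
    (hρ : ∀ i, HasLSDensity (A.component i) μ (ρ i)) :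
    HasDrift μ ρ (fun l t Z => F l t Z A) (fun l i t Z => D l i t Z A) := by
  have hint := fun l i => (hD l).isIntegrand hT (hc l) A μ i
  refine ⟨fun l => (hF l).isRegular A, hint, fun i => (hρ i).integrable,
    fun l s u v Z hsu huv => ?_⟩
  have hflat := ((hF l).isFlat_sub hT hU (hD l) (hc l) A hρ).2.flat s
  have h1 := hflat u hsu Z
  have h2 := hflat v (hsu.trans huv) Z
  have hi := fun i => (hint l i).integrable hU (hρ i).integrable (Z.stopped s)
  rw [integral_finsetSum _ fun i _ => (hi i).integrableOn]
  simp only [← fun i => (hasLSDensity_integral_Iic (hi i)).sub_eq u v huv,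
    Finset.sum_sub_distrib]
  linarith

variable {P : ℕ → Finset (Time T)} {X : CPath T U} {Q : Fin d → Fin d → Time T → ℝ}
  {κ : Fin d → Fin d → Time T → ℝ}

/-- The Itô formula in terms of densities. -/
theorem IsFlat.hasItoIntegral_density (hT : 0 < T) (hU : IsOpen U) (hP : IsRefiningPartition P)
    {f : PathFun T U} (hf : IsFlat f) (hQ : HasQVMatrix P X Q)
    (hκ : ∀ i j, HasLSDensity (Q i j) μ (κ i j)) (t : Time T) :
    HasItoIntegral P (pgrad f) X t (f t X.toCadlag - f ⟨0, le_rfl, hT.le⟩ X.toCadlag -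
      ∫ r in Iic t, (1 / 2) * ∑ i, ∑ j, ppartial i (ppartial j f) r X.toCadlag * κ i j r ∂μ) := by
  have hi : ∀ i j, Integrable (fun r => ppartial i (ppartial j f) r X.toCadlag * κ i j r) μ :=
    fun i j => (hf.hess_leftCont i j).integrable hT.le hU (hf.hess_bddPres i j) _
      (hκ i j).integrable
  convert hf.hasItoIntegral hT hU hP hQ t using 1
  rw [integral_const_mul, integral_finsetSum _ fun i _ =>
    (integrable_finsetSum _ fun j _ => hi i j).integrableOn]
  congr 2
  refine Finset.sum_congr rfl fun i _ => ?_
  rw [integral_finsetSum _ fun j _ => (hi i j).integrableOn]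
  exact Finset.sum_congr rfl fun j _ => ((hf.hess_leftCont i j).lsIntegral_eq hT.le hU
    (hf.hess_bddPres i j) _ (hκ i j) (hQ.continuous i j) (hQ.boundedVariationOn i j)
    measurableSet_Iic).symm

/-- If `f(·,X)` is the pathwise Itô integral of `∇f` along `X`, then the drift of `f` compensates
the second-order term of Itô's formula. -/
theorem HasDrift.drift_ae_eq_zero (hD : HasDrift μ ρ f D) (hT : 0 < T) (hU : IsOpen U)
    (hP : IsRefiningPartition P) (hQ : HasQVMatrix P X Q)
    (hκ : ∀ i j, HasLSDensity (Q i j) μ (κ i j)) (l : Fin ν)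
    (hY : ∀ t, HasItoIntegral P (pgrad (f l)) X t (f l t X.toCadlag)) :
    ∀ᵐ r ∂μ, ∑ i, D l i r X.toCadlag * ρ i r + (1 / 2) * ∑ i, ∑ j,
      ppartial i (ppartial j (f l)) r X.toCadlag * κ i j r = 0 := by
  have hflat := hD.isFlat_sub hU l
  have hpp : ∀ i j, ppartial i (ppartial j fun t Z => f l t Z -
      ∑ i, ∫ r in Iic t, D l i r Z * ρ i r ∂μ) = ppartial i (ppartial j (f l)) := fun i j => by
    congr 1
    unfold ppartial
    rw [hD.pgrad_sub hU l]
  have hreg := hD.regular l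
  have i1 := hD.integrable_drift hU l X.toCadlag
  have i2 : Integrable (fun r => (1 / 2) * ∑ i, ∑ j,
      ppartial i (ppartial j (f l)) r X.toCadlag * κ i j r) μ :=
    (integrable_finsetSum _ fun i _ => integrable_finsetSum _ fun j _ =>
      (hreg.hess_leftCont i j).integrable hT.le hU (hreg.hess_bddPres i j) _
        (hκ i j).integrable).const_mul _
  have hd : ∀ t, ∑ i, ∫ r in Iic t, D l i r X.toCadlag * ρ i r ∂μ =
      ∫ r in Iic t, ∑ i, D l i r X.toCadlag * ρ i r ∂μ := fun t =>
    (integral_finsetSum _ fun i _ =>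
      ((hD.integrand l i).integrable hU (hD.integrable i) _).integrableOn).symm
  have key : ∀ t, f l ⟨0, le_rfl, hT.le⟩ X.toCadlag +
      ∫ r in Iic t, (∑ i, D l i r X.toCadlag * ρ i r + (1 / 2) * ∑ i, ∑ j,
        ppartial i (ppartial j (f l)) r X.toCadlag * κ i j r) ∂μ = 0 := by
    intro t
    have h1 := hflat.hasItoIntegral_density hT hU hP hQ hκ t
    simp only [hpp, hD.pgrad_sub hU l] at h1
    have h2 := tendsto_nhds_unique (hY t) h1
    simp only [hd] at h2
    rw [setIntegral_Iic_zero hT.le] at h2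
    rw [integral_add i1.integrableOn i2.integrableOn]
    linarith
  -- At time `0` the integral vanishes, so the initial value of `f l` along `X` is zero; then all
  -- integrals over `[0,t]` vanish, and so does the density.
  have h0 := key ⟨0, le_rfl, hT.le⟩
  rw [setIntegral_Iic_zero hT.le, add_zero] at h0
  simp only [h0, zero_add] at key
  exact ae_eq_zero_of_setIntegral_Iic (i1.add i2) key

variable {h : PathFun T (univ : Set (Vec ν))} {Y : CPath T (univ : Set (Vec ν))}
  {Φ : Cadlag T U → Cadlag T (univ : Set (Vec ν))}

/-- Associativity of the pathwise Itô integral. -/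
theorem HasDrift.exists_hasItoIntegral (hD : HasDrift μ ρ f D) (hT : 0 < T) (hU : IsOpen U)
    (hP : IsRefiningPartition P) (hQ : HasQVMatrix P X Q)
    (hκ : ∀ i j, HasLSDensity (Q i j) μ (κ i j))
    (hY : ∀ l t, HasItoIntegral P (pgrad (f l)) X t (f l t X.toCadlag))
    (hΦ : ∀ Z t l, Φ Z t l = f l t Z) (hΦX : Φ X.toCadlag = Y.toCadlag) (hh : IsFlat h)
    (hQY : HasQVMatrix P Y fun k l t => ∑ i, ∑ j, lsIntegral (fun s =>
      ppartial i (f k) s X.toCadlag * ppartial j (f l) s X.toCadlag) (Q i j) (Iic t))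
    (t : Time T) :
    ∃ I, HasItoIntegral P (pgrad h) Y t I ∧ HasItoIntegral P (pgrad (driftComp μ ρ D Φ h)) X t I := by
  have hreg := hD.regular
  have igg : ∀ k l i j, Integrable (fun r => ppartial i (f k) r X.toCadlag *
      ppartial j (f l) r X.toCadlag * κ i j r) μ := fun k l i j =>
    (((hreg k).grad_leftCont i).mul ((hreg l).grad_leftCont j)).integrable hT.le hU
      (((hreg k).grad_bddPres i).mul ((hreg l).grad_bddPres j)) X.toCadlag (hκ i j).integrable
  have iκ : ∀ k l, Integrable (fun r => ∑ i, ∑ j, ppartial i (f k) r X.toCadlag *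
      ppartial j (f l) r X.toCadlag * κ i j r) μ := fun k l =>
    integrable_finsetSum _ fun i _ => integrable_finsetSum _ fun j _ => igg k l i j
  -- The assumed formula for the covariations of `Y` provides their densities with respect to the
  -- same `μ`.
  have hκY : ∀ k l, HasLSDensity (fun t => ∑ i, ∑ j, lsIntegral (fun s =>
      ppartial i (f k) s X.toCadlag * ppartial j (f l) s X.toCadlag) (Q i j) (Iic t)) μ
      (fun r => ∑ i, ∑ j, ppartial i (f k) r X.toCadlag *
        ppartial j (f l) r X.toCadlag * κ i j r) := by
    intro k l
    have e : (fun t => ∑ i, ∑ j, lsIntegral (fun s =>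
        ppartial i (f k) s X.toCadlag * ppartial j (f l) s X.toCadlag) (Q i j) (Iic t)) =
        fun t => ∫ r in Iic t, ∑ i, ∑ j, ppartial i (f k) r X.toCadlag *
          ppartial j (f l) r X.toCadlag * κ i j r ∂μ := by
      funext t
      rw [integral_finsetSum _ fun i _ =>
        (integrable_finsetSum _ fun j _ => igg k l i j).integrableOn]
      refine Finset.sum_congr rfl fun i _ => ?_
      rw [integral_finsetSum _ fun j _ => (igg k l i j).integrableOn]
      exact Finset.sum_congr rfl fun j _ =>
        (((hreg k).grad_leftCont i).mul ((hreg l).grad_leftCont j)).lsIntegral_eq hT.le hU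
        (((hreg k).grad_bddPres i).mul ((hreg l).grad_bddPres j)) X.toCadlag (hκ i j)
        (hQ.continuous i j) (hQ.boundedVariationOn i j) measurableSet_Iic
    rw [e]
    exact hasLSDensity_integral_Iic (iκ k l)
  have h1 := hh.hasItoIntegral_density hT isOpen_univ hP hQY hκY t
  have hflat := hD.isFlat_driftComp hT.le hU hh hΦ
  have h2 := hflat.hasItoIntegral_density hT hU hP hQ hκ t
  -- Both integrals exist by Itô's formula, applied to `h` along `Y` and to the corrected
  -- composition along `X`. It remains to identify the limits, that is, their integrands almost
  -- everywhere.
  refine ⟨_, h1, ?_⟩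
  convert h2 using 1
  have i1 : ∀ l i, Integrable (fun r => ppartial l h r (Φ X.toCadlag) *
      D l i r X.toCadlag * ρ i r) μ := fun l i =>
    (hD.isIntegrand_comp hT.le hh hΦ l i).integrable hU (hD.integrable i) X.toCadlag
  have i2 : Integrable (fun r => (1 / 2) * ∑ i, ∑ j,
      ppartial i (ppartial j (driftComp μ ρ D Φ h)) r X.toCadlag * κ i j r) μ :=
    (integrable_finsetSum _ fun i _ => integrable_finsetSum _ fun j _ =>
      (hflat.hess_leftCont i j).integrable hT.le hU (hflat.hess_bddPres i j) _
        (hκ i j).integrable).const_mul _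
  have e1 : ∀ t, driftComp μ ρ D Φ h t X.toCadlag = h t Y.toCadlag -
      ∫ r in Iic t, ∑ l, ∑ i, ppartial l h r (Φ X.toCadlag) * D l i r X.toCadlag * ρ i r ∂μ := by
    intro t
    rw [driftComp, hΦX]
    congr 1
    rw [← hΦX, integral_finsetSum _ fun l _ =>
      (integrable_finsetSum _ fun i _ => i1 l i).integrableOn]
    refine Finset.sum_congr rfl fun l _ => ?_
    rw [integral_finsetSum _ fun i _ => (i1 l i).integrableOn]
  have i3 : Integrable (fun r => ∑ l, ∑ i, ppartial l h r (Φ X.toCadlag) *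
      D l i r X.toCadlag * ρ i r) μ :=
    integrable_finsetSum _ fun l _ => integrable_finsetSum _ fun i _ => i1 l i
  rw [e1, e1, setIntegral_Iic_zero hT.le, sub_zero]
  suffices hmain : ∫ r in Iic t, (1 / 2) * ∑ k, ∑ l, ppartial k (ppartial l h) r Y.toCadlag *
      (∑ i, ∑ j, ppartial i (f k) r X.toCadlag * ppartial j (f l) r X.toCadlag * κ i j r) ∂μ =
      ∫ r in Iic t, ((∑ l, ∑ i, ppartial l h r (Φ X.toCadlag) * D l i r X.toCadlag * ρ i r) +
      (1 / 2) * ∑ i, ∑ j,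
        ppartial i (ppartial j (driftComp μ ρ D Φ h)) r X.toCadlag * κ i j r) ∂μ by
    rw [integral_add i3.integrableOn i2.integrableOn] at hmain
    linarith
  refine integral_congr_ae (ae_restrict_of_ae ?_)
  filter_upwards [eventually_all.2 fun l => hD.drift_ae_eq_zero hT hU hP hQ hκ l (hY l)] with r hr
  simp only [hD.ppartial_ppartial_driftComp hT.le hU hh hΦ, hΦX]
  have hz : ∑ l, ppartial l h r Y.toCadlag * (∑ i, D l i r X.toCadlag * ρ i r + (1 / 2) *
      ∑ i, ∑ j, ppartial i (ppartial j (f l)) r X.toCadlag * κ i j r) = 0 :=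
    Finset.sum_eq_zero fun l _ => by rw [hr l, mul_zero]
  simp only [mul_add, Finset.sum_add_distrib] at hz
  have s1 : ∑ l, ppartial l h r Y.toCadlag * ∑ i, D l i r X.toCadlag * ρ i r =
      ∑ l, ∑ i, ppartial l h r Y.toCadlag * D l i r X.toCadlag * ρ i r := by
    simp only [Finset.mul_sum, mul_assoc]
  -- The Hessian of a composition has a part with the Hessians of the `f l`, cancelled by the drift
  -- through `hz`, and a part with the Hessian of `h`, contracted with the densities of the
  -- covariations of `Y`.
  have s2 : ∑ i, ∑ j, (∑ l, (ppartial l h r Y.toCadlag *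
      ppartial i (ppartial j (f l)) r X.toCadlag + ppartial j (f l) r X.toCadlag *
        ∑ k, ppartial k (ppartial l h) r Y.toCadlag * ppartial i (f k) r X.toCadlag)) * κ i j r =
      ∑ l, ppartial l h r Y.toCadlag * (∑ i, ∑ j,
        ppartial i (ppartial j (f l)) r X.toCadlag * κ i j r) +
      ∑ k, ∑ l, ppartial k (ppartial l h) r Y.toCadlag * (∑ i, ∑ j,
        ppartial i (f k) r X.toCadlag * ppartial j (f l) r X.toCadlag * κ i j r) := by
    have t1 : ∀ i j, (∑ l, (ppartial l h r Y.toCadlag *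
      ppartial i (ppartial j (f l)) r X.toCadlag + ppartial j (f l) r X.toCadlag *
        ∑ k, ppartial k (ppartial l h) r Y.toCadlag * ppartial i (f k) r X.toCadlag)) * κ i j r =
        ∑ l, ppartial l h r Y.toCadlag * (ppartial i (ppartial j (f l)) r X.toCadlag * κ i j r) +
        ∑ k, ∑ l, ppartial k (ppartial l h) r Y.toCadlag *
          (ppartial i (f k) r X.toCadlag * ppartial j (f l) r X.toCadlag * κ i j r) := by
      intro i j
      rw [Finset.sum_comm (s := Finset.univ (α := Fin ν)) (t := Finset.univ (α := Fin ν)),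
        ← Finset.sum_add_distrib, Finset.sum_mul]
      refine Finset.sum_congr rfl fun l _ => ?_
      rw [Finset.mul_sum, add_mul, Finset.sum_mul]
      congr 1
      · ring
      · exact Finset.sum_congr rfl fun k _ => by ring
    simp only [t1]
    simp only [Finset.sum_add_distrib, Finset.mul_sum]
    congr 1
    · rw [Finset.sum_congr rfl fun i _ => Finset.sum_comm, Finset.sum_comm]
    · have c1 : ∀ g : Fin d → Fin d → Fin ν → Fin ν → ℝ,
          ∑ i, ∑ j, ∑ k, ∑ l, g i j k l = ∑ k, ∑ l, ∑ i, ∑ j, g i j k l := fun g => by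
        rw [Finset.sum_congr rfl fun i _ => Finset.sum_comm, Finset.sum_comm]
        refine Finset.sum_congr rfl fun k _ => ?_
        rw [Finset.sum_congr rfl fun i _ => Finset.sum_comm, Finset.sum_comm]
      exact c1 _
  rw [s2, ← s1]
  have s3 : ∑ l, ppartial l h r Y.toCadlag * ((1 / 2) * ∑ i, ∑ j,
      ppartial i (ppartial j (f l)) r X.toCadlag * κ i j r) = (1 / 2) *
      ∑ l, ppartial l h r Y.toCadlag * (∑ i, ∑ j,
        ppartial i (ppartial j (f l)) r X.toCadlag * κ i j r) := by
    rw [Finset.mul_sum]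
    exact Finset.sum_congr rfl fun l _ => by ring
  rw [s3] at hz
  linarith

end Drift


/-! ### The pathwise Itô integral as a functional -/

section ItoFunctional

variable {T : ℝ} {d ν : ℕ} {U : Set (Vec d)}

/-- Left-continuity holds because `X` has no jumps; right-continuity comes from the càdlàg image
path. -/
theorem HasDrift.continuous_path {ι : Type*} [Fintype ι] {μ : Measure (Time T)}
    [NullSingletonClass μ] {ρ : ι → Time T → ℝ} {f : Fin ν → PathFun T U}
    {D : Fin ν → ι → PathFun T U} (hD : HasDrift μ ρ f D) (hU : IsOpen U) (X : CPath T U)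
    (l : Fin ν) : Continuous fun t => f l t X.toCadlag := by
  obtain ⟨Φ, hΦ⟩ := hD.exists_pathMap hU
  refine continuous_iff_continuousAt.2 fun t => continuousAt_iff_continuous_left_right.2 ⟨?_, ?_⟩
  · rcases t.2.1.eq_or_lt with ht | ht
    · have : Iic t = {t} := by
        ext u
        refine ⟨fun h => le_antisymm h ?_, fun h => h.le⟩
        change (t : ℝ) ≤ u
        rw [← ht]
        exact u.2.1
      rw [this]
      exact continuousWithinAt_singleton
    · exact ((hD.regular l).leftCont t ht X.toCadlag).comp
        (tendsto_nhdsLeft_of_continuousAt X.toCadlag X.cont.continuousAt)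
  · have h1 := (EuclideanSpace.proj (𝕜 := ℝ) l).continuous.continuousAt.comp_continuousWithinAt
      ((Φ X.toCadlag).right_cont t)
    refine h1.congr (fun u _ => ?_) ?_
    · exact (hΦ _ _ _).symm
    · exact (hΦ _ _ _).symm

/-- Flat functionals are those with empty drift, so results on drifts apply to them. -/
theorem hasDrift_of_isFlat {f : Fin ν → PathFun T U} (hf : ∀ l, IsFlat (f l))
    (μ : Measure (Time T)) :
    HasDrift μ (fun (_ : Empty) _ => 0) f fun _ i => i.elim where
  regular l := (hf l).toIsRegular
  integrand _ i := i.elim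
  integrable i := i.elim
  sub_eq l s u v Z hsu huv := by
    rw [(hf l).flat s u hsu, (hf l).flat s v (hsu.trans huv)]
    simp

/-- The second vertical derivative, indexed by `Fin (d * d)`. -/
noncomputable def hessEntry (f : PathFun T U) (p : Fin (d * d)) : PathFun T U :=
  ppartial (finProdFinEquiv.symm p).1 (ppartial (finProdFinEquiv.symm p).2 f)

/-- The functional `f(t,Z) - c - ½ ∑ ∫₀ᵗ ∂_i ∂_j f(r,Z) dB_{ij}(r)`. -/
noncomputable def itoFunctional (f : PathFun T U) (c : ℝ) :
    Functional T U (univ : Set (Vec (d * d))) := fun t Z B =>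
  f t Z - c - (1 / 2) * ∑ p, lsIntegral (fun r => hessEntry f p r Z) (fun r => B r p) (Iic t)

/-- The horizontal derivative of `itoFunctional f c`. It vanishes at time `0`, where the second
vertical derivative of `f` need not be continuous. -/
noncomputable def itoHorizontal (f : PathFun T U) :
    Fin (d * d + 1) → Functional T U (univ : Set (Vec (d * d))) :=
  Fin.cons (fun _ _ _ => 0) fun p r Z _ =>
    (Ioi (0 : ℝ)).indicator (fun _ => -(1 / 2) * hessEntry f p r Z) (r : ℝ)

theorem CBV.exists_density {m : ℕ} {S : Set (Vec m)} (B : CBV T S) :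
    ∃ (μ : Measure (Time T)) (ρ : Fin m → Time T → ℝ), NullSingletonClass μ ∧
      ∀ p, HasLSDensity (fun r => B r p) μ (ρ p) := by
  obtain ⟨μ, ρ, _, hμ, h⟩ := exists_hasLSDensity B.component B.continuous_component
    B.boundedVariationOn_component
  exact ⟨μ, fun p => ρ p.succ, hμ, fun p => h p.succ⟩

theorem CBV.continuous_coord {m : ℕ} {S : Set (Vec m)} (B : CBV T S) (p : Fin m) :
    Continuous fun r => B r p := B.continuous_component p.succ

variable {f : PathFun T U}

theorem IsRegular.lsIntegral_hessEntry {μ : Measure (Time T)} [NullSingletonClass μ]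
    (hT : 0 ≤ T) (hU : IsOpen U) (hf : IsRegular f) (Z : Cadlag T U)
    {B : CBV T (univ : Set (Vec (d * d)))} {p : Fin (d * d)} {ρ : Time T → ℝ}
    (hρ : HasLSDensity (fun r => B r p) μ ρ) (t : Time T) :
    lsIntegral (fun r => hessEntry f p r Z) (fun r => B r p) (Iic t) =
      ∫ r in Iic t, hessEntry f p r Z * ρ r ∂μ :=
  (hf.hess_leftCont _ _).lsIntegral_eq hT hU (hf.hess_bddPres _ _) Z hρ (B.continuous_coord p)
    (B.bv p) measurableSet_Iic

theorem IsRegular.hessEntry_adapted (hU : IsOpen U) (hf : IsRegular f) (p : Fin (d * d)) :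
    Adapted (hessEntry f p) := (hf.adapted.ppartial hU _).ppartial hU _

theorem IsRegular.nonAnticipative_itoFunctional (hT : 0 ≤ T) (hU : IsOpen U) (hf : IsRegular f)
    (c : ℝ) : NonAnticipative (itoFunctional f c) := by
  intro t Z B
  obtain ⟨μ, ρ, _, hρ⟩ := B.exists_density
  unfold itoFunctional
  rw [← hf.adapted]
  congr 2
  refine Finset.sum_congr rfl fun p _ => ?_
  have hst : HasLSDensity (fun r => B.stopped t r p) μ ((Iic t).indicator (ρ p)) :=
    (hρ p).stopped t
  rw [hf.lsIntegral_hessEntry hT hU Z (hρ p), hf.lsIntegral_hessEntry hT hU _ hst]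
  refine setIntegral_congr_fun measurableSet_Iic fun r hr => ?_
  simp only [(hf.hessEntry_adapted hU p).eq_stopped (mem_Iic.1 hr), indicator_of_mem hr]

theorem IsRegular.itoFunctional_slice (hT : 0 ≤ T) (hU : IsOpen U) (hf : IsRegular f)
    (c : ℝ) (B : CBV T (univ : Set (Vec (d * d)))) :
    ∃ J : PathFun T U, IsVertTrivial J ∧
      (fun t Z => itoFunctional f c t Z B) = fun t Z => f t Z - J t Z := by
  obtain ⟨μ, ρ, _, hρ⟩ := B.exists_density
  -- The index `none` carries the constant `c`, so one finite sum of vertically trivial terms covers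
  -- everything subtracted.
  refine ⟨fun t Z => ∑ o : Option (Fin (d * d)), o.elim c fun p =>
    ∫ r in Iic t, hessEntry f p r Z * ((1 / 2) * ρ p r) ∂μ, ?_, ?_⟩
  · refine IsVertTrivial.sum (J := fun (o : Option (Fin (d * d))) t Z => o.elim c fun p =>
      ∫ r in Iic t, hessEntry f p r Z * ((1 / 2) * ρ p r) ∂μ) _ fun o _ => ?_
    cases o with
    | none => exact IsVertTrivial.const c
    | some p =>
      exact ((hf.hess_leftCont _ _).isIntegrand hT (hf.hessEntry_adapted hU p)
        (hf.hess_bddPres _ _) μ).isVertTrivial hU ((hρ p).integrable.const_mul _)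
  · funext t Z
    simp only [itoFunctional, Fintype.sum_option, Option.elim, Finset.mul_sum]
    rw [← sub_sub]
    congr 1
    refine Finset.sum_congr rfl fun p _ => ?_
    rw [hf.lsIntegral_hessEntry hT hU Z (hρ p), ← integral_const_mul]
    exact integral_congr_ae (ae_of_all _ fun r => by ring)

/-- Along a stopped path `f` does not change, so the horizontal increments come only from the
integrals of the Hessian. -/
theorem IsFlat.isHorizontalDerivative_itoFunctional (hT : 0 ≤ T) (hU : IsOpen U) (hf : IsFlat f)
    (c : ℝ) : IsHorizontalDerivative (itoFunctional f c) (itoHorizontal f) where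
  nonAnticipative i := by
    refine Fin.cases (fun _ _ _ => rfl) (fun p t Z B => ?_) i
    simp only [itoHorizontal, Fin.cons_succ]
    rw [← hf.toIsRegular.hessEntry_adapted hU p]
  boundednessPreserving i := by
    refine Fin.cases (fun _ _ _ _ => ⟨0, fun _ _ _ => by simp [itoHorizontal]⟩)
      (fun p B K hK hKU => ?_) i
    obtain ⟨C, hC⟩ := hf.hess_bddPres (finProdFinEquiv.symm p).1 (finProdFinEquiv.symm p).2 K hK hKU
    refine ⟨C, fun t Z hZ => ?_⟩
    have h1 : |hessEntry f p t Z| ≤ C := hC t Z hZ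
    have h2 := (abs_nonneg _).trans h1
    simp only [itoHorizontal, Fin.cons_succ]
    refine (norm_indicator_le_norm_self (fun _ : ℝ => -(1 / 2) * hessEntry f p t Z) _).trans ?_
    rw [norm_mul, Real.norm_eq_abs, Real.norm_eq_abs, abs_neg, abs_of_pos (by norm_num)]
    linarith
  measurable i s t hst Z B := by
    classical
    refine Fin.cases measurable_const (fun p => ?_) i
    have h1 := (hf.hess_leftCont (finProdFinEquiv.symm p).1
      (finProdFinEquiv.symm p).2).measurable_stopped hT Z s
    -- Measurability along `X^s` is known only after `s`; the endpoint `r = s` is patched with its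
    -- own value.
    have h2 : Measurable fun r : Time T => if s < r then -(1 / 2) * (if s < r then
        hessEntry f p r (Z.stopped s) else 0) else
        itoHorizontal f p.succ s (Z.stopped s) B :=
      Measurable.ite measurableSet_Ioi (h1.const_mul _) measurable_const
    convert h2.comp (measurable_subtype_coe (p := (· ∈ Icc s t))) using 1
    funext r
    simp only [Function.comp]
    rcases (mem_Icc.1 r.2).1.eq_or_lt with h | h
    · rw [if_neg (by rw [← h]; exact lt_irrefl s), ← h]
    · rw [if_pos h, if_pos h]
      simp only [itoHorizontal, Fin.cons_succ]
      rw [indicator_of_mem]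
      exact s.2.1.trans_lt h
  integral_eq s t hst Z B := by
    obtain ⟨μ, ρ, _, hρ⟩ := B.exists_density
    have hreg := hf.toIsRegular
    rw [Fin.sum_univ_succ]
    have h0 : lsIntegral (fun r : Time T => itoHorizontal f 0 r (Z.stopped s) B) (B.component 0)
        (Ioc s t) = 0 := lsIntegral_zero _ _
    have hH : ∀ p : Fin (d * d), Integrable (fun r => hessEntry f p r (Z.stopped s) * ρ p r) μ :=
      fun p => (hreg.hess_leftCont _ _).integrable hT hU (hreg.hess_bddPres _ _) _
        (hρ p).integrable
    have hp : ∀ p : Fin (d * d), lsIntegral (fun r : Time T =>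
        itoHorizontal f p.succ r (Z.stopped s) B) (B.component p.succ) (Ioc s t) =
        -(1 / 2) * ((∫ r in Iic t, hessEntry f p r (Z.stopped s) * ρ p r ∂μ) -
          ∫ r in Iic s, hessEntry f p r (Z.stopped s) * ρ p r ∂μ) := by
      intro p
      have hbd : BddPres (hessEntry f p) := hreg.hess_bddPres _ _
      obtain ⟨C, hC⟩ := hbd.exists_bound hU (Z.stopped s)
      have hm : AEStronglyMeasurable (fun r : Time T =>
          itoHorizontal f p.succ r (Z.stopped s) B) μ := by
        have h1 := ((hreg.hess_leftCont (finProdFinEquiv.symm p).1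
          (finProdFinEquiv.symm p).2).aestronglyMeasurable hT (Z.stopped s) μ).const_mul (-(1 / 2))
        refine h1.congr ?_
        filter_upwards [ae_pos μ] with r hr
        simp only [itoHorizontal, Fin.cons_succ]
        rw [indicator_of_mem (mem_Ioi.2 hr)]
        rfl
      have hb : ∀ r : Time T, |itoHorizontal f p.succ r (Z.stopped s) B| ≤ C := by
        intro r
        have h2 := (abs_nonneg _).trans (hC r)
        simp only [itoHorizontal, Fin.cons_succ]
        refine (norm_indicator_le_norm_self
          (fun _ : ℝ => -(1 / 2) * hessEntry f p r (Z.stopped s)) _).trans ?_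
        rw [norm_mul, Real.norm_eq_abs, Real.norm_eq_abs, abs_neg, abs_of_pos (by norm_num)]
        linarith [hC r]
      have hcomp : HasLSDensity (B.component p.succ) μ (ρ p) := hρ p
      rw [hcomp.lsIntegral_eq (B.continuous_component _) (B.boundedVariationOn_component _) hm hb
        measurableSet_Ioc, (hasLSDensity_integral_Iic (hH p)).sub_eq s t hst.le,
        ← integral_const_mul]
      refine setIntegral_congr_fun measurableSet_Ioc fun r hr => ?_
      simp only [itoHorizontal, Fin.cons_succ]
      rw [indicator_of_mem (mem_Ioi.2 (s.2.1.trans_lt hr.1))]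
      ring
    rw [h0, zero_add]
    simp only [hp]
    unfold itoFunctional
    simp only [fun p u => hreg.lsIntegral_hessEntry hT hU (Z.stopped s) (hρ p) u]
    rw [hf.flat s t hst.le, ← Finset.mul_sum, Finset.sum_sub_distrib]
    ring

theorem IsRegular.continuousAtFixedTimes_itoHorizontal (hf : IsRegular f)
    (i : Fin (d * d + 1)) : ContinuousAtFixedTimes (itoHorizontal f i) := by
  refine continuousAtFixedTimes_iff.2 fun t Z B => ?_
  refine Fin.cases tendsto_const_nhds (fun p => ?_) i
  simp only [itoHorizontal, Fin.cons_succ]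
  by_cases ht : 0 < (t : ℝ)
  · simp only [indicator_of_mem (mem_Ioi.2 ht)]
    exact ((hf.hess_leftCont _ _).fixedCont t ht Z).const_mul _
  · simp only [indicator_of_notMem (show (t : ℝ) ∉ Ioi 0 from ht)]
    exact tendsto_const_nhds

theorem IsFlat.isC12c_itoFunctional (hT : 0 ≤ T) (hU : IsOpen U) (hf : IsFlat f) (c : ℝ) :
    IsC12c (itoFunctional f c) := by
  refine isC12c_of_slices (hf.nonAnticipative_itoFunctional hT hU c) (fun B => ?_)
    ⟨itoHorizontal f, hf.isHorizontalDerivative_itoFunctional hT hU c,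
      hf.continuousAtFixedTimes_itoHorizontal⟩
  obtain ⟨J, hJ, h⟩ := hf.itoFunctional_slice hT hU c B
  rw [h]
  exact hf.sub hJ

theorem IsRegular.vgrad_itoFunctional (hT : 0 ≤ T) (hU : IsOpen U) (hf : IsRegular f) (c : ℝ)
    (t : Time T) (Z : Cadlag T U) (B : CBV T (univ : Set (Vec (d * d)))) :
    vgrad (itoFunctional f c) t Z B = pgrad f t Z := by
  obtain ⟨J, hJ, h⟩ := hf.itoFunctional_slice hT hU c B
  rw [vgrad_eq_pgrad (hf.nonAnticipative_itoFunctional hT hU c).stopped_right, h,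
    pgrad_sub hf.vdiff hJ]

variable {P : ℕ → Finset (Time T)} {X : CPath T U} {Q : Fin d → Fin d → Time T → ℝ}

/-- The quadratic variation as a path of bounded variation. -/
noncomputable def HasQVMatrix.toCBV (hQ : HasQVMatrix P X Q) :
    CBV T (univ : Set (Vec (d * d))) where
  toFun t := WithLp.toLp 2 fun p => Q (finProdFinEquiv.symm p).1 (finProdFinEquiv.symm p).2 t
  mem _ := mem_univ _
  cont := (PiLp.continuous_toLp 2 _).comp (continuous_pi fun _ => hQ.continuous _ _)
  bv _ := hQ.boundedVariationOn _ _

theorem itoFunctional_toCBV (hQ : HasQVMatrix P X Q) (f : PathFun T U) (c : ℝ) (t : Time T)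
    (Z : Cadlag T U) : itoFunctional f c t Z hQ.toCBV = f t Z - c - (1 / 2) * ∑ i, ∑ j,
      lsIntegral (fun r => ppartial i (ppartial j f) r Z) (Q i j) (Iic t) := by
  rw [itoFunctional, ← Fintype.sum_prod_type' (f := fun i j =>
    lsIntegral (fun r => ppartial i (ppartial j f) r Z) (Q i j) (Iic t)),
    ← Equiv.sum_comp finProdFinEquiv.symm]
  rfl

theorem IsFlat.continuous_itoFunctional (hT : 0 ≤ T) (hU : IsOpen U) {f : Fin ν → PathFun T U}
    (hf : ∀ l, IsFlat (f l)) (c : Fin ν → ℝ) (X : CPath T U)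
    (B : CBV T (univ : Set (Vec (d * d)))) (l : Fin ν) :
    Continuous fun t => itoFunctional (f l) (c l) t X.toCadlag B := by
  obtain ⟨μ, ρ, _, hρ⟩ := B.exists_density
  have h1 := (hasDrift_of_isFlat hf μ).continuous_path hU X l
  have hreg := (hf l).toIsRegular
  unfold itoFunctional
  simp only [fun p u => hreg.lsIntegral_hessEntry hT hU X.toCadlag (hρ p) u]
  refine (h1.sub continuous_const).sub (continuous_const.mul (continuous_finsetSum _ fun p _ =>
    continuous_integral_Iic ?_))
  exact (hreg.hess_leftCont _ _).integrable hT hU (hreg.hess_bddPres _ _) _ (hρ p).integrable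

end ItoFunctional

end PathwiseIto

/-! ### Existence, representation and associativity of the pathwise Itô integral -/

theorem theorem2p2 {T : ℝ} (hT : 0 < T) {d ν : ℕ} {U : Set (Vec d)} (hU : IsOpen U)
    (P : ℕ → Finset (Time T)) (hP : IsRefiningPartition P)
    (ξ : Fin ν → Time T → Cadlag T U → Vec d) (hξ : ∀ l, IsAdmissible (ξ l))
    (X : CPath T U) (Q : Fin d → Fin d → Time T → ℝ) (hQ : HasQVMatrix P X Q) :
    -- the Itô integrals exist and define a continuous path `Y`
    ∃ Y : CPath T (Set.univ : Set (Vec ν)),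
      (∀ l t, HasItoIntegral P (ξ l) X t (Y t l)) ∧
      -- (a)
      (∃ (q : ℕ) (S : Set (Vec q)) (A : CBV T S) (F : Fin ν → Functional T U S),
        IsOpen S ∧ Represents ξ X Y F A) ∧
      -- (b) and (c), for every representation as in (a)
      (∀ (q : ℕ) (S : Set (Vec q)) (A : CBV T S) (F : Fin ν → Functional T U S),
        IsOpen S → Represents ξ X Y F A →
        -- `Φ Z` is the càdlàg path `F(·,Z,A)`
        ∃ Φ : Cadlag T U → Cadlag T (Set.univ : Set (Vec ν)),
          (∀ Z t l, Φ Z t l = F l t Z A) ∧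
          ∀ η : Time T → Cadlag T (Set.univ : Set (Vec ν)) → Vec ν, IsAdmissible η →
            ∀ ζ : Time T → Cadlag T U → Vec d,
              (∀ t Z, ζ t Z = ∑ l, η t (Φ Z) l • ξ l t Z) →
              -- (b)
              IsAdmissible ζ ∧
              (∀ s, ζ s X.toCadlag = ∑ l, η s Y.toCadlag l • ξ l s X.toCadlag) ∧
              -- (c)
              (HasQVMatrix P Y (fun k l t => ∑ i, ∑ j,
                  lsIntegral (fun s => ξ k s X.toCadlag i * ξ l s X.toCadlag j) (Q i j)
                    (Set.Iic t)) →
                ∃ I : ℝ, HasItoIntegral P η Y ⟨T, hT.le, le_rfl⟩ I ∧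
                  HasItoIntegral P ζ X ⟨T, hT.le, le_rfl⟩ I)) := by
  choose f hf hξf using fun l => (hξ l).exists_isFlat hT.le hU
  have hξp : ∀ l, pgrad (f l) = ξ l := fun l => funext fun t => funext fun Z => (hξf l t Z).symm
  -- Evaluated at the covariations of `X`, this is the right-hand side of Itô's formula for `f l`.
  let F₀ : Fin ν → Functional T U (univ : Set (Vec (d * d))) := fun l =>
    itoFunctional (f l) (f l ⟨0, le_rfl, hT.le⟩ X.toCadlag)
  let Y : CPath T (univ : Set (Vec ν)) :=
    ⟨fun t => WithLp.toLp 2 fun l => F₀ l t X.toCadlag hQ.toCBV, fun _ => mem_univ _,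
      (PiLp.continuous_toLp 2 _).comp (continuous_pi fun l =>
        IsFlat.continuous_itoFunctional hT.le hU hf
          (fun l => f l ⟨0, le_rfl, hT.le⟩ X.toCadlag) X hQ.toCBV l)⟩
  have hY : ∀ l t, HasItoIntegral P (ξ l) X t (Y t l) := fun l t => by
    have h := (hf l).hasItoIntegral hT hU hP hQ t
    rw [hξp l, ← itoFunctional_toCBV hQ] at h
    exact h
  refine ⟨Y, hY, ⟨d * d, univ, hQ.toCBV, F₀, isOpen_univ,
    fun l => (hf l).isC12c_itoFunctional hT.le hU _, fun t l => rfl, fun l t Z => ?_⟩, ?_⟩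
  · rw [← hξp l]
    exact (hf l).vgrad_itoFunctional hT.le hU _ t Z _
  intro q S A F _ hR
  choose D hD hc using fun l => (hR.isC12c l).horizontal
  -- One measure serves the given path `A` and the covariations of `X` together, so that the drift
  -- of `F` and the second-order terms can be compared almost everywhere.
  obtain ⟨μ, ρ, _, _, hρ⟩ := exists_hasLSDensity
    (Sum.elim A.component fun p : Fin d × Fin d => Q p.1 p.2)
    (Sum.rec A.continuous_component fun p => hQ.continuous p.1 p.2)
    (Sum.rec A.boundedVariationOn_component fun p => hQ.boundedVariationOn p.1 p.2)
  have hdrift := IsC12c.hasDrift hT.le hU hR.isC12c hD hc A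
    (ρ := fun i => ρ (Sum.inl i)) fun i => hρ (Sum.inl i)
  have hgrad : ∀ l, pgrad (fun t Z => F l t Z A) = ξ l := fun l => by
    funext t Z
    rw [← hR.vgrad_eq l t Z, vgrad_eq_pgrad (hR.isC12c l).nonAnticipative.stopped_right]
  obtain ⟨Φ, hΦ⟩ := hdrift.exists_pathMap hU
  have hΦX : Φ X.toCadlag = Y.toCadlag := by
    ext1
    funext t
    ext l
    rw [hΦ]
    exact (hR.eq t l).symm
  refine ⟨Φ, hΦ, fun η hη ζ hζ => ?_⟩
  obtain ⟨h, hh, hηh⟩ := hη.exists_isFlat hT.le isOpen_univ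
  have hηp : pgrad h = η := funext fun t => funext fun Z => (hηh t Z).symm
  have hζp : pgrad (driftComp μ (fun i => ρ (Sum.inl i)) (fun l i t Z => D l i t Z A) Φ h) = ζ := by
    rw [hdrift.pgrad_driftComp hT.le hU hh hΦ]
    funext t Z
    rw [hζ t Z]
    refine Finset.sum_congr rfl fun l _ => ?_
    rw [hgrad l, ppartial, hηp]
  refine ⟨?_, fun s => ?_, fun hQY => ?_⟩
  · rw [← hζp]
    exact (hdrift.isFlat_driftComp hT.le hU hh hΦ).isAdmissible
  · rw [hζ, hΦX]
  · rw [← hζp, ← hηp]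
    refine hdrift.exists_hasItoIntegral hT hU hP hQ (κ := fun i j => ρ (Sum.inr (i, j)))
      (fun i j => hρ (Sum.inr (i, j))) (fun l t => ?_) hΦ hΦX hh ?_ _
    · rw [hgrad l]
      have := hY l t
      rwa [hR.eq t l] at this
    · simp only [ppartial, hgrad]
      exact hQY
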